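/- Let $f(\mathbf z)=\mathrm{step}\big(\beta_0+\sum_{i=1}^n\beta_i f_i(\mathbf z_i)\big)$ be a generalized additive model (GAM) for classification on $\mathbb F=\mathcal X_1\times\dots\times\mathcal X_n$, where $\mathrm{step}(t)=1$ if $t\ge 0$ and $\mathrm{step}(t)=0$ otherwise, and let $\mathbf x\in\mathbb F$. For $S\subseteq[n]$ write $(\mathbf x_S;\mathbf z_{\bar S})$ for the input that agrees with $\mathbf x$ on $S$ and with $\mathbf z$ elsewhere. $S$ is a *sufficient reason* for $\langle f,\mathbf x\rangle$ if $f(\mathbf x_S;\mathbf z_{\bar S})=f(\mathbf x)$ for all $\mathbf z\in\mathbb F$, and a *contrastive reason* if $f(\mathbf x_{\bar S};\mathbf z_S)\ne f(\mathbf x)$ for some $\mathbf z\in\mathbb F$. The query CSR asks, given $(f,\mathbf x,S)$, whether $S$ is a sufficient reason; MSR (respectively MCR) asks, given $(f,\mathbf x,d)$ with $d\in\mathbb N$, whether there is a sufficient (respectively contrastive) reason $S$ with $|S|\le d$. Each of CSR, MCR and MSR is solvable in polynomial time in each of the following settings. 1. *Any GAM over an enumerable discrete domain.* Every $\mathcal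 X_i$ is a finite set of rationals given by the list of its elements (for example a fixed finite set), all $\beta_i$ are rational, and the $f_i$ come from any class of encoded rational-valued component models for which the value of a component at a point of its domain can be computed in polynomial time from the code of the component and the point. Time is measured in bit operations. 2. *Smooth GAMs over a general discrete domain.* Every $f_i$ is a cubic spline with rational data: there are knots $a_1<a_2<\dots<a_m$ with $m\ge2$, and on each of the intervals $[a_1,a_2),\dots,[a_{m-2},a_{m-1}),[a_{m-1},a_m]$ the function is a polynomial of degree at most $3$. The domain $\mathcal X_i$ is a grid $\{\ell,\ell+h,\ell+2h,\dots\}\cap[\ell,u]\subseteq[a_1,a_m]$ with rational $\ell\le u$ and $h>0$ given in binary (for integer $\ell$ and $h=1$: all integers from $\ell$ to $u$). All $\beta_i$ are rational, and time is measured in bit operations. 3. *Smooth GAMs over a continuous domain.* Every $f_i$ is a cubic spline as in 2, with real data, and $\mathcal X_i=[a_1,a_m]$; the $\beta_i$ are real. Time is measured as the number of exact real arithmetic operations, comparisons and square roots, and is polynomial in $n$ and the total number of pieces of the splines. -/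

import Mathlib

/-! ## Machines over an ordered field, with step costs -/

/-- The binary arithmetic operations that a program may apply to register contents. -/
inductive ArithOp where
  | add | sub | mul | div

/-- The value of a binary arithmetic operation (`x / 0 = 0`, as usual in Mathlib). -/
def ArithOp.apply {K : Type} [Field K] : ArithOp → K → K → K
  | .add, x, y => x + y
  | .sub, x, y => x - y
  | .mul, x, y => x * y
  | .div, x, y => x / y

/-- Tests of a branching instruction: "register `a` holds a smaller number than register `b`" and
"stack `s` is empty". -/
inductive Test where
  | less (a b : ℕ)
  | isEmpty (s : ℕ)

/-- Programs for a machine with registers, each holding one number, and stacks of numbers.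
A program is a finite object and mentions finitely many registers, stacks and (rational)
constants. -/
inductive Prog where
  /-- do nothing -/
  | skip
  /-- `register r := q` -/
  | const (r : ℕ) (q : ℚ)
  /-- `register r := (register a) o (register b)` -/
  | arith (o : ArithOp) (r a b : ℕ)
  /-- `register r := u (register a)`, where `u` is the unary primitive of the machine -/
  | unary (r a : ℕ)
  /-- push the content of register `r` onto stack `s` -/
  | push (s r : ℕ)
  /-- pop the top of stack `s` into register `r` (an empty stack delivers `0`) -/
  | pop (r s : ℕ)
  | seq (p q : Prog)
  | cond (c : Test) (p q : Prog)
  /-- repeat `p` as long as the test holds -/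
  | loop (c : Test) (p : Prog)

/-- Memory contents. -/
structure State (K : Type) where
  reg : ℕ → K
  stack : ℕ → List K

/-- A machine: the size charged for handling a number, and the unary primitive. -/
structure Machine (K : Type) where
  size : K → ℕ
  prim : K → K

/-- The number of bits of a rational number (sign, numerator and denominator in binary). -/
def ratBits (q : ℚ) : ℕ := 1 + Nat.size q.num.natAbs + Nat.size q.den

/-- The bit-cost machine: exact rational arithmetic (and rounding down to an integer), each step
charged with the number of bits of the numbers it handles. Polynomial time on this machine is
polynomial time on Turing machines. -/
def bitMachine : Machine ℚ where
  size := ratBits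
  prim := fun q => (⌊q⌋ : ℚ)

/-- The real machine: exact real arithmetic, comparisons and square roots at unit cost. -/
noncomputable def realMachine : Machine ℝ where
  size := fun _ => 1
  prim := Real.sqrt

section Semantics

variable {K : Type} [Field K] [LinearOrder K]

/-- The state `σ` with register `r` set to `x`. -/
def State.setReg (σ : State K) (r : ℕ) (x : K) : State K :=
  { σ with reg := Function.update σ.reg r x }

/-- The state `σ` with stack `s` set to `l`. -/
def State.setStack (σ : State K) (s : ℕ) (l : List K) : State K :=
  { σ with stack := Function.update σ.stack s l }

/-- The initial state: the input is on stack `0` (its first entry on top), everything else is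
zero or empty. -/
def State.start (input : List K) : State K where
  reg := fun _ => 0
  stack := fun s => if s = 0 then input else []

def Test.Holds (σ : State K) : Test → Prop
  | .less a b => σ.reg a < σ.reg b
  | .isEmpty s => σ.stack s = []

/-- The cost of a test. -/
def Test.cost (M : Machine K) (σ : State K) : Test → ℕ
  | .less a b => 1 + M.size (σ.reg a) + M.size (σ.reg b)
  | .isEmpty _ => 1

/-- `Run M P σ τ t`: the program `P`, started in state `σ`, halts in state `τ` after steps of total
cost `t`. Every step costs `1` plus the sizes of the numbers that it reads and writes; a test is
paid for each time it is evaluated. At most one rule applies to a program in a given state, so the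
machine is deterministic. -/
inductive Run (M : Machine K) : Prog → State K → State K → ℕ → Prop
  | skip (σ : State K) : Run M .skip σ σ 1
  | const (σ : State K) (r : ℕ) (q : ℚ) :
      Run M (.const r q) σ (σ.setReg r (q : K)) (1 + M.size (q : K))
  | arith (σ : State K) (o : ArithOp) (r a b : ℕ) :
      Run M (.arith o r a b) σ (σ.setReg r (o.apply (σ.reg a) (σ.reg b)))
        (1 + M.size (σ.reg a) + M.size (σ.reg b) + M.size (o.apply (σ.reg a) (σ.reg b)))
  | unary (σ : State K) (r a : ℕ) :
      Run M (.unary r a) σ (σ.setReg r (M.prim (σ.reg a)))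
        (1 + M.size (σ.reg a) + M.size (M.prim (σ.reg a)))
  | push (σ : State K) (s r : ℕ) :
      Run M (.push s r) σ (σ.setStack s (σ.reg r :: σ.stack s)) (1 + M.size (σ.reg r))
  | pop (σ : State K) (r s : ℕ) :
      Run M (.pop r s) σ ((σ.setReg r ((σ.stack s).headD 0)).setStack s (σ.stack s).tail)
        (1 + M.size ((σ.stack s).headD 0))
  | seq {σ τ υ : State K} {P Q : Prog} {t u : ℕ} :
      Run M P σ τ t → Run M Q τ υ u → Run M (.seq P Q) σ υ (t + u)
  | condTrue {σ τ : State K} {c : Test} {P Q : Prog} {t : ℕ} :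
      c.Holds σ → Run M P σ τ t → Run M (.cond c P Q) σ τ (c.cost M σ + t)
  | condFalse {σ τ : State K} {c : Test} {P Q : Prog} {t : ℕ} :
      ¬ c.Holds σ → Run M Q σ τ t → Run M (.cond c P Q) σ τ (c.cost M σ + t)
  | loopStop {σ : State K} {c : Test} {P : Prog} :
      ¬ c.Holds σ → Run M (.loop c P) σ σ (c.cost M σ)
  | loopStep {σ τ υ : State K} {c : Test} {P : Prog} {t u : ℕ} :
      c.Holds σ → Run M P σ τ t → Run M (.loop c P) τ υ u →
        Run M (.loop c P) σ υ (c.cost M σ + t + u)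

/-- The length of an input. -/
def inputSize (M : Machine K) (input : List K) : ℕ := (input.map M.size).sum

/-- The decision problem with instances `ι`, encoded as lists of numbers by `encode`, and
yes-instances `yes`, is solvable in polynomial time on the machine `M`: one program halts on every
instance within a cost polynomial in the length of the input, with `1` in register `0` on
yes-instances and `0` in register `0` on the others. -/
def SolvableInPolyTime (M : Machine K) {ι : Type} (encode : ι → List K) (yes : ι → Prop) : Prop :=
  ∃ (P : Prog) (p : Polynomial ℕ), ∀ a : ι, ∃ (τ : State K) (t : ℕ),
    Run M P (State.start (encode a)) τ t ∧
    t ≤ p.eval (inputSize M (encode a)) ∧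
    (yes a → τ.reg 0 = 1) ∧ (¬ yes a → τ.reg 0 = 0)

end Semantics

/-! ## Generalized additive models -/

/-- A way of presenting the features of a GAM: the descriptions of a feature, their encodings, and,
for each description, the domain `𝒳ᵢ` of the feature and its component function `fᵢ` (whose values
matter on the domain only). -/
structure FeatureFamily (K : Type) where
  Desc : Type
  code : Desc → List K
  dom : Desc → Set K
  component : Desc → K → K

/-- A generalized additive model with features presented in the family `F`. -/
structure GAM {K : Type} (F : FeatureFamily K) where
  n : ℕ
  intercept : K
  weight : Fin n → K
  feature : Fin n → F.Desc

section Models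

variable {K : Type} [Field K] [LinearOrder K] {F : FeatureFamily K}

/-- The input space `𝔽 = 𝒳₁ × ⋯ × 𝒳ₙ`. -/
def GAM.inputs (f : GAM F) : Set (Fin f.n → K) :=
  {z | ∀ i, z i ∈ F.dom (f.feature i)}

/-- The additive score `β₀ + β₁ f₁(z₁) + ⋯ + βₙ fₙ(zₙ)`. -/
def GAM.score (f : GAM F) (z : Fin f.n → K) : K :=
  f.intercept + ∑ i, f.weight i * F.component (f.feature i) (z i)

/-- The predicted class: the step function of the score. -/
def GAM.predict (f : GAM F) (z : Fin f.n → K) : Fin 2 :=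
  if 0 ≤ f.score z then 1 else 0

/-- `S` is a sufficient reason for `⟨f, x⟩`: `f(x_S; z_{Sᶜ}) = f(x)` for all inputs `z`. -/
def GAM.IsSufficientReason (f : GAM F) (x : Fin f.n → K) (S : Finset (Fin f.n)) : Prop :=
  ∀ z ∈ f.inputs, f.predict (S.piecewise x z) = f.predict x

/-- `S` is a contrastive reason for `⟨f, x⟩`: `f(x_{Sᶜ}; z_S) ≠ f(x)` for some input `z`. -/
def GAM.IsContrastiveReason (f : GAM F) (x : Fin f.n → K) (S : Finset (Fin f.n)) : Prop :=
  ∃ z ∈ f.inputs, f.predict (S.piecewise z x) ≠ f.predict x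

end Models

/-- A model together with one of its inputs. -/
structure ModelInput {K : Type} (F : FeatureFamily K) where
  f : GAM F
  x : Fin f.n → K
  x_mem : x ∈ f.inputs

/-- An instance `⟨f, x, S⟩`. -/
structure SubsetInstance {K : Type} (F : FeatureFamily K) extends ModelInput F where
  S : Finset (Fin f.n)

/-- An instance `⟨f, x, d⟩`. -/
structure BoundInstance {K : Type} (F : FeatureFamily K) extends ModelInput F where
  d : ℕ

section Queries

variable {K : Type} [Field K] [LinearOrder K] {F : FeatureFamily K}

/-- The encoding of a model and an input: `n`, `β₀`, and for each feature `i` the numbers `βᵢ`, `xᵢ`,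
the length of the description of feature `i`, and this description. -/
def ModelInput.encode (a : ModelInput F) : List K :=
  (a.f.n : K) :: a.f.intercept :: (List.ofFn fun i : Fin a.f.n =>
    a.f.weight i :: a.x i :: ((F.code (a.f.feature i)).length : K) :: F.code (a.f.feature i)).flatten

/-- The set `S` is encoded by its characteristic sequence. -/
def SubsetInstance.encode (a : SubsetInstance F) : List K :=
  a.toModelInput.encode ++ List.ofFn fun i : Fin a.f.n => if i ∈ a.S then (1 : K) else 0

def BoundInstance.encode (a : BoundInstance F) : List K :=
  a.toModelInput.encode ++ [(a.d : K)]

/-- Check Sufficient Reason. -/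
def CSR (a : SubsetInstance F) : Prop :=
  a.f.IsSufficientReason a.x a.S

/-- Minimum Sufficient Reason. -/
def MSR (a : BoundInstance F) : Prop :=
  ∃ S : Finset (Fin a.f.n), a.f.IsSufficientReason a.x S ∧ S.card ≤ a.d

/-- Minimum Change Required. -/
def MCR (a : BoundInstance F) : Prop :=
  ∃ S : Finset (Fin a.f.n), a.f.IsContrastiveReason a.x S ∧ S.card ≤ a.d

end Queries

/-! ## Arbitrary components over enumerable discrete domains -/

/-- A class of component models (neural networks, tree ensembles, splines, …): every code `c`, a
finite list of rational numbers, stands for the function `eval c` on the set `domain c` (which is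
empty if `c` is not the code of a component). -/
structure ComponentClass where
  domain : List ℚ → Set ℚ
  eval : List ℚ → ℚ → ℚ

/-- Inference is possible in polynomial time: one program computes the value of a component at a
point from the code of the component and the point. -/
def ComponentClass.HasPolyTimeInference (C : ComponentClass) : Prop :=
  ∃ (P : Prog) (p : Polynomial ℕ), ∀ (c : List ℚ), ∀ v ∈ C.domain c, ∃ (τ : State ℚ) (t : ℕ),
    Run bitMachine P (State.start (v :: c)) τ t ∧
    t ≤ p.eval (inputSize bitMachine (v :: c)) ∧
    τ.reg 0 = C.eval c v

/-- A component from the class `C` on a domain that is given by the list of its elements. -/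
structure EnumeratedFeature (C : ComponentClass) where
  values : List ℚ
  model : List ℚ
  values_mem : ∀ v ∈ values, v ∈ C.domain model

/-- The features with an enumerable discrete domain and a component from `C`. -/
def enumeratedFeatures (C : ComponentClass) : FeatureFamily ℚ where
  Desc := EnumeratedFeature C
  code := fun e => (e.values.length : ℚ) :: (e.values ++ e.model)
  dom := fun e => {v | v ∈ e.values}
  component := fun e => C.eval e.model

/-! ## Cubic splines -/

/-- A piecewise cubic function with `pieces` pieces, between the knots
`a₀ < a₁ < ⋯ < a_pieces`. -/
structure CubicSpline (K : Type) [Preorder K] where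
  pieces : ℕ
  pieces_pos : 0 < pieces
  knot : Fin (pieces + 1) → K
  knot_strictMono : StrictMono knot
  coeff : Fin pieces → Fin 4 → K

section Splines

variable {K : Type} [Field K] [LinearOrder K]

/-- The `j`-th interval: half-open `[aⱼ, aⱼ₊₁)`, except for the last one, which is closed. -/
def CubicSpline.interval (s : CubicSpline K) (j : Fin s.pieces) : Set K :=
  if (j : ℕ) + 1 = s.pieces then Set.Icc (s.knot j.castSucc) (s.knot j.succ)
  else Set.Ico (s.knot j.castSucc) (s.knot j.succ)

/-- The value of the spline at `v`: that of the cubic polynomial of the interval containing `v`. -/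
noncomputable def CubicSpline.eval (s : CubicSpline K) (v : K) : K :=
  ∑ j, (s.interval j).indicator (fun w => ∑ k : Fin 4, s.coeff j k * w ^ (k : ℕ)) v

/-- The number of pieces, the knots, and the coefficients of the polynomials. -/
def CubicSpline.code (s : CubicSpline K) : List K :=
  (s.pieces : K) :: (List.ofFn s.knot ++ (List.ofFn fun j => List.ofFn (s.coeff j)).flatten)

end Splines

/-- A cubic spline on a general discrete domain: the points `lo, lo + step, lo + 2 step, …` up to
`hi`, where `lo`, `hi` and `step` are given in binary (integers between two bounds, for `step = 1`
and an integer `lo`). -/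
structure GridSpline where
  spline : CubicSpline ℚ
  lo : ℚ
  hi : ℚ
  step : ℚ
  lo_le_hi : lo ≤ hi
  step_pos : 0 < step
  first_le_lo : spline.knot 0 ≤ lo
  hi_le_last : hi ≤ spline.knot (Fin.last spline.pieces)

/-- The features of Smooth GAMs over a general discrete domain. -/
noncomputable def discreteSplines : FeatureFamily ℚ where
  Desc := GridSpline
  code := fun g => g.lo :: g.hi :: g.step :: g.spline.code
  dom := fun g => {v | ∃ k : ℕ, v = g.lo + k * g.step ∧ v ≤ g.hi}
  component := fun g => g.spline.eval

/-- The features of Smooth GAMs over a continuous domain: the domain of the feature is the whole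
interval on which the spline is defined. -/
noncomputable def continuousSplines : FeatureFamily ℝ where
  Desc := CubicSpline ℝ
  code := CubicSpline.code
  dom := fun s => Set.Icc (s.knot 0) (s.knot (Fin.last s.pieces))
  component := CubicSpline.eval

/-!
The score of a generalized additive model is a sum of contributions, one for each feature, and in
`f(x_{Sᶜ}; z_S)` the features in `S` can be chosen independently of each other. Hence `S` is a
contrastive reason if and only if the score of `x`, plus the sum over `i ∈ S` of the largest change
of the contribution of feature `i` in the direction of the other class (its gain), reaches that
class (`GAM.isContrastiveReason_iff`). A set is a sufficient reason if and only if its complement is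
not a contrastive one. Gains are nonnegative, so for both kinds of reasons a set of at most `d`
features is best if it consists of the features with the largest gains
(`GAM.exists_isContrastiveReason_iff`, `GAM.exists_isSufficientReason_iff`). All three queries
therefore reduce to evaluating the components and to computing the suprema of their multiples over
the domains (`FeatureFamily.Tractable`).

A cubic spline need not attain its supremum, as the pieces are half-open and may jump at the knots.
Since the threshold inequality is weak in one direction and strict in the other, it matters whether
a sum of suprema is attained. Suprema are therefore recorded as pairs in the lexicographic product
`K ×ₗ K`, whose second component is negative if the supremum is not attained (`IsLexSup`); pairs
are added and compared like numbers with an infinitesimal part.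

The suprema are computed as follows. On an enumerated domain, all values are compared. On a real
interval, a cubic polynomial is maximal at an end or at a zero of its derivative, which a square
root delivers (`isLexSup_supCubic`). On the integers between two bounds, given in binary, the
differences of a cubic polynomial form a quadratic polynomial, which is monotone on either side of
its vertex; on each side the maximum is at an end or where the differences turn negative, and binary
search finds this place (`exists_polyNum_isGreatest_cubic`).

Running times are handled by a small calculus. `PolyList M D xs f` states that a program of `M`
computes the list `f γ` from the lists `xs γ` in polynomial time, for all `γ` that satisfy `D`. This
notion is closed under substitution (`PolyList.comp`), arithmetic, case distinctions, and loops with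
polynomially many rounds whose intermediate results have polynomial size (`PolyList.loop`). It uses
only that both machines are instances of `FeasibleMachine`. Programs pass data on stacks and assume
nothing about registers; a given inference program for components, which needs cleared registers, is
called as a subroutine (`PolyNum.of_run`).
-/

/-! ### Programs as transformations of stacks -/

section StackPrograms

/-- The properties of a machine on which all running time estimates rest: every number has positive
size, a single operation increases sizes at most linearly, and sums of many numbers stay of
polynomial size. The last property is separate because iterating the second one only gives an
exponential bound. -/
class FeasibleMachine {K : Type} [Field K] [LinearOrder K] (M : Machine K) : Prop where
  one_le_size : ∀ x, 1 ≤ M.size x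
  size_apply_le : ∀ o x y, M.size (ArithOp.apply o x y) ≤ 4 * (M.size x + M.size y) + 4
  size_prim_le : ∀ x, M.size (M.prim x) ≤ 4 * M.size x + 4
  size_sum_le : ∃ p : Polynomial ℕ, ∀ (n B : ℕ) (g : ℕ → K), (∀ i < n, M.size (g i) ≤ B) →
    M.size (∑ i ∈ Finset.range n, g i) ≤ p.eval (n + B)

variable {K : Type} [Field K] [LinearOrder K] {M : Machine K}

/-- The program `P` with every stack `s` replaced by the stack `ρ s`. -/
def Prog.renameStacks (ρ : ℕ → ℕ) : Prog → Prog
  | .skip => .skip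
  | .const r q => .const r q
  | .arith o r a b => .arith o r a b
  | .unary r a => .unary r a
  | .push s r => .push (ρ s) r
  | .pop r s => .pop r (ρ s)
  | .seq P Q => .seq (P.renameStacks ρ) (Q.renameStacks ρ)
  | .cond (.less a b) P Q => .cond (.less a b) (P.renameStacks ρ) (Q.renameStacks ρ)
  | .cond (.isEmpty s) P Q => .cond (.isEmpty (ρ s)) (P.renameStacks ρ) (Q.renameStacks ρ)
  | .loop (.less a b) P => .loop (.less a b) (P.renameStacks ρ)
  | .loop (.isEmpty s) P => .loop (.isEmpty (ρ s)) (P.renameStacks ρ)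

lemma Run.renameStacks {ρ : ℕ → ℕ} (hρ : Function.Injective ρ) {P : Prog} {σ τ : State K} {t : ℕ}
    (h : Run M P σ τ t) : ∀ S : ℕ → List K, (∀ s, S (ρ s) = σ.stack s) →
      ∃ T : ℕ → List K, Run M (P.renameStacks ρ) ⟨σ.reg, S⟩ ⟨τ.reg, T⟩ t ∧
        (∀ s, T (ρ s) = τ.stack s) ∧ ∀ s, s ∉ Set.range ρ → T s = S s := by
  induction h with
  | skip σ => exact fun S hS => ⟨S, Run.skip _, hS, fun _ _ => rfl⟩
  | const σ r q => exact fun S hS => ⟨S, Run.const ⟨σ.reg, S⟩ r q, hS, fun _ _ => rfl⟩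
  | arith σ o r a b => exact fun S hS => ⟨S, Run.arith ⟨σ.reg, S⟩ o r a b, hS, fun _ _ => rfl⟩
  | unary σ r a => exact fun S hS => ⟨S, Run.unary ⟨σ.reg, S⟩ r a, hS, fun _ _ => rfl⟩
  | push σ s r =>
    intro S hS
    refine ⟨Function.update S (ρ s) (σ.reg r :: σ.stack s), ?_, ?_, ?_⟩
    · have := Run.push (M := M) ⟨σ.reg, S⟩ (ρ s) r
      simpa [State.setStack, hS, Prog.renameStacks] using this
    · intro s'
      by_cases e : s' = s
      · subst e; simp [State.setStack]
      · simp [State.setStack, e, hρ.ne e, hS]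
    · intro s' hs'
      rw [Function.update_of_ne]
      rintro rfl
      exact hs' ⟨s, rfl⟩
  | pop σ r s =>
    intro S hS
    refine ⟨Function.update S (ρ s) (σ.stack s).tail, ?_, ?_, ?_⟩
    · have := Run.pop (M := M) ⟨σ.reg, S⟩ r (ρ s)
      simpa [State.setStack, State.setReg, hS, Prog.renameStacks] using this
    · intro s'
      by_cases e : s' = s
      · subst e; simp [State.setStack]
      · simp [State.setStack, State.setReg, e, hρ.ne e, hS]
    · intro s' hs'
      rw [Function.update_of_ne]
      rintro rfl
      exact hs' ⟨s, rfl⟩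
  | seq _ _ ih₁ ih₂ =>
    intro S hS
    obtain ⟨T, hT, hT₁, hT₂⟩ := ih₁ S hS
    obtain ⟨U, hU, hU₁, hU₂⟩ := ih₂ T hT₁
    exact ⟨U, Run.seq hT hU, hU₁, fun s hs => (hU₂ s hs).trans (hT₂ s hs)⟩
  | @condTrue σ τ c P Q t hc _ ih =>
    intro S hS
    obtain ⟨T, hT, hT₁, hT₂⟩ := ih S hS
    refine ⟨T, ?_, hT₁, hT₂⟩
    cases c with
    | less a b => exact Run.condTrue (c := .less a b) (σ := ⟨σ.reg, S⟩) hc hT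
    | isEmpty s => exact Run.condTrue (c := .isEmpty (ρ s)) ((hS s).trans hc) hT
  | @condFalse σ τ c P Q t hc _ ih =>
    intro S hS
    obtain ⟨T, hT, hT₁, hT₂⟩ := ih S hS
    refine ⟨T, ?_, hT₁, hT₂⟩
    cases c with
    | less a b => exact Run.condFalse (c := .less a b) (σ := ⟨σ.reg, S⟩) hc hT
    | isEmpty s =>
      exact Run.condFalse (c := .isEmpty (ρ s)) (fun h => hc ((hS s).symm.trans h)) hT
  | @loopStop σ c P hc =>
    intro S hS
    refine ⟨S, ?_, hS, fun _ _ => rfl⟩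
    cases c with
    | less a b => exact Run.loopStop (c := .less a b) (σ := ⟨σ.reg, S⟩) hc
    | isEmpty s =>
      exact Run.loopStop (c := .isEmpty (ρ s)) (fun h => hc ((hS s).symm.trans h))
  | @loopStep σ τ υ c P t u hc _ _ ih₁ ih₂ =>
    intro S hS
    obtain ⟨T, hT, hT₁, hT₂⟩ := ih₁ S hS
    obtain ⟨U, hU, hU₁, hU₂⟩ := ih₂ T hT₁
    refine ⟨U, ?_, hU₁, fun s hs => (hU₂ s hs).trans (hT₂ s hs)⟩
    cases c with
    | less a b => exact Run.loopStep (c := .less a b) (σ := ⟨σ.reg, S⟩) hc hT hU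
    | isEmpty s => exact Run.loopStep (c := .isEmpty (ρ s)) ((hS s).trans hc) hT hU

/-- Every number on a stack at the end was there at the start or has been paid for. -/
lemma Run.sum_inputSize_le {P : Prog} {σ τ : State K} {t : ℕ} (h : Run M P σ τ t) (n : ℕ) :
    ∑ s ∈ Finset.range n, inputSize M (τ.stack s) ≤
      ∑ s ∈ Finset.range n, inputSize M (σ.stack s) + t := by
  induction h with
  | skip | const | arith | unary | loopStop => simp [State.setReg]
  | push σ s r =>
    have key : ∀ s', inputSize M ((σ.setStack s (σ.reg r :: σ.stack s)).stack s') ≤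
        inputSize M (σ.stack s') + if s' = s then M.size (σ.reg r) else 0 := by
      intro s'
      by_cases e : s' = s
      · subst e; simp [State.setStack, inputSize]; omega
      · simp [State.setStack, e]
    refine (Finset.sum_le_sum fun s' _ => key s').trans ?_
    rw [Finset.sum_add_distrib, Finset.sum_ite_eq']
    split_ifs <;> omega
  | pop σ r s =>
    refine le_trans (Finset.sum_le_sum fun s' _ => ?_) (Nat.le_add_right _ _)
    by_cases e : s' = s
    · subst e
      cases h : σ.stack s' <;> simp [State.setStack, inputSize]
    · simp [State.setStack, State.setReg, e]
  | seq _ _ ih₁ ih₂ => omega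
  | condTrue _ _ ih => omega
  | condFalse _ _ ih => omega
  | loopStep _ _ _ ih₁ ih₂ => omega

/-- The program `P` changes the stacks from `S` to `T`, whatever the registers contain, at cost at
most `t`. Nothing is said about the registers afterwards. -/
def StackRun (M : Machine K) (P : Prog) (S T : ℕ → List K) (t : ℕ) : Prop :=
  ∀ r : ℕ → K, ∃ (r' : ℕ → K) (t' : ℕ), t' ≤ t ∧ Run M P ⟨r, S⟩ ⟨r', T⟩ t'

lemma StackRun.of_run {P : Prog} {S T : ℕ → List K} {t : ℕ}
    (h : ∀ r : ℕ → K, ∃ (τ : State K) (t' : ℕ), Run M P ⟨r, S⟩ τ t' ∧ τ.stack = T ∧ t' ≤ t) :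
    StackRun M P S T t := by
  intro r
  obtain ⟨⟨r', T'⟩, t', hr, rfl, ht⟩ := h r
  exact ⟨r', t', ht, hr⟩

lemma StackRun.mono {P : Prog} {S T : ℕ → List K} {t u : ℕ} (h : StackRun M P S T t)
    (htu : t ≤ u) : StackRun M P S T u := by
  intro r
  obtain ⟨r', t', ht, h⟩ := h r
  exact ⟨r', t', ht.trans htu, h⟩

lemma StackRun.skip (S : ℕ → List K) : StackRun M .skip S S 1 :=
  fun r => ⟨r, 1, le_rfl, Run.skip _⟩

lemma StackRun.seq {P Q : Prog} {S T U : ℕ → List K} {t u : ℕ} (h₁ : StackRun M P S T t)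
    (h₂ : StackRun M Q T U u) : StackRun M (.seq P Q) S U (t + u) := by
  intro r
  obtain ⟨r', t', ht, h⟩ := h₁ r
  obtain ⟨r'', t'', ht', h'⟩ := h₂ r'
  exact ⟨r'', t' + t'', by omega, Run.seq h h'⟩

lemma StackRun.renameStacks {ρ : ℕ → ℕ} (hρ : Function.Injective ρ) {P : Prog}
    {S T S' T' : ℕ → List K} {t : ℕ} (h : StackRun M P S T t) (hS : ∀ s, S' (ρ s) = S s)
    (hT : ∀ s, T' (ρ s) = T s) (hST : ∀ s, s ∉ Set.range ρ → T' s = S' s) :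
    StackRun M (P.renameStacks ρ) S' T' t := by
  intro r
  obtain ⟨r', t', ht, h⟩ := h r
  obtain ⟨U, hU, hU₁, hU₂⟩ := h.renameStacks hρ S' hS
  have : U = T' := by
    funext s
    by_cases hs : s ∈ Set.range ρ
    · obtain ⟨s, rfl⟩ := hs
      rw [hU₁, hT]
    · rw [hU₂ s hs, hST s hs]
  subst this
  exact ⟨r', t', ht, hU⟩

/-- Put `0` into register `0`, and `1` or `0` into register `1`, as stack `s` is nonempty or not. -/
def Prog.testNonempty (s : ℕ) : Prog :=
  .seq (.const 0 0) (.seq (.const 1 1) (.cond (.isEmpty s) (.const 1 0) .skip))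

/-- Repeat `P` as long as stack `s` is nonempty. The control registers are set anew before each
test, so `P` may overwrite all registers. -/
def Prog.whileNonempty (s : ℕ) (P : Prog) : Prog :=
  .seq (.testNonempty s) (.loop (.less 0 1) (.seq P (.testNonempty s)))

/-- A bound for the cost of `Prog.testNonempty` together with the test of the loop. -/
def testCost (M : Machine K) : ℕ := 6 + 4 * M.size 0 + 4 * M.size 1

lemma run_testNonempty [IsStrictOrderedRing K] (s : ℕ) (r : ℕ → K) (S : ℕ → List K) :
    ∃ (r' : ℕ → K) (t : ℕ), Run M (.testNonempty s) ⟨r, S⟩ ⟨r', S⟩ t ∧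
      t + (1 + M.size (r' 0) + M.size (r' 1)) ≤ testCost M ∧ (r' 0 < r' 1 ↔ S s ≠ []) := by
  by_cases h : S s = []
  · refine ⟨_, _, Run.seq (Run.const _ _ _) (Run.seq (Run.const _ _ _)
      (Run.condTrue ?_ (Run.const _ _ _))), ?_, ?_⟩
    · exact h
    · simp [State.setReg, testCost, Test.cost]
      omega
    · simp [State.setReg, h]
  · refine ⟨_, _, Run.seq (Run.const _ _ _) (Run.seq (Run.const _ _ _)
      (Run.condFalse ?_ (Run.skip _))), ?_, ?_⟩
    · exact h
    · simp [State.setReg, testCost, Test.cost]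
      omega
    · simp [State.setReg, h]

lemma StackRun.whileNonempty_stop [IsStrictOrderedRing K] {s : ℕ} {P : Prog} {S : ℕ → List K}
    (h : S s = []) : StackRun M (.whileNonempty s P) S S (testCost M) := by
  intro r
  obtain ⟨r', t, hr, ht, hlt⟩ := run_testNonempty (M := M) s r S
  refine ⟨r', _, ?_, Run.seq hr (Run.loopStop ?_)⟩
  · simpa [Test.cost] using ht
  · simp only [Test.Holds, hlt]
    simpa using h

lemma StackRun.whileNonempty_step [IsStrictOrderedRing K] {s : ℕ} {P : Prog}
    {S T U : ℕ → List K} {t u : ℕ} (h : S s ≠ []) (hP : StackRun M P S T t)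
    (hrec : StackRun M (.whileNonempty s P) T U u) :
    StackRun M (.whileNonempty s P) S U (testCost M + t + u) := by
  intro r
  obtain ⟨r₁, t₁, hr₁, ht₁, hlt₁⟩ := run_testNonempty (M := M) s r S
  obtain ⟨r₂, t₂, ht₂, hr₂⟩ := hP r₁
  obtain ⟨r₃, t₃, ht₃, hr₃⟩ := hrec r₂
  cases hr₃ with
  | seq h₁ h₂ =>
    refine ⟨r₃, _, ?_, Run.seq hr₁ (Run.loopStep ?_ (Run.seq hr₂ h₁) h₂)⟩
    · simp only [Test.cost]
      omega
    · exact hlt₁.2 h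

/-- Push the content of register `2` onto all stacks of a list. -/
def Prog.pushAll : List ℕ → Prog
  | [] => .skip
  | b :: bs => .seq (.push b 2) (Prog.pushAll bs)

/-- Empty stack `a`, pushing its numbers, from the top on, onto each of the stacks `bs`. -/
def Prog.drain (a : ℕ) (bs : List ℕ) : Prog :=
  .whileNonempty a (.seq (.pop 2 a) (.pushAll bs))

lemma run_pushAll (bs : List ℕ) (hbs : bs.Nodup) (r : ℕ → K) (S : ℕ → List K) :
    Run M (.pushAll bs) ⟨r, S⟩ ⟨r, fun s => if s ∈ bs then r 2 :: S s else S s⟩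
      (1 + bs.length * (1 + M.size (r 2))) := by
  induction bs generalizing S with
  | nil => simpa [Prog.pushAll] using Run.skip (M := M) ⟨r, S⟩
  | cons b bs ih =>
    rw [List.nodup_cons] at hbs
    have := Run.seq (Run.push (M := M) ⟨r, S⟩ b 2) (ih hbs.2 (Function.update S b (r 2 :: S b)))
    have e : (fun s => if s ∈ b :: bs then r 2 :: S s else S s) = fun s => if s ∈ bs then
        r 2 :: Function.update S b (r 2 :: S b) s else Function.update S b (r 2 :: S b) s := by
      funext s
      by_cases e : s = b
      · subst e; simp [hbs.1]
      · simp [e]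
    have e' : 1 + (b :: bs).length * (1 + M.size (r 2)) =
        1 + M.size (r 2) + (1 + bs.length * (1 + M.size (r 2))) := by
      simp only [List.length_cons]
      ring
    rw [e, e']
    exact this

/-- A bound for the cost of draining a stack, per unit of its size. -/
def drainCost (M : Machine K) (k : ℕ) : ℕ := testCost M + 2 + (k + 1) * 2

lemma stackRun_drain [IsStrictOrderedRing K] [FeasibleMachine M] {a : ℕ} {bs : List ℕ} (ha : a ∉ bs)
    (hbs : bs.Nodup) (S : ℕ → List K) :
    StackRun M (.drain a bs) S
      (fun s => if s = a then [] else if s ∈ bs then (S a).reverse ++ S s else S s)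
      (drainCost M bs.length * (inputSize M (S a) + 1)) := by
  generalize hl : S a = l
  induction l generalizing S with
  | nil =>
    have := StackRun.whileNonempty_stop (M := M) (P := .seq (.pop 2 a) (.pushAll bs)) hl
    have e : (fun s => if s = a then [] else if s ∈ bs then ([] : List K).reverse ++ S s else S s)
        = S := by
      funext s
      by_cases e : s = a
      · subst e; simp [hl]
      · simp [e]
    rw [e]
    refine this.mono ?_
    simp only [inputSize, drainCost, List.map_nil, List.sum_nil]
    omega
  | cons x l ih =>
    have h₁ : StackRun M (.seq (.pop 2 a) (.pushAll bs)) S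
        (fun s => if s ∈ bs then x :: S s else if s = a then l else S s)
        ((1 + M.size x) + (1 + bs.length * (1 + M.size x))) := by
      refine StackRun.of_run fun r =>
        ⟨_, _, Run.seq (Run.pop _ _ _) (run_pushAll bs hbs _ _), ?_, ?_⟩
      · funext s
        by_cases e : s = a
        · subst e; simp [hl, ha]
        · by_cases e' : s ∈ bs <;> simp [e, e', hl, State.setReg]
      · simp [State.setReg, hl]
    have h := StackRun.whileNonempty_step (by simp [hl]) h₁ (ih _ (by simp [ha]))
    refine StackRun.mono (t := testCost M + ((1 + M.size x) + (1 + bs.length * (1 + M.size x)))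
      + drainCost M bs.length * (inputSize M l + 1)) ?_ ?_
    · refine Eq.subst (motive := fun T => StackRun M _ S T _) ?_ h
      funext s
      by_cases e : s = a
      · simp [e]
      · by_cases e' : s ∈ bs <;> simp [e, e']
    · have hx := FeasibleMachine.one_le_size (M := M) x
      simp only [inputSize, List.map_cons, List.sum_cons, drainCost]
      nlinarith [Nat.zero_le (testCost M), Nat.mul_le_mul_left bs.length hx,
        Nat.mul_le_mul_left (testCost M) hx]

end StackPrograms

/-! ### Moving stacks around -/

section StackLists

variable {K : Type}

/-- The stacks that hold the lists `E` and are empty from `E.length` on. -/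
def stacksOf (E : List (List K)) : ℕ → List K := fun s => E.getD s []

/-- The size of a list of stacks; an empty stack counts as well. -/
def stacksSize (M : Machine K) (E : List (List K)) : ℕ := (E.map fun l => inputSize M l + 1).sum

lemma stacksOf_append_lt {A B : List (List K)} {s : ℕ} (h : s < A.length) :
    stacksOf (A ++ B) s = stacksOf A s := List.getD_append _ _ _ _ h

lemma stacksOf_append_ge {A B : List (List K)} {s : ℕ} (h : A.length ≤ s) :
    stacksOf (A ++ B) s = stacksOf B (s - A.length) := List.getD_append_right _ _ _ _ h

lemma stacksOf_append_add (A B : List (List K)) (s : ℕ) :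
    stacksOf (A ++ B) (A.length + s) = stacksOf B s := by
  rw [stacksOf_append_ge (by omega), Nat.add_sub_cancel_left]

lemma stacksOf_of_le {A : List (List K)} {s : ℕ} (h : A.length ≤ s) : stacksOf A s = [] :=
  List.getD_eq_default _ _ h

lemma stacksOf_cons_zero (l : List K) (A : List (List K)) : stacksOf (l :: A) 0 = l := rfl

lemma stacksOf_cons_succ (l : List K) (A : List (List K)) (s : ℕ) :
    stacksOf (l :: A) (s + 1) = stacksOf A s := rfl

lemma stacksOf_append_cons (A B : List (List K)) (l : List K) :
    stacksOf (A ++ l :: B) A.length = l :=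
  stacksOf_append_add A (l :: B) 0

lemma update_stacksOf_append_cons (A B : List (List K)) (l l' : List K) :
    Function.update (stacksOf (A ++ l :: B)) A.length l' = stacksOf (A ++ l' :: B) := by
  funext s
  rcases lt_trichotomy s A.length with h | rfl | h
  · rw [Function.update_of_ne h.ne, stacksOf_append_lt h, stacksOf_append_lt h]
  · simp [stacksOf_append_cons]
  · obtain ⟨k, rfl⟩ := Nat.exists_eq_add_of_lt h
    rw [Function.update_of_ne h.ne', add_assoc, stacksOf_append_add, stacksOf_append_add,
      stacksOf_cons_succ, stacksOf_cons_succ]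

lemma stacksOf_append_nil_singleton (A : List (List K)) :
    stacksOf (A ++ [[]]) = stacksOf A := by
  funext s
  rcases lt_or_ge s A.length with h | h
  · rw [stacksOf_append_lt h]
  · rw [stacksOf_append_ge h, stacksOf_of_le h]
    rcases Nat.eq_zero_or_pos (s - A.length) with e | e
    · rw [e, stacksOf_cons_zero]
    · exact stacksOf_of_le (by simpa [Nat.one_le_iff_ne_zero] using e.ne')

lemma update_stacksOf_length (A : List (List K)) (l : List K) :
    Function.update (stacksOf A) A.length l = stacksOf (A ++ [l]) := by
  rw [← stacksOf_append_nil_singleton A, update_stacksOf_append_cons]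

lemma stacksSize_append (M : Machine K) (A B : List (List K)) :
    stacksSize M (A ++ B) = stacksSize M A + stacksSize M B := by
  simp [stacksSize]

lemma stacksSize_cons (M : Machine K) (l : List K) (A : List (List K)) :
    stacksSize M (l :: A) = inputSize M l + 1 + stacksSize M A := by
  simp [stacksSize]

lemma inputSize_reverse (M : Machine K) (l : List K) :
    inputSize M l.reverse = inputSize M l := by
  simp [inputSize]

lemma inputSize_le_stacksSize {M : Machine K} {E : List (List K)} {l : List K} (h : l ∈ E) :
    inputSize M l + 1 ≤ stacksSize M E :=
  List.single_le_sum (by simp) _ (List.mem_map_of_mem h)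

lemma sum_inputSize_stacksOf (M : Machine K) (E : List (List K)) (n : ℕ) (hn : E.length ≤ n) :
    ∑ s ∈ Finset.range n, inputSize M (stacksOf E s) + E.length = stacksSize M E := by
  induction E generalizing n with
  | nil => simp [stacksSize, stacksOf, inputSize]
  | cons l E ih =>
    obtain ⟨n, rfl⟩ : ∃ m, n = m + 1 := ⟨n - 1, by simp at hn; omega⟩
    rw [Finset.sum_range_succ', stacksSize_cons, ← ih n (by simpa using hn)]
    simp only [stacksOf_cons_succ, stacksOf_cons_zero, List.length_cons]
    omega

variable [Field K] [LinearOrder K] {M : Machine K}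

lemma StackRun.stacksSize_le {P : Prog} {E E' : List (List K)} {t : ℕ}
    (h : StackRun M P (stacksOf E) (stacksOf E') t) :
    stacksSize M E' ≤ stacksSize M E + t + E'.length := by
  obtain ⟨r, t', ht, h⟩ := h 0
  have := h.sum_inputSize_le (max E.length E'.length)
  have h₁ := sum_inputSize_stacksOf M E _ (le_max_left E.length E'.length)
  have h₂ := sum_inputSize_stacksOf M E' _ (le_max_right E.length E'.length)
  simp only at this
  omega

variable [IsStrictOrderedRing K] [FeasibleMachine M]

/-- Move stack `a` onto the empty stack `b` via the empty stack `h`. -/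
def Prog.move (a b h : ℕ) : Prog := .seq (.drain a [h]) (.drain h [b])

/-- Copy stack `a` to the empty stack `b` via the empty stack `h`. -/
def Prog.copy (a b h : ℕ) : Prog := .seq (.drain a [h]) (.drain h [a, b])

lemma stackRun_move {a b h : ℕ} (hab : a ≠ b) (hah : a ≠ h) (hbh : b ≠ h) {S : ℕ → List K}
    (hb : S b = []) (hh : S h = []) :
    StackRun M (.move a b h) S (Function.update (Function.update S a []) b (S a))
      (2 * drainCost M 1 * (inputSize M (S a) + 1)) := by
  have h₁ := stackRun_drain (M := M) (a := a) (bs := [h]) (by simpa using hah) (by simp) S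
  have h₂ := stackRun_drain (M := M) (a := h) (bs := [b]) (by simpa using hbh.symm) (by simp)
    (fun s => if s = a then [] else if s ∈ [h] then (S a).reverse ++ S s else S s)
  refine ((h₁.seq h₂).mono ?_ : StackRun M (.move a b h) S _ _) |> Eq.subst (motive := fun T =>
    StackRun M _ S T (2 * drainCost M 1 * (inputSize M (S a) + 1))) ?_
  · funext s
    by_cases e : s = a
    · subst e; simp [hab, hah]
    · by_cases e' : s = h
      · subst e'; simp [hh, hbh.symm, e]
      · by_cases e'' : s = b
        · subst e''; simp [hb, hah.symm, hh, e, e']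
        · simp [e, e', e'']
  · simp [hah.symm, hh, inputSize_reverse]
    nlinarith

lemma stackRun_copy {a b h : ℕ} (hab : a ≠ b) (hah : a ≠ h) (hbh : b ≠ h) {S : ℕ → List K}
    (hb : S b = []) (hh : S h = []) :
    StackRun M (.copy a b h) S (Function.update S b (S a))
      (2 * drainCost M 2 * (inputSize M (S a) + 1)) := by
  have h₁ := stackRun_drain (M := M) (a := a) (bs := [h]) (by simpa using hah) (by simp) S
  have h₂ := stackRun_drain (M := M) (a := h) (bs := [a, b]) (by simp [hbh.symm, hah.symm])
    (by simpa using hab)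
    (fun s => if s = a then [] else if s ∈ [h] then (S a).reverse ++ S s else S s)
  refine ((h₁.seq h₂).mono ?_ : StackRun M (.copy a b h) S _ _) |> Eq.subst (motive := fun T =>
    StackRun M _ S T (2 * drainCost M 2 * (inputSize M (S a) + 1))) ?_
  · funext s
    by_cases e : s = a
    · subst e; simp [hab, hah, hah.symm, hh]
    · by_cases e' : s = h
      · subst e'; simp [hh, hbh.symm]
      · by_cases e'' : s = b
        · subst e''; simp [hb, hah.symm, hh, e, e']
        · simp [e, e', e'']
  · simp [hah.symm, hh, inputSize_reverse, drainCost]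
    nlinarith

/-- Move the `k` stacks above the empty stack `a` down by one place. -/
def Prog.shiftDown : ℕ → ℕ → Prog
  | _, 0 => .skip
  | a, k + 1 => .seq (.move (a + 1) a (a + k + 2)) (.shiftDown (a + 1) k)

lemma stackRun_shiftDown (A B : List (List K)) :
    StackRun M (.shiftDown A.length B.length) (stacksOf (A ++ [] :: B)) (stacksOf (A ++ B))
      (2 * drainCost M 1 * stacksSize M B + 1) := by
  induction B generalizing A with
  | nil =>
    rw [stacksOf_append_nil_singleton, List.append_nil]
    exact (StackRun.skip _).mono (by omega)
  | cons b B ih =>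
    have hS : stacksOf (A ++ [] :: b :: B) (A.length + 1) = b := by
      rw [stacksOf_append_add]; rfl
    have h := stackRun_move (M := M) (a := A.length + 1) (b := A.length)
      (h := A.length + B.length + 2) (by omega) (by omega) (by omega)
      (S := stacksOf (A ++ [] :: b :: B)) (stacksOf_append_cons _ _ _)
      (stacksOf_of_le (by simp; omega))
    have e : Function.update (Function.update (stacksOf (A ++ [] :: b :: B)) (A.length + 1) [])
        A.length (stacksOf (A ++ [] :: b :: B) (A.length + 1)) =
          stacksOf (A ++ [b] ++ [] :: B) := by
      rw [hS]
      have := update_stacksOf_append_cons (A ++ [[]]) B b []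
      simp only [List.length_append, List.length_singleton, List.append_assoc,
        List.singleton_append] at this
      rw [this, update_stacksOf_append_cons]
      simp
    rw [e, hS] at h
    have h' := ih (A ++ [b])
    simp only [List.length_append, List.length_singleton] at h'
    simp only [List.append_assoc, List.singleton_append] at h h'
    refine (h.seq h').mono ?_
    rw [stacksSize_cons]
    ring_nf
    omega

/-- Remove the `j` stacks from stack `a` on, moving the `k` stacks above them down. -/
def Prog.dropBlock (a : ℕ) : ℕ → ℕ → Prog
  | 0, _ => .skip
  | j + 1, k => .seq (.drain a []) (.seq (.shiftDown a (j + k)) (.dropBlock a j k))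

lemma stackRun_dropBlock (A B C : List (List K)) :
    StackRun M (.dropBlock A.length B.length C.length) (stacksOf (A ++ B ++ C))
      (stacksOf (A ++ C)) (B.length * (drainCost M 0 * stacksSize M (B ++ C) +
        2 * drainCost M 1 * stacksSize M (B ++ C) + 1) + 1) := by
  induction B with
  | nil => simpa [Prog.dropBlock] using StackRun.skip (M := M) (stacksOf (A ++ C))
  | cons b B ih =>
    have h := stackRun_drain (M := M) (a := A.length) (bs := []) (by simp) (by simp)
      (stacksOf (A ++ b :: (B ++ C)))
    have e : (fun s => if s = A.length then [] else if s ∈ ([] : List ℕ) then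
        (stacksOf (A ++ b :: (B ++ C)) A.length).reverse ++ stacksOf (A ++ b :: (B ++ C)) s
        else stacksOf (A ++ b :: (B ++ C)) s) = stacksOf (A ++ [] :: (B ++ C)) := by
      rw [← update_stacksOf_append_cons A (B ++ C) b []]
      funext s
      by_cases e : s = A.length
      · subst e; simp
      · simp [e]
    rw [e, stacksOf_append_cons] at h
    have h' := stackRun_shiftDown (M := M) A (B ++ C)
    rw [← List.append_assoc, List.length_append] at h'
    simp only [List.length_cons, List.append_assoc, List.cons_append] at h h' ih ⊢
    refine (h.seq (h'.seq ih)).mono ?_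
    rw [stacksSize_cons]
    generalize stacksSize M (B ++ C) = z
    simp only [List.length_nil]
    have : B.length * (drainCost M 0 * z + 2 * drainCost M 1 * z + 1) ≤
      B.length * (drainCost M 0 * (inputSize M b + 1 + z) +
        2 * drainCost M 1 * (inputSize M b + 1 + z) + 1) := by gcongr <;> omega
    nlinarith [Nat.zero_le (drainCost M 0 * z), Nat.zero_le (drainCost M 1 * (inputSize M b + 1))]

end StackLists

/-! ### Polynomial time functions of lists -/

section PolyTime

lemma Polynomial.eval_le_eval_of_le (p : Polynomial ℕ) {a b : ℕ} (h : a ≤ b) :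
    p.eval a ≤ p.eval b := by
  rw [Polynomial.eval_eq_sum_range, Polynomial.eval_eq_sum_range]
  gcongr

variable {K Γ : Type}

/-- The values at `γ` of a list of list-valued functions. -/
def valuesAt (xs : List (Γ → List K)) (γ : Γ) : List (List K) := xs.map fun x => x γ

lemma valuesAt_append (xs ys : List (Γ → List K)) (γ : Γ) :
    valuesAt (xs ++ ys) γ = valuesAt xs γ ++ valuesAt ys γ := by simp [valuesAt]

lemma valuesAt_cons (x : Γ → List K) (xs : List (Γ → List K)) (γ : Γ) :
    valuesAt (x :: xs) γ = x γ :: valuesAt xs γ := rfl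

lemma valuesAt_nil (γ : Γ) : valuesAt ([] : List (Γ → List K)) γ = [] := rfl

lemma length_valuesAt (xs : List (Γ → List K)) (γ : Γ) :
    (valuesAt xs γ).length = xs.length := by simp [valuesAt]

/-- On the set `D`, the function `B` is bounded by a polynomial in the total size of the
lists `xs`. -/
def PolyBounded (M : Machine K) (D : Γ → Prop) (xs : List (Γ → List K)) (B : Γ → ℕ) : Prop :=
  ∃ p : Polynomial ℕ, ∀ γ, D γ → B γ ≤ p.eval (stacksSize M (valuesAt xs γ))

variable {M : Machine K} {D : Γ → Prop} {xs ys zs : List (Γ → List K)} {B B' : Γ → ℕ}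

lemma PolyBounded.mono (h : PolyBounded M D xs B) (h' : ∀ γ, D γ → B' γ ≤ B γ) :
    PolyBounded M D xs B' := by
  obtain ⟨p, hp⟩ := h
  exact ⟨p, fun γ hγ => (h' γ hγ).trans (hp γ hγ)⟩

lemma PolyBounded.size : PolyBounded M D xs fun γ => stacksSize M (valuesAt xs γ) :=
  ⟨Polynomial.X, fun γ _ => by simp⟩

lemma PolyBounded.const (c : ℕ) : PolyBounded M D xs fun _ => c :=
  ⟨Polynomial.C c, fun γ _ => by simp⟩

lemma PolyBounded.add (h : PolyBounded M D xs B) (h' : PolyBounded M D xs B') :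
    PolyBounded M D xs fun γ => B γ + B' γ := by
  obtain ⟨p, hp⟩ := h
  obtain ⟨q, hq⟩ := h'
  exact ⟨p + q, fun γ hγ => by simpa using add_le_add (hp γ hγ) (hq γ hγ)⟩

lemma PolyBounded.mul (h : PolyBounded M D xs B) (h' : PolyBounded M D xs B') :
    PolyBounded M D xs fun γ => B γ * B' γ := by
  obtain ⟨p, hp⟩ := h
  obtain ⟨q, hq⟩ := h'
  exact ⟨p * q, fun γ hγ => by simpa using Nat.mul_le_mul (hp γ hγ) (hq γ hγ)⟩

lemma PolyBounded.eval (q : Polynomial ℕ) (h : PolyBounded M D xs B) :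
    PolyBounded M D xs fun γ => q.eval (B γ) := by
  obtain ⟨p, hp⟩ := h
  exact ⟨q.comp p, fun γ hγ => by
    rw [Polynomial.eval_comp]; exact q.eval_le_eval_of_le (hp γ hγ)⟩

lemma PolyBounded.trans (h : PolyBounded M D ys B)
    (h' : PolyBounded M D xs fun γ => stacksSize M (valuesAt ys γ)) : PolyBounded M D xs B := by
  obtain ⟨p, hp⟩ := h
  exact (h'.eval p).mono hp

variable [Field K] [LinearOrder K]

/-- One program changes, for every `γ` in `D`, the stacks `xs γ` to the stacks `ys γ` in time
polynomial in the size of `xs γ`. -/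
def PolyTrans (M : Machine K) (D : Γ → Prop) (xs ys : List (Γ → List K)) : Prop :=
  ∃ (P : Prog) (B : Γ → ℕ), PolyBounded M D xs B ∧
    ∀ γ, D γ → StackRun M P (stacksOf (valuesAt xs γ)) (stacksOf (valuesAt ys γ)) (B γ)

/-- On the set `D`, the list `f γ` can be computed in polynomial time from the lists `xs γ`: one
program adds it as a new stack above the stacks `xs γ`. -/
def PolyList (M : Machine K) (D : Γ → Prop) (xs : List (Γ → List K)) (f : Γ → List K) : Prop :=
  PolyTrans M D xs (xs ++ [f])

/-- On the set `D`, the number `f γ` can be computed in polynomial time from the lists `xs γ`. -/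
def PolyNum (M : Machine K) (D : Γ → Prop) (xs : List (Γ → List K)) (f : Γ → K) : Prop :=
  PolyList M D xs fun γ => [f γ]

lemma PolyTrans.bounded (h : PolyTrans M D xs ys) :
    PolyBounded M D xs fun γ => stacksSize M (valuesAt ys γ) := by
  obtain ⟨P, B, hB, hP⟩ := h
  refine ((PolyBounded.size.add hB).add (.const ys.length)).mono fun γ hγ => ?_
  simpa [length_valuesAt] using (hP γ hγ).stacksSize_le

lemma PolyTrans.refl : PolyTrans M D xs xs :=
  ⟨.skip, fun _ => 1, .const 1, fun _ _ => StackRun.skip _⟩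

lemma PolyTrans.trans (h : PolyTrans M D xs ys) (h' : PolyTrans M D ys zs) :
    PolyTrans M D xs zs := by
  have hb := h.bounded
  obtain ⟨P, B, hB, hP⟩ := h
  obtain ⟨Q, B', hB', hQ⟩ := h'
  exact ⟨.seq P Q, fun γ => B γ + B' γ, hB.add (hB'.trans hb), fun γ hγ =>
    (hP γ hγ).seq (hQ γ hγ)⟩

lemma PolyTrans.mono {D' : Γ → Prop} (h : PolyTrans M D xs ys) (h' : ∀ γ, D' γ → D γ) :
    PolyTrans M D' xs ys := by
  obtain ⟨P, B, ⟨p, hp⟩, hP⟩ := h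
  exact ⟨P, B, ⟨p, fun γ hγ => hp γ (h' γ hγ)⟩, fun γ hγ => hP γ (h' γ hγ)⟩

/-- A polynomial time transformation only depends on the set of pairs of an input and an output,
not on the type that indexes them. -/
lemma PolyTrans.transfer {Δ : Type} {E : Δ → Prop} {xs' ys' : List (Δ → List K)}
    (h : PolyTrans M E xs' ys') (h' : ∀ γ, D γ → ∃ δ, E δ ∧ valuesAt xs γ = valuesAt xs' δ ∧
      valuesAt ys γ = valuesAt ys' δ) : PolyTrans M D xs ys := by
  obtain ⟨P, B, ⟨p, hp⟩, hP⟩ := h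
  refine ⟨P, fun γ => p.eval (stacksSize M (valuesAt xs γ)), ⟨p, fun _ _ => le_rfl⟩,
    fun γ hγ => ?_⟩
  obtain ⟨δ, hδ, hx, hy⟩ := h' γ hγ
  simp only [hx, hy]
  exact (hP δ hδ).mono (hp δ hδ)

/-- Further stacks below those that are transformed stay as they are. -/
lemma PolyTrans.frame (h : PolyTrans M D xs ys) (zs : List (Γ → List K)) :
    PolyTrans M D (zs ++ xs) (zs ++ ys) := by
  obtain ⟨P, B, hB, hP⟩ := h
  refine ⟨P.renameStacks (zs.length + ·), B, hB.trans ?_, fun γ hγ => ?_⟩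
  · exact PolyBounded.size.mono fun γ _ => by simp [valuesAt_append, stacksSize_append]
  · refine (hP γ hγ).renameStacks (add_right_injective _) ?_ ?_ ?_
    · intro s
      rw [valuesAt_append, ← length_valuesAt zs γ, stacksOf_append_add]
    · intro s
      rw [valuesAt_append, ← length_valuesAt zs γ, stacksOf_append_add]
    · intro s hs
      have : s < (valuesAt zs γ).length := by
        rw [length_valuesAt]
        by_contra hlt
        exact hs ⟨s - zs.length, by simp; omega⟩
      rw [valuesAt_append, valuesAt_append, stacksOf_append_lt this, stacksOf_append_lt this]

/-- Results can also be put above further stacks. -/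
lemma PolyTrans.insert (h : PolyTrans M D xs (xs ++ ys)) (zs : List (Γ → List K)) :
    PolyTrans M D (xs ++ zs) (xs ++ zs ++ ys) := by
  obtain ⟨P, B, hB, hP⟩ := h
  refine ⟨P.renameStacks fun s => if s < xs.length then s else s + zs.length, B, hB.trans ?_,
    fun γ hγ => ?_⟩
  · exact PolyBounded.size.mono fun γ _ => by simp [valuesAt_append, stacksSize_append]
  · have hx := length_valuesAt xs γ
    have hz := length_valuesAt zs γ
    refine (hP γ hγ).renameStacks ?_ ?_ ?_ ?_
    · intro a b hab
      dsimp only at hab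
      split_ifs at hab <;> omega
    · intro s
      split_ifs with hs
      · rw [valuesAt_append, stacksOf_append_lt (hx.symm ▸ hs)]
      · rw [stacksOf_of_le (by rw [length_valuesAt, List.length_append]; omega),
          stacksOf_of_le (by rw [length_valuesAt]; omega)]
    · intro s
      split_ifs with hs
      · rw [valuesAt_append, valuesAt_append, valuesAt_append, List.append_assoc,
          stacksOf_append_lt (hx.symm ▸ hs), stacksOf_append_lt (hx.symm ▸ hs)]
      · rw [valuesAt_append, valuesAt_append, valuesAt_append,
          stacksOf_append_ge (by rw [List.length_append]; omega), stacksOf_append_ge (by omega),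
          List.length_append]
        congr 1
        omega
    · intro s hs
      have : s < (valuesAt (xs ++ zs) γ).length := by
        rw [length_valuesAt, List.length_append]
        by_contra hlt
        exact hs ⟨s - zs.length, by dsimp only; rw [if_neg (by omega)]; omega⟩
      rw [valuesAt_append, stacksOf_append_lt this]

lemma PolyTrans.of_forall (h : ∀ y ∈ ys, PolyList M D xs y) : PolyTrans M D xs (xs ++ ys) := by
  induction ys using List.reverseRecOn with
  | nil => simpa using PolyTrans.refl
  | append_singleton ys y ih =>
    rw [← List.append_assoc]
    exact (ih fun z hz => h z (by simp [hz])).trans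
      (PolyTrans.insert (h y (by simp)) ys)

lemma PolyList.mono {D' : Γ → Prop} {f : Γ → List K} (h : PolyList M D xs f)
    (h' : ∀ γ, D' γ → D γ) : PolyList M D' xs f := PolyTrans.mono h h'

lemma PolyList.transfer {Δ : Type} {E : Δ → Prop} {xs' : List (Δ → List K)} {f' : Δ → List K}
    {f : Γ → List K} (h : PolyList M E xs' f') (h' : ∀ γ, D γ → ∃ δ, E δ ∧
      valuesAt xs γ = valuesAt xs' δ ∧ f γ = f' δ) : PolyList M D xs f := by
  refine PolyTrans.transfer h fun γ hγ => ?_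
  obtain ⟨δ, hδ, hx, hf⟩ := h' γ hγ
  exact ⟨δ, hδ, hx, by simp [valuesAt_append, hx, valuesAt_cons, hf, valuesAt_nil]⟩

lemma PolyList.congr {f g : Γ → List K} (h : PolyList M D xs f) (hfg : ∀ γ, D γ → g γ = f γ) :
    PolyList M D xs g :=
  h.transfer fun γ hγ => ⟨γ, hγ, rfl, hfg γ hγ⟩

lemma PolyList.bounded {f : Γ → List K} (h : PolyList M D xs f) :
    PolyBounded M D xs fun γ => inputSize M (f γ) :=
  (PolyTrans.bounded h).mono fun γ _ => by
    simp [valuesAt_append, stacksSize_append, valuesAt_cons, stacksSize_cons]; omega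

/-- The rule for straight-line programs: if the lists `ys` can be computed, so can every `f` that
a program obtains from them at a cost that is polynomial in `ys`. -/
lemma PolyList.of_stackRun {f : Γ → List K} (h : ∀ y ∈ ys, PolyList M D xs y) {P : Prog}
    {B : Γ → ℕ} (hB : PolyBounded M D ys B) (hP : ∀ γ, D γ →
      StackRun M P (stacksOf (valuesAt ys γ)) (stacksOf (valuesAt [f] γ)) (B γ)) :
    PolyList M D xs f :=
  (PolyTrans.of_forall h).trans (PolyTrans.frame ⟨P, B, hB, hP⟩ xs)

variable [IsStrictOrderedRing K] [FeasibleMachine M]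

lemma PolyTrans.drop (xs ys zs : List (Γ → List K)) :
    PolyTrans M D (xs ++ ys ++ zs) (xs ++ zs) := by
  have hs : PolyBounded M D (xs ++ ys ++ zs) fun γ => stacksSize M (valuesAt (ys ++ zs) γ) :=
    PolyBounded.size.mono fun γ _ => by simp [valuesAt_append, stacksSize_append]
  refine ⟨.dropBlock xs.length ys.length zs.length, _, ((PolyBounded.const ys.length).mul
    ((((PolyBounded.const (drainCost M 0)).mul hs).add
      ((PolyBounded.const (2 * drainCost M 1)).mul hs)).add (.const 1))).add (.const 1),
    fun γ _ => ?_⟩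
  have := stackRun_dropBlock (M := M) (valuesAt xs γ) (valuesAt ys γ) (valuesAt zs γ)
  simpa only [length_valuesAt, ← valuesAt_append] using this

/-- Substitution: what can be computed from lists that can be computed from `ys` can be computed
from `ys`. -/
lemma PolyList.comp {f : Γ → List K} (h : PolyList M D xs f) (h' : ∀ x ∈ xs, PolyList M D ys x) :
    PolyList M D ys f := by
  have h₁ := (PolyTrans.of_forall h').trans (PolyTrans.frame h ys)
  rw [← List.append_assoc] at h₁
  exact h₁.trans (PolyTrans.drop ys xs [f])

lemma PolyList.var {f : Γ → List K} (h : f ∈ xs) : PolyList M D xs f := by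
  obtain ⟨as, bs, rfl⟩ := List.append_of_mem h
  refine ⟨.copy as.length (as.length + (bs.length + 1)) (as.length + (bs.length + 2)),
    fun γ => 2 * drainCost M 2 * stacksSize M (valuesAt (as ++ f :: bs) γ),
    (PolyBounded.const _).mul .size, fun γ _ => ?_⟩
  have hl : (valuesAt (as ++ f :: bs) γ).length = as.length + (bs.length + 1) := by
    simp [length_valuesAt]
  have e : stacksOf (valuesAt (as ++ f :: bs) γ) as.length = f γ := by
    rw [valuesAt_append, valuesAt_cons, ← length_valuesAt as γ, stacksOf_append_cons]
  have := stackRun_copy (M := M) (a := as.length) (b := as.length + (bs.length + 1))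
    (h := as.length + (bs.length + 2)) (by omega) (by omega) (by omega)
    (S := stacksOf (valuesAt (as ++ f :: bs) γ)) (stacksOf_of_le (by rw [hl]))
    (stacksOf_of_le (by rw [hl]; omega))
  rw [e, ← hl, update_stacksOf_length] at this
  rw [hl] at this
  rw [valuesAt_append _ [f]]
  refine this.mono (Nat.mul_le_mul_left _ ?_)
  exact inputSize_le_stacksSize (by simp [valuesAt])

end PolyTime

/-! ### Arithmetic and branching in polynomial time -/

section Primitives

set_option linter.unusedSectionVars false

variable {K Γ : Type} [Field K] [LinearOrder K] {M : Machine K} {D : Γ → Prop}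
  {xs ys : List (Γ → List K)}

lemma PolyBounded.of_le_linear {B : Γ → ℕ} (a b : ℕ)
    (h : ∀ γ, D γ → B γ ≤ a * stacksSize M (valuesAt xs γ) + b) : PolyBounded M D xs B :=
  (((PolyBounded.const a).mul .size).add (.const b)).mono h

lemma run_pop_last (A : List (List K)) (l : List K) (a : K) (r : ℕ) (ρ : ℕ → K) :
    Run M (.pop r A.length) ⟨ρ, stacksOf (A ++ [a :: l])⟩
      ⟨Function.update ρ r a, stacksOf (A ++ [l])⟩ (1 + M.size a) := by
  have := Run.pop (M := M) ⟨ρ, stacksOf (A ++ [a :: l])⟩ r A.length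
  simp only [stacksOf_append_cons, State.setReg, State.setStack, List.headD_cons, List.tail_cons,
    update_stacksOf_append_cons] at this
  exact this

lemma run_pop_singleton (A : List (List K)) (a : K) (r : ℕ) (ρ : ℕ → K) :
    Run M (.pop r A.length) ⟨ρ, stacksOf (A ++ [[a]])⟩
      ⟨Function.update ρ r a, stacksOf A⟩ (1 + M.size a) := by
  rw [← stacksOf_append_nil_singleton A]
  exact run_pop_last A [] a r ρ

lemma run_push_length (A : List (List K)) (r : ℕ) (ρ : ℕ → K) :
    Run M (.push A.length r) ⟨ρ, stacksOf A⟩ ⟨ρ, stacksOf (A ++ [[ρ r]])⟩ (1 + M.size (ρ r)) := by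
  have := Run.push (M := M) ⟨ρ, stacksOf A⟩ A.length r
  simp only [State.setStack, update_stacksOf_length, stacksOf_of_le le_rfl] at this
  exact this

lemma run_push_last (A : List (List K)) (l : List K) (r : ℕ) (ρ : ℕ → K) :
    Run M (.push A.length r) ⟨ρ, stacksOf (A ++ [l])⟩ ⟨ρ, stacksOf (A ++ [ρ r :: l])⟩
      (1 + M.size (ρ r)) := by
  have := Run.push (M := M) ⟨ρ, stacksOf (A ++ [l])⟩ A.length r
  simp only [State.setStack, update_stacksOf_append_cons, stacksOf_append_cons] at this
  exact this

variable [IsStrictOrderedRing K] [FeasibleMachine M]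

lemma PolyNum.congr {f g : Γ → K} (h : PolyNum M D xs f) (hfg : ∀ γ, D γ → g γ = f γ) :
    PolyNum M D xs g :=
  PolyList.congr h fun γ hγ => by rw [hfg γ hγ]

lemma PolyNum.mono {D' : Γ → Prop} {f : Γ → K} (h : PolyNum M D xs f)
    (h' : ∀ γ, D' γ → D γ) : PolyNum M D' xs f := PolyList.mono h h'

lemma PolyList.nil : PolyList M D xs fun _ => [] := by
  refine ⟨.skip, fun _ => 1, .const 1, fun γ _ => ?_⟩
  rw [valuesAt_append, valuesAt_cons, valuesAt_nil, stacksOf_append_nil_singleton]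
  exact StackRun.skip _

lemma PolyNum.const (q : ℚ) : PolyNum M D xs fun _ => (q : K) := by
  refine PolyList.of_stackRun (ys := []) (by simp) (P := .seq (.const 0 q) (.push 0 0))
    (.const (2 + 2 * M.size (q : K))) fun γ _ => StackRun.of_run fun r =>
      ⟨_, _, Run.seq (Run.const _ _ _) (run_push_length [] 0 _), ?_, ?_⟩
  · simp [valuesAt]
  · simp; omega

lemma PolyNum.natCast (n : ℕ) : PolyNum M D xs fun _ => (n : K) := by
  simpa using PolyNum.const (n : ℚ)

lemma PolyNum.zero : PolyNum M D xs fun _ => 0 := by simpa using PolyNum.natCast 0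

lemma PolyNum.one : PolyNum M D xs fun _ => 1 := by simpa using PolyNum.natCast 1

lemma PolyNum.apply (o : ArithOp) {a b : Γ → K} (ha : PolyNum M D xs a) (hb : PolyNum M D xs b) :
    PolyNum M D xs fun γ => o.apply (a γ) (b γ) := by
  refine PolyList.of_stackRun (ys := [fun γ => [a γ], fun γ => [b γ]]) (by simp; exact ⟨ha, hb⟩)
    (P := .seq (.pop 1 1) (.seq (.pop 0 0) (.seq (.arith o 0 0 1) (.push 0 0))))
    (.of_le_linear 12 20 fun γ _ => le_rfl) fun γ _ => StackRun.of_run fun r =>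
      ⟨_, _, Run.seq (run_pop_singleton [[a γ]] (b γ) 1 _) (Run.seq (run_pop_singleton [] _ 0 _)
        (Run.seq (Run.arith _ _ _ _ _) (run_push_length [] 0 _))), ?_, ?_⟩
  · simp [valuesAt]
  · have := FeasibleMachine.size_apply_le (M := M) o (a γ) (b γ)
    simp [valuesAt, stacksSize, inputSize]
    omega

lemma PolyNum.add {a b : Γ → K} (ha : PolyNum M D xs a) (hb : PolyNum M D xs b) :
    PolyNum M D xs fun γ => a γ + b γ := PolyNum.apply .add ha hb

lemma PolyNum.sub {a b : Γ → K} (ha : PolyNum M D xs a) (hb : PolyNum M D xs b) :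
    PolyNum M D xs fun γ => a γ - b γ := PolyNum.apply .sub ha hb

lemma PolyNum.mul {a b : Γ → K} (ha : PolyNum M D xs a) (hb : PolyNum M D xs b) :
    PolyNum M D xs fun γ => a γ * b γ := PolyNum.apply .mul ha hb

lemma PolyNum.div {a b : Γ → K} (ha : PolyNum M D xs a) (hb : PolyNum M D xs b) :
    PolyNum M D xs fun γ => a γ / b γ := PolyNum.apply .div ha hb

lemma PolyNum.neg {a : Γ → K} (ha : PolyNum M D xs a) : PolyNum M D xs fun γ => -a γ :=
  (PolyNum.zero.sub ha).congr fun γ _ => by simp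

lemma PolyNum.prim {a : Γ → K} (ha : PolyNum M D xs a) :
    PolyNum M D xs fun γ => M.prim (a γ) := by
  refine PolyList.of_stackRun (ys := [fun γ => [a γ]]) (by simp; exact ha)
    (P := .seq (.pop 0 0) (.seq (.unary 0 0) (.push 0 0)))
    (.of_le_linear 12 20 fun γ _ => le_rfl) fun γ _ => StackRun.of_run fun r =>
      ⟨_, _, Run.seq (run_pop_singleton [] (a γ) 0 _)
        (Run.seq (Run.unary _ _ _) (run_push_length [] 0 _)), ?_, ?_⟩
  · simp [valuesAt]
  · have := FeasibleMachine.size_prim_le (M := M) (a γ)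
    simp [valuesAt, stacksSize, inputSize]
    omega

lemma PolyList.head {f : Γ → List K} (hf : PolyList M D xs f) :
    PolyNum M D xs fun γ => (f γ).headD 0 := by
  have h : PolyTrans M D [f] [fun γ => (f γ).tail, fun γ => [(f γ).headD 0]] := by
    refine ⟨.seq (.pop 0 0) (.push 1 0), _, .of_le_linear 2 (2 + 2 * M.size 0)
      fun γ _ => le_rfl, fun γ _ => StackRun.of_run fun r => ?_⟩
    have h₁ : Run M (.pop 0 0) ⟨r, stacksOf [f γ]⟩
        ⟨Function.update r 0 ((f γ).headD 0), stacksOf [(f γ).tail]⟩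
        (1 + M.size ((f γ).headD 0)) := by
      have := Run.pop (M := M) ⟨r, stacksOf [f γ]⟩ 0 0
      have e := update_stacksOf_append_cons [] [] (f γ) (f γ).tail
      simp only [List.nil_append, List.length_nil] at e
      simpa [State.setReg, State.setStack, stacksOf_cons_zero, e] using this
    refine ⟨_, _, Run.seq h₁ (run_push_length [(f γ).tail] 0 _), ?_, ?_⟩
    · simp [valuesAt]
    · cases h : f γ <;> simp [valuesAt, stacksSize, inputSize, h]
      all_goals omega
  exact (PolyTrans.trans hf (h.frame xs)).trans
    (by simpa using PolyTrans.drop xs [fun γ => (f γ).tail] [fun γ => [(f γ).headD 0]])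

lemma PolyList.tail {f : Γ → List K} (hf : PolyList M D xs f) :
    PolyList M D xs fun γ => (f γ).tail := by
  refine PolyList.of_stackRun (ys := [f]) (by simpa using hf) (P := .pop 0 0)
    (B := fun γ => 1 + M.size 0 + inputSize M (f γ)) ?_ fun γ _ => StackRun.of_run fun r =>
      ⟨_, _, Run.pop _ _ _, ?_, ?_⟩
  · exact .of_le_linear 1 (1 + M.size 0) fun γ _ => by simp [valuesAt, stacksSize]; omega
  · have := update_stacksOf_append_cons [] [] (f γ) (f γ).tail
    simpa [State.setStack, State.setReg, valuesAt, stacksOf_cons_zero] using this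
  · cases h : f γ <;> simp [valuesAt, stacksOf, h, inputSize]
    omega

lemma PolyList.cons {a : Γ → K} {f : Γ → List K} (ha : PolyNum M D xs a)
    (hf : PolyList M D xs f) : PolyList M D xs fun γ => a γ :: f γ := by
  refine PolyList.of_stackRun (ys := [f, fun γ => [a γ]]) (by simp; exact ⟨hf, ha⟩)
    (P := .seq (.pop 0 1) (.push 0 0))
    (.of_le_linear 2 2 fun γ _ => le_rfl) fun γ _ => StackRun.of_run fun r =>
      ⟨_, _, Run.seq (run_pop_singleton [f γ] (a γ) 0 _) (run_push_last [] (f γ) 0 _), ?_, ?_⟩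
  · simp [valuesAt]
  · simp [valuesAt, stacksSize, inputSize]
    omega

/-- On the set `D`, the predicate `p` can be decided in polynomial time from the lists `xs`. -/
def PolyPred (M : Machine K) (D : Γ → Prop) (xs : List (Γ → List K)) (p : Γ → Prop) : Prop :=
  open Classical in PolyNum M D xs fun γ => if p γ then 1 else 0

open Classical in
lemma PolyPred.congr {p q : Γ → Prop} (h : PolyPred M D xs p) (hpq : ∀ γ, D γ → (q γ ↔ p γ)) :
    PolyPred M D xs q :=
  PolyNum.congr h fun γ hγ => if_congr (hpq γ hγ) rfl rfl

lemma PolyPred.not {p : Γ → Prop} (h : PolyPred M D xs p) : PolyPred M D xs fun γ => ¬ p γ :=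
  (PolyNum.one.sub h).congr fun γ _ => by by_cases h : p γ <;> simp [h]

lemma PolyPred.and {p q : Γ → Prop} (h : PolyPred M D xs p) (h' : PolyPred M D xs q) :
    PolyPred M D xs fun γ => p γ ∧ q γ :=
  (PolyNum.mul h h').congr fun γ _ => by by_cases h : p γ <;> by_cases h' : q γ <;> simp [h, h']

lemma PolyPred.or {p q : Γ → Prop} (h : PolyPred M D xs p) (h' : PolyPred M D xs q) :
    PolyPred M D xs fun γ => p γ ∨ q γ :=
  (h.not.and h'.not).not.congr fun _ _ => by tauto

lemma PolyPred.lt {a b : Γ → K} (ha : PolyNum M D xs a) (hb : PolyNum M D xs b) :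
    PolyPred M D xs fun γ => a γ < b γ := by
  classical
  refine PolyList.of_stackRun (ys := [fun γ => [a γ], fun γ => [b γ]]) (by simp; exact ⟨ha, hb⟩)
    (P := .seq (.pop 1 1) (.seq (.pop 0 0) (.seq (.cond (.less 0 1) (.const 0 1) (.const 0 0))
      (.push 0 0)))) (.of_le_linear 2 (5 + 2 * M.size 0 + 2 * M.size 1) fun γ _ => le_rfl)
    fun γ _ => StackRun.of_run fun r => ?_
  by_cases h : a γ < b γ
  · refine ⟨_, _, Run.seq (run_pop_singleton [[a γ]] (b γ) 1 _) (Run.seq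
      (run_pop_singleton [] _ 0 _) (Run.seq (Run.condTrue ?_ (Run.const _ _ _))
        (run_push_length [] 0 _))), ?_, ?_⟩
    · simpa [Test.Holds] using h
    · simp [valuesAt, h]
    · simp [valuesAt, stacksSize, inputSize, Test.cost]
      omega
  · refine ⟨_, _, Run.seq (run_pop_singleton [[a γ]] (b γ) 1 _) (Run.seq
      (run_pop_singleton [] _ 0 _) (Run.seq (Run.condFalse ?_ (Run.const _ _ _))
        (run_push_length [] 0 _))), ?_, ?_⟩
    · simpa [Test.Holds] using h
    · simp [valuesAt, h]
    · simp [valuesAt, stacksSize, inputSize, Test.cost]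
      omega

lemma PolyPred.le {a b : Γ → K} (ha : PolyNum M D xs a) (hb : PolyNum M D xs b) :
    PolyPred M D xs fun γ => a γ ≤ b γ :=
  (PolyPred.lt hb ha).not.congr fun γ _ => by simp

lemma PolyPred.eq {a b : Γ → K} (ha : PolyNum M D xs a) (hb : PolyNum M D xs b) :
    PolyPred M D xs fun γ => a γ = b γ :=
  ((PolyPred.le ha hb).and (PolyPred.le hb ha)).congr fun _ _ => le_antisymm_iff

lemma PolyList.ite {p : Γ → Prop} [DecidablePred p] {f g : Γ → List K} (hp : PolyPred M D xs p)
    (hf : PolyList M (fun γ => D γ ∧ p γ) xs f) (hg : PolyList M (fun γ => D γ ∧ ¬ p γ) xs g) :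
    PolyList M D xs fun γ => if p γ then f γ else g γ := by
  have hp : PolyNum M D xs fun γ => if p γ then 1 else 0 := PolyNum.congr hp fun _ _ => by congr
  obtain ⟨P, _, ⟨b, hB⟩, hP⟩ := hf
  obtain ⟨Q, _, ⟨c, hC⟩, hQ⟩ := hg
  refine PolyTrans.trans (PolyTrans.of_forall (ys := [fun γ => [if p γ then 1 else 0]])
    (by simp; exact hp)) ⟨.seq (.pop 1 xs.length) (.seq (.const 0 0) (.cond (.less 0 1) P Q)),
    fun γ => b.eval (stacksSize M (valuesAt xs γ)) + c.eval (stacksSize M (valuesAt xs γ)) +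
      (3 + 4 * M.size 0 + 4 * M.size 1), ?_, fun γ hγ => ?_⟩
  · have h : PolyBounded M D (xs ++ [fun γ => [if p γ then 1 else 0]])
        fun γ => stacksSize M (valuesAt xs γ) :=
      PolyBounded.size.mono fun γ _ => by simp [valuesAt_append, stacksSize_append]
    exact ((h.eval b).add (h.eval c)).add (.const _)
  · intro r
    have h₀ := run_pop_singleton (M := M) (valuesAt xs γ) (if p γ then 1 else 0) 1 r
    rw [length_valuesAt] at h₀
    rw [valuesAt_append, valuesAt_append]
    by_cases h : p γ
    · obtain ⟨r', t, ht, hr⟩ := hP γ ⟨hγ, h⟩ (Function.update (Function.update r 1 1) 0 0)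
      rw [valuesAt_append] at hr
      have hb := hB γ ⟨hγ, h⟩
      simp only [if_pos h] at h₀
      simp only [valuesAt_cons, valuesAt_nil, if_pos h] at hr ⊢
      refine ⟨r', _, ?_, Run.seq h₀ (Run.seq (Run.const _ _ _) (Run.condTrue ?_
        (by simpa [State.setReg] using hr)))⟩
      · simp [Test.cost, State.setReg]
        omega
      · simp [Test.Holds, State.setReg]
    · obtain ⟨r', t, ht, hr⟩ := hQ γ ⟨hγ, h⟩ (Function.update (Function.update r 1 0) 0 0)
      rw [valuesAt_append] at hr
      have hb := hC γ ⟨hγ, h⟩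
      simp only [if_neg h] at h₀
      simp only [valuesAt_cons, valuesAt_nil, if_neg h] at hr ⊢
      refine ⟨r', _, ?_, Run.seq h₀ (Run.seq (Run.const _ _ _) (Run.condFalse ?_
        (by simpa [State.setReg] using hr)))⟩
      · simp [Test.cost, State.setReg]
        omega
      · simp [Test.Holds, State.setReg]

lemma PolyNum.ite {p : Γ → Prop} [DecidablePred p] {f g : Γ → K} (hp : PolyPred M D xs p)
    (hf : PolyNum M (fun γ => D γ ∧ p γ) xs f) (hg : PolyNum M (fun γ => D γ ∧ ¬ p γ) xs g) :
    PolyNum M D xs fun γ => if p γ then f γ else g γ :=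
  (PolyList.ite hp hf hg).congr fun γ _ => by beta_reduce; split_ifs <;> rfl

end Primitives

/-! ### Loops in polynomial time -/

section Loops

set_option linter.unusedSectionVars false

variable {K Γ : Type} [Field K] [LinearOrder K] {M : Machine K} {D : Γ → Prop}
  {xs : List (Γ → List K)} [IsStrictOrderedRing K] [FeasibleMachine M] {N : Γ → ℕ}

/-- Functions on `Γ`, regarded as functions on `Γ × ℕ`. -/
def liftFst (xs : List (Γ → List K)) : List (Γ × ℕ → List K) := xs.map fun x p => x p.1

lemma valuesAt_liftFst (xs : List (Γ → List K)) (p : Γ × ℕ) :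
    valuesAt (liftFst xs) p = valuesAt xs p.1 := by
  simp [valuesAt, liftFst]

lemma length_liftFst (xs : List (Γ → List K)) : (liftFst xs).length = xs.length := by
  simp [liftFst]

/-- What can be computed at `γ` from `xs` can be computed at `(γ, i)`. -/
lemma PolyList.lift {f : Γ → List K} {E : Γ × ℕ → Prop} {zs : List (Γ × ℕ → List K)}
    (h : PolyList M D xs f) (hE : ∀ p, E p → D p.1) (hzs : liftFst xs ⊆ zs) :
    PolyList M E zs fun p => f p.1 :=
  PolyList.comp (h.transfer fun p hp => ⟨p.1, hE p hp, valuesAt_liftFst _ _, rfl⟩)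
    fun _ hx => PolyList.var (hzs hx)

lemma PolyNum.lift {f : Γ → K} {E : Γ × ℕ → Prop} {zs : List (Γ × ℕ → List K)}
    (h : PolyNum M D xs f) (hE : ∀ p, E p → D p.1) (hzs : liftFst xs ⊆ zs) :
    PolyNum M E zs fun p => f p.1 :=
  PolyList.lift h hE hzs

lemma stacksSize_le_of_forall {E : List (List K)} {B : ℕ} (h : ∀ l ∈ E, inputSize M l ≤ B) :
    stacksSize M E ≤ E.length * (B + 1) := by
  induction E with
  | nil => simp [stacksSize]
  | cons l E ih =>
    have h₁ := ih fun l hl => h l (by simp [hl])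
    have h₂ := h l (by simp)
    rw [stacksSize_cons, List.length_cons]
    nlinarith

/-- Loops: the lists `y (γ, i)`, for `y` in `y₀ :: ys`, are updated in each round until `y₀` is
empty, which happens after `N γ` rounds. The running time is polynomial if the number of rounds and
the sizes of the lists are. -/
lemma PolyList.loop {y₀ : Γ × ℕ → List K} {ys : List (Γ × ℕ → List K)} {B : Γ → ℕ}
    (hN : PolyBounded M D xs N) (hB : PolyBounded M D xs B)
    (hsize : ∀ γ, D γ → ∀ i ≤ N γ, ∀ y ∈ y₀ :: ys, inputSize M (y (γ, i)) ≤ B γ)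
    (h₀ : ∀ y ∈ y₀ :: ys, PolyList M D xs fun γ => y (γ, 0))
    (hs : ∀ y ∈ y₀ :: ys, PolyList M (fun p => D p.1 ∧ p.2 < N p.1) (liftFst xs ++ y₀ :: ys)
      fun p => y (p.1, p.2 + 1))
    (hc : ∀ γ, D γ → ∀ i ≤ N γ, (y₀ (γ, i) = [] ↔ i = N γ)) :
    ∀ y ∈ y₀ :: ys, PolyList M D xs fun γ => y (γ, N γ) := by
  obtain ⟨P, _, ⟨p, hp⟩, hP⟩ := (PolyTrans.of_forall
    (ys := (y₀ :: ys).map fun y (p : Γ × ℕ) => y (p.1, p.2 + 1)) (by simpa using hs)).trans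
      (PolyTrans.drop (liftFst xs) (y₀ :: ys) _)
  have hinit := PolyTrans.of_forall (ys := (y₀ :: ys).map fun y γ => y (γ, 0)) (by simpa using h₀)
  -- a bound for the size of all stacks, at any time at which the test is evaluated
  set S : Γ → ℕ := fun γ => stacksSize M (valuesAt xs γ) + (ys.length + 1) * (B γ + 1) with hS
  have hSle : ∀ γ, D γ → ∀ i ≤ N γ,
      stacksSize M (valuesAt (liftFst xs ++ y₀ :: ys) (γ, i)) ≤ S γ := by
    intro γ hγ i hi
    rw [valuesAt_append, stacksSize_append, valuesAt_liftFst]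
    refine Nat.add_le_add_left ?_ _
    have := stacksSize_le_of_forall (M := M) (E := valuesAt (y₀ :: ys) (γ, i)) (B := B γ)
      (by simpa [valuesAt] using hsize γ hγ i hi)
    rwa [length_valuesAt, List.length_cons] at this
  have hrun : ∀ γ, D γ → ∀ k ≤ N γ, StackRun M (.whileNonempty xs.length P)
      (stacksOf (valuesAt (liftFst xs ++ y₀ :: ys) (γ, N γ - k)))
      (stacksOf (valuesAt (liftFst xs ++ y₀ :: ys) (γ, N γ)))
      ((k + 1) * (testCost M + p.eval (S γ))) := by
    intro γ hγ k
    have htop : ∀ i, stacksOf (valuesAt (liftFst xs ++ y₀ :: ys) (γ, i)) xs.length =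
        y₀ (γ, i) := by
      intro i
      rw [valuesAt_append, valuesAt_cons, ← length_liftFst xs,
        ← length_valuesAt (liftFst xs) (γ, i), stacksOf_append_cons]
    induction k with
    | zero =>
      intro _
      exact (StackRun.whileNonempty_stop (by rw [htop, hc γ hγ _ (by omega)]; omega)).mono
        (by simp)
    | succ k ih =>
      intro hk
      have h₁ := hP (γ, N γ - (k + 1)) ⟨hγ, by dsimp only; omega⟩
      have e : valuesAt (liftFst xs ++ (y₀ :: ys).map fun y (p : Γ × ℕ) => y (p.1, p.2 + 1))
          (γ, N γ - (k + 1)) = valuesAt (liftFst xs ++ y₀ :: ys) (γ, N γ - k) := by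
        simp only [valuesAt_append, valuesAt_liftFst]
        simp [valuesAt, show N γ - (k + 1) + 1 = N γ - k by omega]
      rw [e] at h₁
      refine (StackRun.whileNonempty_step ?_ h₁ (ih (by omega))).mono ?_
      · rw [htop, ne_eq, hc γ hγ _ (by omega)]
        omega
      · have := (hp (γ, N γ - (k + 1)) ⟨hγ, by dsimp only; omega⟩).trans
          (p.eval_le_eval_of_le (hSle γ hγ (N γ - (k + 1)) (by omega)))
        linarith
  have hloop : PolyTrans M D (xs ++ (y₀ :: ys).map fun y γ => y (γ, 0))
      (xs ++ (y₀ :: ys).map fun y γ => y (γ, N γ)) := by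
    refine ⟨.whileNonempty xs.length P, fun γ => (N γ + 1) * (testCost M + p.eval (S γ)), ?_,
      fun γ hγ => ?_⟩
    · have hx : PolyBounded M D (xs ++ (y₀ :: ys).map fun y γ => y (γ, 0))
          fun γ => stacksSize M (valuesAt xs γ) :=
        PolyBounded.size.mono fun γ _ => by simp [valuesAt_append, stacksSize_append]
      exact ((hN.trans hx).add (.const 1)).mul ((PolyBounded.const _).add
        (PolyBounded.eval p (hx.add ((PolyBounded.const _).mul ((hB.trans hx).add (.const 1))))))
    · have := hrun γ hγ (N γ) le_rfl
      simp only [Nat.sub_self, valuesAt_append, valuesAt_liftFst] at this ⊢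
      simpa [valuesAt, Function.comp_def] using this
  intro y hy
  have hy' : PolyList M D (xs ++ (y₀ :: ys).map fun y γ => y (γ, N γ)) fun γ => y (γ, N γ) :=
    PolyList.var (List.mem_append_right _ (List.mem_map.2 ⟨y, hy, rfl⟩))
  exact ((hinit.trans hloop).trans hy').trans (PolyTrans.drop xs _ _)

lemma exists_size_natCast_le (M : Machine K) [FeasibleMachine M] :
    ∃ p : Polynomial ℕ, ∀ n i : ℕ, i ≤ n → M.size (i : K) ≤ p.eval n := by
  obtain ⟨p, hp⟩ := FeasibleMachine.size_sum_le (M := M)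
  refine ⟨p.comp (.X + .C (M.size 1)), fun n i hi => ?_⟩
  have := hp i (M.size 1) (fun _ => 1) (fun _ _ => le_rfl)
  simp only [Finset.sum_const, Finset.card_range, nsmul_eq_mul, mul_one] at this
  rw [Polynomial.eval_comp]
  exact this.trans (p.eval_le_eval_of_le (by simpa using hi))

/-- The loop counter as a function on `Γ × ℕ`. -/
def loopIndex (K Γ : Type) [Field K] : Γ × ℕ → List K := fun p => [(p.2 : K)]

lemma PolyNum.counter {E : Γ × ℕ → Prop} {zs : List (Γ × ℕ → List K)}
    (h : loopIndex K Γ ∈ zs) : PolyNum M E zs fun p => (p.2 : K) :=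
  PolyList.var h

/-- A value computed in the rounds of a loop is polynomially bounded, uniformly over all rounds. -/
lemma PolyList.bounded_loop {f : Γ × ℕ → List K} (hN : PolyBounded M D xs N)
    (hf : PolyList M (fun p => D p.1 ∧ p.2 < N p.1) (liftFst xs ++ [loopIndex K Γ]) f) :
    ∃ B, PolyBounded M D xs B ∧ ∀ γ, D γ → ∀ i < N γ, inputSize M (f (γ, i)) ≤ B γ := by
  obtain ⟨p, hp⟩ := hf.bounded
  obtain ⟨q, hq⟩ := exists_size_natCast_le M
  refine ⟨_, PolyBounded.eval p ((PolyBounded.size.add (.eval q hN)).add (.const 1)),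
    fun γ hγ i hi => (hp (γ, i) ⟨hγ, hi⟩).trans (p.eval_le_eval_of_le ?_)⟩
  have := hq (N γ) i hi.le
  simp only [valuesAt_append, valuesAt_liftFst, stacksSize_append]
  simp [valuesAt, loopIndex, stacksSize, inputSize] at this ⊢
  omega

/-- Counting loops: `N γ` rounds, where the number `N γ` can be computed; the rounds may use the
loop counter. -/
lemma PolyList.iterate {ys : List (Γ × ℕ → List K)} {B : Γ → ℕ}
    (hNc : PolyNum M D xs fun γ => (N γ : K))
    (hN : PolyBounded M D xs N) (hB : PolyBounded M D xs B)
    (hsize : ∀ γ, D γ → ∀ i ≤ N γ, ∀ y ∈ ys, inputSize M (y (γ, i)) ≤ B γ)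
    (h₀ : ∀ y ∈ ys, PolyList M D xs fun γ => y (γ, 0))
    (hs : ∀ y ∈ ys, PolyList M (fun p => D p.1 ∧ p.2 < N p.1)
      (liftFst xs ++ loopIndex K Γ :: ys) fun p => y (p.1, p.2 + 1)) :
    ∀ y ∈ ys, PolyList M D xs fun γ => y (γ, N γ) := by
  obtain ⟨q, hq⟩ := exists_size_natCast_le M
  set c : Γ × ℕ → List K := fun p => if p.2 < N p.1 then [1] else [] with hcdef
  have key := PolyList.loop (y₀ := c) (ys := loopIndex K Γ :: ys) hN
    ((hB.add (.eval q hN)).add (.const (M.size 1))) ?_ ?_ ?_ ?_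
  · exact fun y hy => key y (by simp [hy])
  · intro γ hγ i hi y hy
    simp only [List.mem_cons] at hy
    rcases hy with rfl | rfl | hy
    · simp only [hcdef, inputSize]
      split_ifs <;> simp
    · have := hq _ i hi
      simp [loopIndex, inputSize]
      omega
    · have := hsize γ hγ i hi y hy
      omega
  · intro y hy
    simp only [List.mem_cons] at hy
    rcases hy with rfl | rfl | hy
    · refine PolyList.ite (p := fun γ => 0 < N γ) ?_ PolyNum.one .nil
      exact (PolyPred.lt .zero hNc).congr fun γ _ => by simp
    · exact PolyNum.zero.congr fun _ _ => by simp
    · exact h₀ y hy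
  · intro y hy
    have hidx : PolyNum M (fun p : Γ × ℕ => D p.1 ∧ p.2 < N p.1)
        (liftFst xs ++ c :: loopIndex K Γ :: ys) fun p => (p.2 : K) :=
      PolyNum.counter (by simp)
    have hidx' := (hidx.add .one).congr (g := fun p : Γ × ℕ => ((p.2 + 1 : ℕ) : K))
      fun _ _ => by simp
    simp only [List.mem_cons] at hy
    rcases hy with rfl | rfl | hy
    · refine PolyList.ite (p := fun p : Γ × ℕ => p.2 + 1 < N p.1) ?_ PolyNum.one .nil
      refine (PolyPred.lt hidx' ?_).congr fun p _ => (Nat.cast_lt (α := K)).symm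
      exact hNc.lift (fun p hp => hp.1) (by simp)
    · exact hidx'
    · refine (hs y hy).comp fun x hx => PolyList.var ?_
      simp only [List.mem_append, List.mem_cons] at hx ⊢
      tauto
  · intro γ hγ i hi
    simp [hcdef]
    omega

/-- A counting loop that updates one list. -/
lemma PolyList.iterate_single {y : Γ × ℕ → List K} {B : Γ → ℕ}
    (hNc : PolyNum M D xs fun γ => (N γ : K)) (hN : PolyBounded M D xs N)
    (hB : PolyBounded M D xs B) (hsize : ∀ γ, D γ → ∀ i ≤ N γ, inputSize M (y (γ, i)) ≤ B γ)
    (h₀ : PolyList M D xs fun γ => y (γ, 0))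
    (hs : PolyList M (fun p => D p.1 ∧ p.2 < N p.1) (liftFst xs ++ [loopIndex K Γ, y])
      fun p => y (p.1, p.2 + 1)) :
    PolyList M D xs fun γ => y (γ, N γ) :=
  PolyList.iterate (ys := [y]) hNc hN hB (by simpa using hsize) (by simpa using h₀)
    (by simpa using hs) y (by simp)

lemma PolyNum.sum {g : Γ × ℕ → K} (hNc : PolyNum M D xs fun γ => (N γ : K))
    (hN : PolyBounded M D xs N) (hg : PolyNum M (fun p => D p.1 ∧ p.2 < N p.1)
      (liftFst xs ++ [loopIndex K Γ]) g) :
    PolyNum M D xs fun γ => ∑ i ∈ Finset.range (N γ), g (γ, i) := by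
  obtain ⟨B, hB, hBg⟩ := PolyList.bounded_loop hN hg
  obtain ⟨p, hp⟩ := FeasibleMachine.size_sum_le (M := M)
  refine PolyList.iterate_single (y := fun p => [∑ i ∈ Finset.range p.2, g (p.1, i)]) hNc hN
    (PolyBounded.eval p (hN.add hB)) ?_ ?_ ?_
  · intro γ hγ i hi
    simp only [inputSize, List.map_cons, List.map_nil, List.sum_cons, List.sum_nil, add_zero]
    refine (hp i (B γ) (fun j => g (γ, j)) fun j hj => ?_).trans
      (p.eval_le_eval_of_le (by omega))
    simpa [inputSize] using hBg γ hγ j (by omega)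
  · exact PolyNum.zero.congr fun _ _ => by simp
  · simp only [Finset.sum_range_succ]
    refine PolyNum.add (PolyList.var (by simp)) (PolyList.comp hg fun x hx => PolyList.var ?_)
    simp only [List.mem_append, List.mem_cons, List.not_mem_nil, or_false] at hx ⊢
    tauto

lemma length_le_inputSize (M : Machine K) [FeasibleMachine M] (l : List K) :
    l.length ≤ inputSize M l := by
  induction l with
  | nil => simp
  | cons x l ih =>
    have := FeasibleMachine.one_le_size (M := M) x
    simp only [inputSize, List.map_cons, List.sum_cons, List.length_cons] at ih ⊢
    omega

lemma inputSize_le_of_sublist (M : Machine K) {l l' : List K} (h : l.Sublist l') :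
    inputSize M l ≤ inputSize M l' :=
  (h.map M.size).sum_le_sum (by simp)

lemma PolyList.bounded_length {f : Γ → List K} (hf : PolyList M D xs f)
    (hN : ∀ γ, D γ → N γ ≤ (f γ).length) : PolyBounded M D xs N :=
  hf.bounded.mono fun γ hγ => (hN γ hγ).trans (length_le_inputSize M _)

lemma PolyList.drop {f : Γ → List K} (hf : PolyList M D xs f)
    (hNc : PolyNum M D xs fun γ => (N γ : K)) (hN : ∀ γ, D γ → N γ ≤ (f γ).length) :
    PolyList M D xs fun γ => (f γ).drop (N γ) := by
  refine PolyList.iterate_single (y := fun p => (f p.1).drop p.2) hNc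
    (hf.bounded_length hN) hf.bounded ?_ ?_ ?_
  · exact fun γ hγ i hi => inputSize_le_of_sublist M (List.drop_sublist i (f γ))
  · simpa using hf
  · have : PolyList M (fun p : Γ × ℕ => D p.1 ∧ p.2 < N p.1)
      (liftFst xs ++ [loopIndex K Γ, fun p => (f p.1).drop p.2])
        fun p => (f p.1).drop p.2 := PolyList.var (by simp)
    exact this.tail.congr fun p _ => by simp

lemma PolyNum.getD {f : Γ → List K} (hf : PolyList M D xs f)
    (hNc : PolyNum M D xs fun γ => (N γ : K)) (hN : ∀ γ, D γ → N γ ≤ (f γ).length) :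
    PolyNum M D xs fun γ => (f γ).getD (N γ) 0 :=
  (hf.drop hNc hN).head.congr fun γ _ => by
    simp [List.head?_drop]

lemma PolyList.take {f : Γ → List K} (hf : PolyList M D xs f)
    (hNc : PolyNum M D xs fun γ => (N γ : K)) (hN : ∀ γ, D γ → N γ ≤ (f γ).length) :
    PolyList M D xs fun γ => (f γ).take (N γ) := by
  -- the list is built from its end, as only its head is accessible
  have key := PolyList.iterate_single (y := fun p => ((f p.1).drop (N p.1 - p.2)).take p.2) hNc
    (hf.bounded_length hN) hf.bounded ?_ ?_ ?_
  · simpa using key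
  · exact fun γ hγ i hi => inputSize_le_of_sublist M
      ((List.take_sublist _ _).trans (List.drop_sublist _ _))
  · simpa using PolyList.nil
  · set ctx := liftFst xs ++
      [loopIndex K Γ, fun p => ((f p.1).drop (N p.1 - p.2)).take p.2] with hctx
    have hsub : liftFst xs ⊆ ctx := by simp [hctx]
    have hidx : PolyNum M (fun p : Γ × ℕ => D p.1 ∧ p.2 < N p.1) ctx fun p => (p.2 : K) :=
      PolyNum.counter (by simp [hctx])
    have hN' : PolyNum M (fun p : Γ × ℕ => D p.1 ∧ p.2 < N p.1) ctx
        fun p => ((N p.1 - (p.2 + 1) : ℕ) : K) :=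
      ((hNc.lift (fun p hp => hp.1) hsub).sub
        (hidx.add .one)).congr fun p hp => by rw [Nat.cast_sub hp.2]; simp
    have hf' : PolyList M (fun p : Γ × ℕ => D p.1 ∧ p.2 < N p.1) ctx fun p => f p.1 :=
      hf.lift (fun p hp => hp.1) hsub
    refine (PolyList.cons (PolyNum.getD hf' hN' fun p hp => ?_) (PolyList.var (f := fun p : Γ × ℕ =>
        ((f p.1).drop (N p.1 - p.2)).take p.2) (by simp [hctx]))).congr fun p hp => ?_
    · have := hN p.1 hp.1
      omega
    · have h₁ := hN p.1 hp.1
      have h₂ := hp.2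
      dsimp only
      rw [List.drop_eq_getElem_cons (i := N p.1 - (p.2 + 1)) (by omega),
        List.getD_eq_getElem _ _ (by omega), List.take_succ_cons,
        show N p.1 - (p.2 + 1) + 1 = N p.1 - p.2 by omega]

end Loops

/-! ### The two machines -/

section Machines

instance : FeasibleMachine realMachine where
  one_le_size _ := le_rfl
  size_apply_le _ _ _ := by simp [realMachine]
  size_prim_le _ := by simp [realMachine]
  size_sum_le := ⟨1, fun _ _ _ _ => by simp [realMachine]⟩

lemma Nat.size_mul_le (m n : ℕ) : Nat.size (m * n) ≤ Nat.size m + Nat.size n := by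
  rw [Nat.size_le, pow_add]
  exact Nat.mul_lt_mul'' m.lt_size_self n.lt_size_self

lemma Nat.size_add_le {m n k : ℕ} (hm : Nat.size m ≤ k) (hn : Nat.size n ≤ k) :
    Nat.size (m + n) ≤ k + 1 := by
  rw [Nat.size_le] at *
  omega

/-- Numerator and denominator of `q` have at most `k` bits. -/
def HeightBits (q : ℚ) (k : ℕ) : Prop := Nat.size q.num.natAbs ≤ k ∧ Nat.size q.den ≤ k

lemma heightBits_ratBits (q : ℚ) : HeightBits q (ratBits q) := by
  constructor <;> rw [ratBits] <;> omega

lemma HeightBits.ratBits_le {q : ℚ} {k : ℕ} (h : HeightBits q k) : ratBits q ≤ 1 + 2 * k := by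
  have := h.1
  have := h.2
  rw [ratBits]
  omega

lemma heightBits_intCast_div {a b : ℤ} {k : ℕ} (hk : 0 < k) (ha : Nat.size a.natAbs ≤ k)
    (hb : Nat.size b.natAbs ≤ k) : HeightBits ((a : ℚ) / b) k := by
  by_cases ha0 : a = 0
  · subst ha0
    exact ⟨by simp, by simp; omega⟩
  by_cases hb0 : b = 0
  · subst hb0
    exact ⟨by simp, by simp; omega⟩
  rw [← Rat.divInt_eq_div]
  refine ⟨(Nat.size_le_size ?_).trans ha, (Nat.size_le_size ?_).trans hb⟩
  · exact Nat.le_of_dvd (by omega) (Int.natAbs_dvd_natAbs.2 (Rat.num_dvd a hb0))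
  · have := Int.natAbs_dvd_natAbs.2 (Rat.den_dvd a b)
    exact Nat.le_of_dvd (by omega) (by simpa using this)

lemma HeightBits.add {x y : ℚ} {k l : ℕ} (hx : HeightBits x k) (hy : HeightBits y l) :
    HeightBits (x + y) (k + l + 1) := by
  have e : x + y = ((x.num * y.den + y.num * x.den : ℤ) : ℚ) / (x.den * y.den : ℤ) := by
    have := x.den_ne_zero
    have := y.den_ne_zero
    conv_lhs => rw [← x.num_div_den, ← y.num_div_den]
    push_cast
    field_simp
  rw [e]
  have h₁ := Nat.size_mul_le x.num.natAbs y.den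
  have h₂ := Nat.size_mul_le y.num.natAbs x.den
  have h₃ := Nat.size_mul_le x.den y.den
  obtain ⟨hx₁, hx₂⟩ := hx
  obtain ⟨hy₁, hy₂⟩ := hy
  refine heightBits_intCast_div (by omega) ?_ ?_
  · refine (Nat.size_le_size (Int.natAbs_add_le _ _)).trans (Nat.size_add_le ?_ ?_) <;>
      rw [Int.natAbs_mul, Int.natAbs_natCast] <;> omega
  · rw [Int.natAbs_mul, Int.natAbs_natCast, Int.natAbs_natCast]
    omega

lemma HeightBits.neg {x : ℚ} {k : ℕ} (hx : HeightBits x k) : HeightBits (-x) k := by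
  simpa [HeightBits] using hx

lemma HeightBits.mul {x y : ℚ} {k l : ℕ} (hx : HeightBits x k) (hy : HeightBits y l) :
    HeightBits (x * y) (k + l + 1) := by
  have e : x * y = ((x.num * y.num : ℤ) : ℚ) / (x.den * y.den : ℤ) := by
    conv_lhs => rw [← x.num_div_den, ← y.num_div_den]
    push_cast
    rw [div_mul_div_comm]
  rw [e]
  have h₁ := Nat.size_mul_le x.num.natAbs y.num.natAbs
  have h₃ := Nat.size_mul_le x.den y.den
  obtain ⟨hx₁, hx₂⟩ := hx
  obtain ⟨hy₁, hy₂⟩ := hy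
  refine heightBits_intCast_div (by omega) ?_ ?_
  · rw [Int.natAbs_mul]
    omega
  · rw [Int.natAbs_mul, Int.natAbs_natCast, Int.natAbs_natCast]
    omega

lemma HeightBits.inv {x : ℚ} {k : ℕ} (hx : HeightBits x k) : HeightBits x⁻¹ (k + 1) := by
  have e : x⁻¹ = ((x.den : ℤ) : ℚ) / (x.num : ℤ) := by
    conv_lhs => rw [← x.num_div_den]
    push_cast
    rw [inv_div]
  rw [e]
  obtain ⟨hx₁, hx₂⟩ := hx
  exact heightBits_intCast_div (by omega) (by rw [Int.natAbs_natCast]; omega) (by omega)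

lemma HeightBits.floor {x : ℚ} {k : ℕ} (hx : HeightBits x k) :
    HeightBits (⌊x⌋ : ℚ) (k + 1) := by
  refine ⟨(Nat.size_le_size ?_).trans (hx.1.trans (Nat.le_succ k)), by simp⟩
  rw [Rat.num_intCast, Rat.floor_def']
  have hd : (0 : ℤ) < x.den := by exact_mod_cast x.den_pos
  rcases le_or_gt 0 x.num with h | h
  · have h₁ := Int.ediv_nonneg h hd.le
    have h₂ := Int.ediv_le_self x.den h
    omega
  · have h₁ : x.num / x.den < 0 := Int.ediv_neg_of_neg_of_pos h hd
    have h₂ : x.num ≤ x.num / x.den := by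
      rw [Int.le_ediv_iff_mul_le hd]
      nlinarith
    omega

instance : FeasibleMachine bitMachine where
  one_le_size q := by simp [bitMachine, ratBits]; omega
  size_apply_le o x y := by
    have hx := heightBits_ratBits x
    have hy := heightBits_ratBits y
    have h : HeightBits (o.apply x y) (ratBits x + ratBits y + 2) := by
      have up : ∀ {q : ℚ} {k l : ℕ}, HeightBits q k → k ≤ l → HeightBits q l :=
        fun h hkl => ⟨h.1.trans hkl, h.2.trans hkl⟩
      cases o
      · exact up (hx.add hy) (by omega)
      · simpa only [ArithOp.apply, sub_eq_add_neg] using up (hx.add hy.neg) (by omega)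
      · exact up (hx.mul hy) (by omega)
      · simpa only [ArithOp.apply, div_eq_mul_inv] using up (hx.mul hy.inv) (by omega)
    have := h.ratBits_le
    have h₁ : 1 ≤ ratBits x := by rw [ratBits]; omega
    have h₂ : 1 ≤ ratBits y := by rw [ratBits]; omega
    simp only [bitMachine]
    omega
  size_prim_le q := by
    have := (heightBits_ratBits q).floor.ratBits_le
    simp only [bitMachine]
    omega
  size_sum_le := by
    refine ⟨1 + 2 * (.X * (.X + 1) + 1), fun n B g hg => ?_⟩
    -- numerator and denominator are bounded separately, as this bound is additive
    have h : HeightBits (∑ i ∈ Finset.range n, g i) (n * (B + 1) + 1) := by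
      induction n with
      | zero => exact ⟨by simp, by simp⟩
      | succ n ih =>
        rw [Finset.sum_range_succ]
        have h₁ := ih fun i hi => hg i (by omega)
        have h₂ := heightBits_ratBits (g n)
        have h₃ : ratBits (g n) ≤ B := hg n (by omega)
        have h₄ := h₁.add h₂
        have h₅ : n * (B + 1) + 1 + ratBits (g n) + 1 ≤ (n + 1) * (B + 1) + 1 := by
          rw [add_mul]; omega
        exact ⟨h₄.1.trans h₅, h₄.2.trans h₅⟩
    have := h.ratBits_le
    have h' : n * (B + 1) ≤ (n + B) * (n + B + 1) := Nat.mul_le_mul (by omega) (by omega)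
    simp [bitMachine]
    omega

end Machines

/-! ### Largest sums of few elements -/

section Greedy

set_option linter.unusedSectionVars false

variable {n : ℕ} {G : Type} [AddCommGroup G] [LinearOrder G] [IsOrderedAddMonoid G]

/-- In the order of the indices by decreasing value of `g`, ties being broken by the index, `j`
comes before `i`. -/
def Precedes (g : Fin n → G) (j i : Fin n) : Prop := g i < g j ∨ g i = g j ∧ j < i

instance (g : Fin n → G) (i j : Fin n) : Decidable (Precedes g j i) :=
  inferInstanceAs (Decidable (_ ∨ _))

/-- The number of indices that come before `i`. -/
def rankOf (g : Fin n → G) (i : Fin n) : ℕ := (Finset.univ.filter fun j => Precedes g j i).card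

/-- The indices of the `d` largest values (of all values, if there are at most `d`). -/
def topIndices (g : Fin n → G) (d : ℕ) : Finset (Fin n) :=
  Finset.univ.filter fun i => rankOf g i < d

lemma Precedes.trans {g : Fin n → G} {i j k : Fin n} (h : Precedes g i j) (h' : Precedes g j k) :
    Precedes g i k := by
  rcases h with h | ⟨h, e⟩ <;> rcases h' with h' | ⟨h', e'⟩
  · exact .inl (h'.trans h)
  · exact .inl (h' ▸ h)
  · exact .inl (h ▸ h')
  · exact .inr ⟨h'.trans h, e.trans e'⟩

lemma not_precedes_self (g : Fin n → G) (i : Fin n) : ¬ Precedes g i i := by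
  simp [Precedes]

lemma precedes_or_precedes (g : Fin n → G) {i j : Fin n} (h : i ≠ j) :
    Precedes g i j ∨ Precedes g j i := by
  unfold Precedes
  rcases lt_trichotomy (g i) (g j) with e | e | e <;> rcases lt_or_gt_of_ne h with e' | e' <;>
    simp [e, e']

lemma Precedes.rankOf_lt {g : Fin n → G} {i j : Fin n} (h : Precedes g j i) :
    rankOf g j < rankOf g i := by
  refine Finset.card_lt_card ⟨fun k hk => ?_, fun hsub => ?_⟩
  · simp only [Finset.mem_filter, Finset.mem_univ, true_and] at hk ⊢
    exact hk.trans h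
  · have := hsub (x := j) (by simpa using h)
    simp [not_precedes_self] at this

lemma card_topIndices_le (g : Fin n → G) (d : ℕ) : (topIndices g d).card ≤ d := by
  have hinj : Set.InjOn (rankOf g) (topIndices g d) := by
    intro i _ j _ hij
    by_contra hne
    rcases precedes_or_precedes g hne with h | h <;> exact absurd h.rankOf_lt (by omega)
  simpa using Finset.card_le_card_of_injOn (t := Finset.range d) (rankOf g)
    (fun i hi => by simpa [topIndices] using hi) hinj

/-- Exchange argument: elements outside of the largest ones are replaced by larger ones. -/
lemma sum_le_sum_topIndices {g : Fin n → G} (hg : ∀ i, 0 ≤ g i) {d : ℕ} {S : Finset (Fin n)}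
    (hS : S.card ≤ d) : ∑ i ∈ S, g i ≤ ∑ i ∈ topIndices g d, g i := by
  classical
  set T := topIndices g d with hT
  have hmem : ∀ i, i ∈ T ↔ rankOf g i < d := by simp [hT, topIndices]
  have hTS : ∀ i ∈ T, ∀ j ∉ T, g j ≤ g i := by
    intro i hi j hj
    by_contra! hlt
    have : rankOf g j < rankOf g i := Precedes.rankOf_lt (.inl hlt)
    rw [hmem] at hi hj
    omega
  rw [← Finset.sum_inter_add_sum_sdiff S T, ← Finset.sum_inter_add_sum_sdiff T S,
    Finset.inter_comm T S]
  refine add_le_add le_rfl ?_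
  rcases (S \ T).eq_empty_or_nonempty with h | h
  · rw [h, Finset.sum_empty]
    exact Finset.sum_nonneg fun i _ => hg i
  obtain ⟨j, hj, hmax⟩ := Finset.exists_max_image (S \ T) g h
  have hjT : j ∉ T := (Finset.mem_sdiff.1 hj).2
  have hcard : S.card ≤ T.card := by
    -- the indices before the first one outside of `T` lie in `T`
    obtain ⟨k, hk, hmin⟩ := Finset.exists_min_image Tᶜ (rankOf g) ⟨j, by simpa using hjT⟩
    have hsub : (Finset.univ.filter fun i => Precedes g i k) ⊆ T := by
      intro i hi
      by_contra hiT
      have := hmin i (by simpa using hiT)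
      have := Precedes.rankOf_lt (Finset.mem_filter.1 hi).2
      omega
    have h₁ : rankOf g k ≤ T.card := Finset.card_le_card hsub
    have h₂ : ¬ rankOf g k < d := by rw [← hmem]; simpa using hk
    omega
  have hcard' : (S \ T).card ≤ (T \ S).card := by
    have h₁ := Finset.card_sdiff_add_card_inter S T
    have h₂ := Finset.card_sdiff_add_card_inter T S
    rw [Finset.inter_comm] at h₂
    omega
  calc ∑ i ∈ S \ T, g i ≤ (S \ T).card • g j := Finset.sum_le_card_nsmul _ _ _ hmax
    _ ≤ (T \ S).card • g j := nsmul_le_nsmul_left (hg j) hcard'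
    _ ≤ ∑ i ∈ T \ S, g i := Finset.card_nsmul_le_sum _ _ _ fun i hi =>
        hTS i (Finset.mem_sdiff.1 hi).1 j hjT

end Greedy

/-! ### Suprema that remember whether they are attained -/

section LexSup

set_option linter.unusedSectionVars false

variable {K : Type} [Field K] [LinearOrder K] [IsStrictOrderedRing K]

/-- `q = (s, -k)` describes the supremum `s` of the set `V`, with `k = 0` only if `s` is attained,
and `k > 0` only if it is not. In the lexicographic order, `(s, -k)` with `k > 0` stands for a
number infinitesimally smaller than `s`. -/
structure IsLexSup (V : Set K) (q : K ×ₗ K) : Prop where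
  upper : ∀ v ∈ V, toLex (v, 0) ≤ q
  snd_nonpos : (ofLex q).2 ≤ 0
  attained : (ofLex q).2 = 0 → (ofLex q).1 ∈ V
  approx : ∀ ε > 0, ∃ v ∈ V, (ofLex q).1 - ε < v

lemma IsGreatest.isLexSup {V : Set K} {s : K} (h : IsGreatest V s) :
    IsLexSup V (toLex (s, 0)) where
  upper v hv := by
    rw [Prod.Lex.toLex_le_toLex]
    rcases (h.2 hv).lt_or_eq with h | h
    · exact .inl h
    · exact .inr ⟨h, le_rfl⟩
  snd_nonpos := le_rfl
  attained _ := h.1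
  approx ε hε := ⟨s, h.1, sub_lt_self s hε⟩

lemma IsLexSup.max_union {V W : Set K} {q r : K ×ₗ K} (hq : IsLexSup V q) (hr : IsLexSup W r) :
    IsLexSup (V ∪ W) (max q r) := by
  refine ⟨?_, ?_, ?_, ?_⟩
  · rintro v (hv | hv)
    · exact (hq.upper v hv).trans (le_max_left _ _)
    · exact (hr.upper v hv).trans (le_max_right _ _)
  all_goals rcases le_total q r with h | h
  all_goals simp only [max_eq_left h, max_eq_right h]
  · exact hr.snd_nonpos
  · exact hq.snd_nonpos
  · exact fun h => .inr (hr.attained h)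
  · exact fun h => .inl (hq.attained h)
  · intro ε hε
    obtain ⟨v, hv, h⟩ := hr.approx ε hε
    exact ⟨v, .inr hv, h⟩
  · intro ε hε
    obtain ⟨v, hv, h⟩ := hq.approx ε hε
    exact ⟨v, .inl hv, h⟩

variable {ι : Type}

lemma ofLex_sum (s : Finset ι) (q : ι → K ×ₗ K) :
    ofLex (∑ i ∈ s, q i) = (∑ i ∈ s, (ofLex (q i)).1, ∑ i ∈ s, (ofLex (q i)).2) := by
  classical
  induction s using Finset.induction_on with
  | empty => rfl
  | insert i s hi ih =>
    simp only [Finset.sum_insert hi, ofLex_add, ih]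
    rfl

lemma zero_le_iff_ofLex (q : K ×ₗ K) :
    0 ≤ q ↔ 0 < (ofLex q).1 ∨ 0 = (ofLex q).1 ∧ 0 ≤ (ofLex q).2 := by
  rw [Prod.Lex.le_iff]; rfl

/-- A sum over independent choices can be made positive if and only if the sum of the suprema is,
attained or not. -/
lemma exists_sum_pos_iff {s : Finset ι} {V : ι → Set K} {q : ι → K ×ₗ K}
    (h : ∀ i ∈ s, IsLexSup (V i) (q i)) (c : K) :
    (∃ v : ι → K, (∀ i ∈ s, v i ∈ V i) ∧ 0 < c + ∑ i ∈ s, v i) ↔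
      0 < c + ∑ i ∈ s, (ofLex (q i)).1 := by
  constructor
  · rintro ⟨v, hv, hpos⟩
    refine hpos.trans_le (add_le_add_right (Finset.sum_le_sum fun i hi => ?_) c)
    exact Prod.Lex.monotone_fst _ _ ((h i hi).upper _ (hv i hi))
  · intro hpos
    set ε := (c + ∑ i ∈ s, (ofLex (q i)).1) / (s.card + 1) with hε
    have hε0 : 0 < ε := by positivity
    have hex : ∀ i, ∃ v, i ∈ s → v ∈ V i ∧ (ofLex (q i)).1 - ε < v := by
      intro i
      by_cases hi : i ∈ s
      · obtain ⟨v, hv⟩ := (h i hi).approx ε hε0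
        exact ⟨v, fun _ => hv⟩
      · exact ⟨0, fun h => absurd h hi⟩
    choose v hv using hex
    refine ⟨v, fun i hi => (hv i hi).1, ?_⟩
    have h₁ : ∑ i ∈ s, ((ofLex (q i)).1 - ε) ≤ ∑ i ∈ s, v i :=
      Finset.sum_le_sum fun i hi => (hv i hi).2.le
    rw [Finset.sum_sub_distrib, Finset.sum_const, nsmul_eq_mul] at h₁
    have h₂ : ε * (s.card + 1) = c + ∑ i ∈ s, (ofLex (q i)).1 := by
      rw [hε]; field_simp
    nlinarith

/-- For a weak inequality it matters whether all the suprema are attained if their sum is exactly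
zero: the second components keep track of this. -/
lemma exists_sum_nonneg_iff {s : Finset ι} {V : ι → Set K} {q : ι → K ×ₗ K}
    (h : ∀ i ∈ s, IsLexSup (V i) (q i)) (c : K) :
    (∃ v : ι → K, (∀ i ∈ s, v i ∈ V i) ∧ 0 ≤ c + ∑ i ∈ s, v i) ↔
      0 ≤ toLex (c, 0) + ∑ i ∈ s, q i := by
  constructor
  · rintro ⟨v, hv, hpos⟩
    calc (0 : K ×ₗ K) ≤ toLex (c + ∑ i ∈ s, v i, 0) := by
          rw [zero_le_iff_ofLex]
          rcases hpos.lt_or_eq with h | h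
          · exact .inl h
          · exact .inr ⟨h, le_rfl⟩
      _ = toLex (c, 0) + ∑ i ∈ s, toLex (v i, 0) := by
          apply ofLex.injective
          rw [ofLex_add, ofLex_sum]
          simp
      _ ≤ _ := add_le_add_right (Finset.sum_le_sum fun i hi => (h i hi).upper _ (hv i hi)) _
  · intro hq
    rw [zero_le_iff_ofLex, ofLex_add, ofLex_sum] at hq
    simp only [ofLex_toLex, Prod.fst_add, Prod.snd_add, zero_add] at hq
    rcases hq with hpos | ⟨h₀, hk⟩
    · obtain ⟨v, hv, hp⟩ := (exists_sum_pos_iff h c).2 hpos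
      exact ⟨v, hv, hp.le⟩
    · have hall := (Finset.sum_eq_zero_iff_of_nonpos fun i hi => (h i hi).snd_nonpos).1
        (le_antisymm (Finset.sum_nonpos fun i hi => (h i hi).snd_nonpos) hk)
      exact ⟨fun i => (ofLex (q i)).1, fun i hi => (h i hi).attained (hall i hi), h₀.le⟩

end LexSup

/-! ### When a set of features can change the prediction -/

section Flipping

set_option linter.unusedSectionVars false

variable {K : Type} [Field K] [LinearOrder K] [IsStrictOrderedRing K] {F : FeatureFamily K}

/-- The direction in which the score of `x` has to move for the prediction to change. -/
def GAM.flipSign (f : GAM F) (x : Fin f.n → K) : K := if 0 ≤ f.score x then -1 else 1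

/-- The prediction changes as soon as `flipBase`, plus the changes of the score, counted in the
direction `flipSign`, is lexicographically nonnegative. The second component is `-1` if the score
has to become strictly negative. -/
def GAM.flipBase (f : GAM F) (x : Fin f.n → K) : K ×ₗ K :=
  toLex (f.flipSign x * f.score x, if 0 ≤ f.score x then -1 else 0)

/-- The largest change of the score that feature `i` can cause in the direction `flipSign`, if
`q e b` describes the supremum of `b` times the component with description `e`. -/
def GAM.flipGain (q : F.Desc → K → K ×ₗ K) (f : GAM F) (x : Fin f.n → K) (i : Fin f.n) : K ×ₗ K :=
  q (f.feature i) (f.flipSign x * f.weight i) -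
    toLex (f.flipSign x * f.weight i * F.component (f.feature i) (x i), 0)

/-- The values that `q` describes are the suprema of the multiples of the components. -/
def FeatureFamily.IsSup (F : FeatureFamily K) (q : F.Desc → K → K ×ₗ K) : Prop :=
  ∀ e b, (F.dom e).Nonempty → IsLexSup ((fun z => b * F.component e z) '' F.dom e) (q e b)

variable {q : F.Desc → K → K ×ₗ K} {f : GAM F} {x : Fin f.n → K}

lemma GAM.flipGain_nonneg (hq : F.IsSup q) (hx : x ∈ f.inputs) (i : Fin f.n) :
    0 ≤ f.flipGain q x i :=
  sub_nonneg.2 ((hq _ _ ⟨x i, hx i⟩).upper _ ⟨x i, hx i, rfl⟩)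

lemma GAM.score_piecewise (z : Fin f.n → K) (S : Finset (Fin f.n)) :
    f.score (S.piecewise z x) = f.score x - ∑ i ∈ S, f.weight i * F.component (f.feature i) (x i) +
      ∑ i ∈ S, f.weight i * F.component (f.feature i) (z i) := by
  classical
  simp only [GAM.score]
  rw [← Finset.sum_add_sum_compl S, ← Finset.sum_add_sum_compl S
    fun i => f.weight i * F.component (f.feature i) (x i)]
  have h₁ : ∑ i ∈ S, f.weight i * F.component (f.feature i) (S.piecewise z x i) =
      ∑ i ∈ S, f.weight i * F.component (f.feature i) (z i) :=
    Finset.sum_congr rfl fun i hi => by rw [Finset.piecewise_eq_of_mem _ _ _ hi]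
  have h₂ : ∑ i ∈ Sᶜ, f.weight i * F.component (f.feature i) (S.piecewise z x i) =
      ∑ i ∈ Sᶜ, f.weight i * F.component (f.feature i) (x i) :=
    Finset.sum_congr rfl fun i hi => by
      rw [Finset.piecewise_eq_of_notMem _ _ _ (Finset.mem_compl.1 hi)]
  rw [h₁, h₂]
  ring

/-- Features contribute to a change of the prediction independently of each other, so the best
change for a set `S` is the sum of the gains of its members. -/
lemma GAM.isContrastiveReason_iff (hq : F.IsSup q) (hx : x ∈ f.inputs) (S : Finset (Fin f.n)) :
    f.IsContrastiveReason x S ↔ 0 ≤ f.flipBase x + ∑ i ∈ S, f.flipGain q x i := by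
  classical
  set σ := f.flipSign x with hσ
  set V : Fin f.n → Set K := fun i =>
    (fun z => σ * f.weight i * F.component (f.feature i) z) '' F.dom (f.feature i) with hV
  set Q : Fin f.n → K ×ₗ K := fun i => q (f.feature i) (σ * f.weight i) with hQ
  have hVQ : ∀ i ∈ S, IsLexSup (V i) (Q i) := fun i _ => hq _ _ ⟨x i, hx i⟩
  set c := σ * f.score x - ∑ i ∈ S, σ * f.weight i * F.component (f.feature i) (x i) with hc
  have hscore : ∀ z, σ * f.score (S.piecewise z x) =
      c + ∑ i ∈ S, σ * f.weight i * F.component (f.feature i) (z i) := by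
    intro z
    rw [GAM.score_piecewise, mul_add, mul_sub, Finset.mul_sum, Finset.mul_sum, hc]
    simp only [mul_assoc]
  have hex : ∀ p : K → Prop, (∃ z ∈ f.inputs, p (σ * f.score (S.piecewise z x))) ↔
      ∃ v : Fin f.n → K, (∀ i ∈ S, v i ∈ V i) ∧ p (c + ∑ i ∈ S, v i) := by
    intro p
    simp only [hscore]
    constructor
    · rintro ⟨z, hz, hp⟩
      exact ⟨_, fun i _ => ⟨z i, hz i, rfl⟩, hp⟩
    · rintro ⟨v, hv, hp⟩
      have : ∀ i, ∃ z ∈ F.dom (f.feature i), i ∈ S →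
          σ * f.weight i * F.component (f.feature i) z = v i := by
        intro i
        by_cases hi : i ∈ S
        · obtain ⟨z, hz, h⟩ := hv i hi
          exact ⟨z, hz, fun _ => h⟩
        · exact ⟨x i, hx i, fun h => absurd h hi⟩
      choose z hz hzv using this
      refine ⟨z, hz, ?_⟩
      rwa [Finset.sum_congr rfl fun i hi => hzv i hi]
  have hsum : f.flipBase x + ∑ i ∈ S, f.flipGain q x i =
      toLex (c, if 0 ≤ f.score x then -1 else 0) + ∑ i ∈ S, Q i := by
    simp only [GAM.flipGain, GAM.flipBase, ← hσ, ← hQ, Finset.sum_sub_distrib]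
    apply ofLex.injective
    simp only [ofLex_add, ofLex_sub, ofLex_sum, ofLex_toLex]
    refine Prod.ext ?_ ?_
    · simp [hc, hQ]; ring
    · simp [hQ]
  rw [hsum, GAM.IsContrastiveReason]
  by_cases h : 0 ≤ f.score x
  · have hσ' : σ = -1 := by simp [hσ, GAM.flipSign, h]
    have h₁ : ∀ z, f.predict (S.piecewise z x) ≠ f.predict x ↔
        0 < σ * f.score (S.piecewise z x) := by
      intro z
      rw [hσ']
      by_cases h' : 0 ≤ f.score (S.piecewise z x) <;> simp [GAM.predict, h, h']
      simpa using h'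
    simp only [h₁]
    rw [hex (0 < ·), exists_sum_pos_iff hVQ, if_pos h, zero_le_iff_ofLex, ofLex_add, ofLex_sum]
    refine ⟨fun h => .inl (by simpa using h), ?_⟩
    rintro (h | ⟨-, h⟩)
    · simpa using h
    · have := Finset.sum_nonpos fun i hi => (hVQ i hi).snd_nonpos
      simp only [ofLex_toLex, Prod.mk_add_mk] at h
      linarith
  · have hσ' : σ = 1 := by simp [hσ, GAM.flipSign, h]
    have h₁ : ∀ z, f.predict (S.piecewise z x) ≠ f.predict x ↔
        0 ≤ σ * f.score (S.piecewise z x) := by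
      intro z
      rw [hσ']
      by_cases h' : 0 ≤ f.score (S.piecewise z x) <;> simp [GAM.predict, h, h']
    simp only [h₁]
    rw [hex (0 ≤ ·), exists_sum_nonneg_iff hVQ, if_neg h]

lemma GAM.isSufficientReason_iff_not (S : Finset (Fin f.n)) :
    f.IsSufficientReason x S ↔ ¬ f.IsContrastiveReason x Sᶜ := by
  simp [GAM.IsSufficientReason, GAM.IsContrastiveReason, Finset.piecewise_compl]

/-- Gains are nonnegative, so the best set of at most `d` features is found greedily. -/
lemma GAM.exists_isContrastiveReason_iff (hq : F.IsSup q) (hx : x ∈ f.inputs) (d : ℕ) :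
    (∃ S, f.IsContrastiveReason x S ∧ S.card ≤ d) ↔
      0 ≤ f.flipBase x + ∑ i ∈ topIndices (f.flipGain q x) d, f.flipGain q x i := by
  simp only [GAM.isContrastiveReason_iff hq hx]
  constructor
  · rintro ⟨S, hS, hd⟩
    exact hS.trans (add_le_add_right (sum_le_sum_topIndices (f.flipGain_nonneg hq hx) hd) _)
  · exact fun h => ⟨_, h, card_topIndices_le _ _⟩

/-- The best features to fix are those with the largest gains, which leaves the smallest gains to
the others. -/
lemma GAM.exists_isSufficientReason_iff (hq : F.IsSup q) (hx : x ∈ f.inputs) (d : ℕ) :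
    (∃ S, f.IsSufficientReason x S ∧ S.card ≤ d) ↔
      ¬ 0 ≤ f.flipBase x + ∑ i ∈ (topIndices (f.flipGain q x) d)ᶜ, f.flipGain q x i := by
  simp only [GAM.isSufficientReason_iff_not, GAM.isContrastiveReason_iff hq hx]
  constructor
  · rintro ⟨S, hS, hd⟩ h
    refine hS (h.trans (add_le_add_right ?_ _))
    have h₁ := Finset.sum_add_sum_compl S (f.flipGain q x)
    have h₂ := Finset.sum_add_sum_compl (topIndices (f.flipGain q x) d) (f.flipGain q x)
    rw [← eq_sub_iff_add_eq'] at h₁ h₂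
    rw [h₁, h₂]
    exact sub_le_sub_left (sum_le_sum_topIndices (f.flipGain_nonneg hq hx) hd) _
  · exact fun h => ⟨_, h, card_topIndices_le _ _⟩

end Flipping

/-! ### From tractable features to tractable queries -/

section Queries

set_option linter.unusedSectionVars false

variable {K : Type} [Field K] [LinearOrder K] {M : Machine K}

lemma SolvableInPolyTime.of_polyPred {I : Type} {enc : I → List K} {yes : I → Prop}
    (h : PolyPred M (fun _ => True) [enc] yes) : SolvableInPolyTime M enc yes := by
  classical
  obtain ⟨P, _, ⟨p, hp⟩, hP⟩ := h
  refine ⟨.seq P (.pop 0 1), p.comp (.X + 1) + .C (1 + M.size 0 + M.size 1), fun a => ?_⟩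
  obtain ⟨r, t, ht, hr⟩ := hP a trivial 0
  have hb := hp a trivial
  have h₁ : stacksOf (valuesAt [enc] a) = (State.start (enc a)).stack := by
    funext s
    rcases s with - | s
    · rfl
    · simp [State.start, valuesAt, stacksOf]
  rw [h₁, valuesAt_append] at hr
  have h₂ := run_pop_singleton (M := M) (valuesAt [enc] a) (if yes a then 1 else 0) 0 r
  refine ⟨_, _, Run.seq hr h₂, ?_, ?_, ?_⟩
  · have h₃ : M.size (if yes a then 1 else 0) ≤ M.size 0 + M.size 1 := by split_ifs <;> omega
    simp [stacksSize, valuesAt, Polynomial.eval_comp] at hb ⊢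
    omega
  · intro h; simp [h]
  · intro h; simp [h]

variable {Γ : Type} {D : Γ → Prop} {xs : List (Γ → List K)}

/-- The value of a function of `(γ, i)` at a `γ` and an `i` that have themselves been computed. -/
lemma PolyList.at [IsStrictOrderedRing K] [FeasibleMachine M] {Δ : Type} {E : Γ × ℕ → Prop}
    {f : Γ × ℕ → List K} (h : PolyList M E (liftFst xs ++ [loopIndex K Γ]) f) (g : Δ → Γ)
    (N : Δ → ℕ) {D' : Δ → Prop} {ys : List (Δ → List K)} (hE : ∀ δ, D' δ → E (g δ, N δ))
    (hx : ∀ x ∈ xs, PolyList M D' ys fun δ => x (g δ))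
    (hN : PolyNum M D' ys fun δ => (N δ : K)) : PolyList M D' ys fun δ => f (g δ, N δ) := by
  have h₁ : PolyList M D' (xs.map (fun x δ => x (g δ)) ++ [fun δ => [(N δ : K)]])
      fun δ => f (g δ, N δ) := h.transfer fun δ hδ => ⟨(g δ, N δ), hE δ hδ, by
        simp [valuesAt, liftFst, loopIndex, Function.comp_def], rfl⟩
  refine h₁.comp fun x hx' => ?_
  simp only [List.mem_append, List.mem_map, List.mem_singleton] at hx'
  rcases hx' with ⟨x, hx', rfl⟩ | rfl
  · exact hx x hx'
  · exact hN

lemma PolyNum.at [IsStrictOrderedRing K] [FeasibleMachine M] {Δ : Type} {E : Γ × ℕ → Prop}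
    {f : Γ × ℕ → K} (h : PolyNum M E (liftFst xs ++ [loopIndex K Γ]) f) (g : Δ → Γ)
    (N : Δ → ℕ) {D' : Δ → Prop} {ys : List (Δ → List K)} (hE : ∀ δ, D' δ → E (g δ, N δ))
    (hx : ∀ x ∈ xs, PolyList M D' ys fun δ => x (g δ))
    (hN : PolyNum M D' ys fun δ => (N δ : K)) : PolyNum M D' ys fun δ => f (g δ, N δ) :=
  PolyList.at h g N hE hx hN

/-- Both components of the pair `q γ` can be computed in polynomial time from the lists `xs`. -/
def PolyPair (M : Machine K) (D : Γ → Prop) (xs : List (Γ → List K)) (q : Γ → K ×ₗ K) : Prop :=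
  PolyNum M D xs (fun γ => (ofLex (q γ)).1) ∧ PolyNum M D xs fun γ => (ofLex (q γ)).2

variable [IsStrictOrderedRing K] [FeasibleMachine M] {q r : Γ → K ×ₗ K}

lemma PolyPair.congr (h : PolyPair M D xs q) (h' : ∀ γ, D γ → r γ = q γ) : PolyPair M D xs r :=
  ⟨h.1.congr fun γ hγ => by rw [h' γ hγ], h.2.congr fun γ hγ => by rw [h' γ hγ]⟩

lemma PolyPair.mono {D' : Γ → Prop} (h : PolyPair M D xs q) (h' : ∀ γ, D' γ → D γ) :
    PolyPair M D' xs q :=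
  ⟨h.1.mono h', h.2.mono h'⟩

lemma PolyPair.mk {a b : Γ → K} (ha : PolyNum M D xs a) (hb : PolyNum M D xs b) :
    PolyPair M D xs fun γ => toLex (a γ, b γ) := ⟨ha, hb⟩

lemma PolyPair.add (hq : PolyPair M D xs q) (hr : PolyPair M D xs r) :
    PolyPair M D xs fun γ => q γ + r γ := ⟨hq.1.add hr.1, hq.2.add hr.2⟩

lemma PolyPair.sub (hq : PolyPair M D xs q) (hr : PolyPair M D xs r) :
    PolyPair M D xs fun γ => q γ - r γ := ⟨hq.1.sub hr.1, hq.2.sub hr.2⟩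

lemma PolyPair.lift {E : Γ × ℕ → Prop} {zs : List (Γ × ℕ → List K)} (h : PolyPair M D xs q)
    (hE : ∀ p, E p → D p.1) (hzs : liftFst xs ⊆ zs) : PolyPair M E zs fun p => q p.1 :=
  ⟨h.1.lift hE hzs, h.2.lift hE hzs⟩

lemma PolyPair.at {Δ : Type} {E : Γ × ℕ → Prop}
    {f : Γ × ℕ → K ×ₗ K} (h : PolyPair M E (liftFst xs ++ [loopIndex K Γ]) f) (g : Δ → Γ)
    (N : Δ → ℕ) {D' : Δ → Prop} {ys : List (Δ → List K)} (hE : ∀ δ, D' δ → E (g δ, N δ))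
    (hx : ∀ x ∈ xs, PolyList M D' ys fun δ => x (g δ))
    (hN : PolyNum M D' ys fun δ => (N δ : K)) : PolyPair M D' ys fun δ => f (g δ, N δ) :=
  ⟨h.1.at g N hE hx hN, h.2.at g N hE hx hN⟩

lemma PolyPred.lexLt (hq : PolyPair M D xs q) (hr : PolyPair M D xs r) :
    PolyPred M D xs fun γ => q γ < r γ :=
  ((PolyPred.lt hq.1 hr.1).or ((PolyPred.eq hq.1 hr.1).and (PolyPred.lt hq.2 hr.2))).congr
    fun _ _ => Prod.Lex.lt_iff

lemma PolyPred.lexLe (hq : PolyPair M D xs q) (hr : PolyPair M D xs r) :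
    PolyPred M D xs fun γ => q γ ≤ r γ :=
  (PolyPred.lexLt hr hq).not.congr fun _ _ => not_lt.symm

lemma PolyPair.ite {p : Γ → Prop} [DecidablePred p] (hp : PolyPred M D xs p)
    (hq : PolyPair M (fun γ => D γ ∧ p γ) xs q) (hr : PolyPair M (fun γ => D γ ∧ ¬ p γ) xs r) :
    PolyPair M D xs fun γ => if p γ then q γ else r γ :=
  ⟨(PolyNum.ite hp hq.1 hr.1).congr fun γ _ => by beta_reduce; split_ifs <;> rfl,
    (PolyNum.ite hp hq.2 hr.2).congr fun γ _ => by beta_reduce; split_ifs <;> rfl⟩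

lemma PolyPair.max (hq : PolyPair M D xs q) (hr : PolyPair M D xs r) :
    PolyPair M D xs fun γ => max (q γ) (r γ) :=
  (PolyPair.ite (PolyPred.lexLe hq hr) (hr.mono fun _ h => h.1) (hq.mono fun _ h => h.1)).congr
    fun _ _ => max_def _ _

lemma PolyPair.sum {N : Γ → ℕ} {q : Γ × ℕ → K ×ₗ K} (hNc : PolyNum M D xs fun γ => (N γ : K))
    (hN : PolyBounded M D xs N) (hq : PolyPair M (fun p => D p.1 ∧ p.2 < N p.1)
      (liftFst xs ++ [loopIndex K Γ]) q) :
    PolyPair M D xs fun γ => ∑ i ∈ Finset.range (N γ), q (γ, i) :=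
  ⟨(PolyNum.sum hNc hN hq.1).congr fun γ _ => by rw [ofLex_sum],
    (PolyNum.sum hNc hN hq.2).congr fun γ _ => by rw [ofLex_sum]⟩

/-- A family of features is tractable on a machine if the components can be evaluated and the
suprema of their multiples can be computed in polynomial time. -/
structure FeatureFamily.Tractable (F : FeatureFamily K) (M : Machine K) : Prop where
  component : PolyNum M (fun p : F.Desc × K => p.2 ∈ F.dom p.1)
    [fun p => F.code p.1, fun p => [p.2]] fun p => F.component p.1 p.2
  sup : ∃ q : F.Desc → K → K ×ₗ K, F.IsSup q ∧ PolyPair M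
    (fun p : F.Desc × K => (F.dom p.1).Nonempty) [fun p => F.code p.1, fun p => [p.2]]
      fun p => q p.1 p.2

/-- The function `g` on `Fin n` as a function of natural numbers, with a default value. -/
@[irreducible] def extendFin {α : Type} {n : ℕ} (g : Fin n → α) (d : α) (i : ℕ) : α :=
  if h : i < n then g ⟨i, h⟩ else d

lemma extendFin_of_lt {α : Type} {n : ℕ} (g : Fin n → α) (d : α) {i : ℕ} (h : i < n) :
    extendFin g d i = g ⟨i, h⟩ := by
  rw [extendFin, dif_pos h]

lemma sum_range_extendFin {α : Type} [AddCommMonoid α] {n : ℕ} (g : Fin n → α) :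
    ∑ i ∈ Finset.range n, extendFin g 0 i = ∑ i, g i := by
  rw [Finset.sum_range]
  exact Finset.sum_congr rfl fun i _ => extendFin_of_lt g 0 i.2

variable {F : FeatureFamily K} {I : Type} (m : I → ModelInput F) (tail : I → List K)

/-- The part of the encoding of a model and an input that concerns feature `i`. -/
def ModelInput.record (a : ModelInput F) (i : Fin a.f.n) : List K :=
  a.f.weight i :: a.x i :: ((F.code (a.f.feature i)).length : K) :: F.code (a.f.feature i)

/-- The encoding of a model and an input, followed by further data. -/
def encodeWith (a : I) : List K := (m a).encode ++ tail a

/-- The part of the encoding from feature `i` on. -/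
def encodeFrom (p : I × ℕ) : List K :=
  ((List.ofFn (m p.1).record).drop p.2).flatten ++ tail p.1

lemma encodeFrom_of_lt {a : I} {i : ℕ} (h : i < (m a).f.n) :
    encodeFrom m tail (a, i) = (m a).record ⟨i, h⟩ ++ encodeFrom m tail (a, i + 1) := by
  rw [encodeFrom, List.drop_eq_getElem_cons (by simpa using h)]
  simp [encodeFrom]

lemma n_le_length_encodeWith (a : I) : (m a).f.n ≤ (encodeWith m tail a).length := by
  have : (m a).f.n ≤ (List.ofFn (m a).record).flatten.length := by
    rw [List.length_flatten, List.map_ofFn, List.sum_ofFn]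
    calc (m a).f.n = ∑ _i : Fin (m a).f.n, 1 := by simp
      _ ≤ _ := Finset.sum_le_sum fun i _ => by simp [ModelInput.record]
  simp only [encodeWith, ModelInput.encode, List.length_append, List.length_cons]
  unfold ModelInput.record at this
  omega

lemma polyList_encodeWith {D : I → Prop} :
    PolyList M D [encodeWith m tail] (encodeWith m tail) := PolyList.var (by simp)

lemma polyNum_n {D : I → Prop} :
    PolyNum M D [encodeWith m tail] fun a => ((m a).f.n : K) :=
  (polyList_encodeWith m tail).head

lemma polyBounded_n {D : I → Prop} :
    PolyBounded M D [encodeWith m tail] fun a => (m a).f.n :=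
  (polyList_encodeWith m tail).bounded_length fun a _ => n_le_length_encodeWith m tail a

/-- The records of the features have to be skipped one by one, as their lengths differ: each
announces the length of its description. -/
lemma polyList_encodeFrom : PolyList M (fun p : I × ℕ => p.2 ≤ (m p.1).f.n)
    (liftFst [encodeWith m tail] ++ [loopIndex K I]) (encodeFrom m tail) := by
  have hsize : ∀ p : I × ℕ, inputSize M (encodeFrom m tail p) ≤
      inputSize M (encodeWith m tail p.1) := by
    intro p
    refine inputSize_le_of_sublist M ?_
    rw [encodeWith, ModelInput.encode, encodeFrom]
    refine List.Sublist.append ?_ (List.Sublist.refl _)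
    refine .cons _ (.cons _ ?_)
    exact (List.drop_sublist _ _).flatten
  have henc : PolyList M (fun p : I × ℕ => p.2 ≤ (m p.1).f.n)
      (liftFst [encodeWith m tail] ++ [loopIndex K I]) fun p => encodeWith m tail p.1 :=
    (polyList_encodeWith m tail (D := fun _ => True)).lift (fun _ _ => trivial) (by simp)
  refine PolyList.iterate_single (N := fun p => p.2)
    (y := fun p => encodeFrom m tail (p.1.1, p.2)) (PolyNum.counter (by simp)) ?_
    henc.bounded (fun p _ i _ => hsize (p.1, i)) ?_ ?_
  · exact henc.bounded_length fun p hp => hp.trans (n_le_length_encodeWith m tail p.1)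
  · refine henc.tail.tail.congr fun p _ => ?_
    simp only [encodeFrom, List.drop_zero, encodeWith, ModelInput.encode, List.cons_append,
      List.tail_cons]
    rfl
  · set ctx := liftFst (liftFst [encodeWith m tail] ++ [loopIndex K I]) ++
      [loopIndex K (I × ℕ), fun p => encodeFrom m tail (p.1.1, p.2)] with hctx
    have hcur : PolyList M (fun p : (I × ℕ) × ℕ => p.1.2 ≤ (m p.1.1).f.n ∧ p.2 < p.1.2) ctx
        fun p => encodeFrom m tail (p.1.1, p.2) := PolyList.var (by simp [hctx])
    have hlen : ∀ p : (I × ℕ) × ℕ, p.1.2 ≤ (m p.1.1).f.n ∧ p.2 < p.1.2 →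
        ∃ h : p.2 < (m p.1.1).f.n, (encodeFrom m tail (p.1.1, p.2)).tail.tail.headD 0 =
          ((F.code ((m p.1.1).f.feature ⟨p.2, h⟩)).length : K) := by
      intro p hp
      have h : p.2 < (m p.1.1).f.n := by omega
      refine ⟨h, ?_⟩
      rw [encodeFrom_of_lt m tail h]
      simp [ModelInput.record]
    refine (PolyList.drop hcur.tail.tail.tail (N := fun p => extendFin (fun i =>
      (F.code ((m p.1.1).f.feature i)).length) 0 p.2) ?_ ?_).congr ?_
    · refine hcur.tail.tail.head.congr fun p hp => ?_
      obtain ⟨h, e⟩ := hlen p hp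
      rw [e, extendFin_of_lt _ _ h]
    · intro p hp
      have h : p.2 < (m p.1.1).f.n := by omega
      rw [encodeFrom_of_lt m tail h, extendFin_of_lt _ _ h]
      simp [ModelInput.record]
    · intro p hp
      have h : p.2 < (m p.1.1).f.n := by omega
      rw [encodeFrom_of_lt m tail h, extendFin_of_lt _ _ h]
      simp [ModelInput.record]

/-- The condition that `i` is the index of a feature. -/
abbrev IsIndex (p : I × ℕ) : Prop := p.2 < (m p.1).f.n

/-- The data from which functions of `(a, i)` are computed. -/
abbrev indexContext : List (I × ℕ → List K) := liftFst [encodeWith m tail] ++ [loopIndex K I]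

lemma polyNum_weight : PolyNum M (IsIndex m) (indexContext m tail)
    fun p => extendFin (m p.1).f.weight 0 p.2 :=
  ((polyList_encodeFrom m tail).mono fun _ h => le_of_lt h).head.congr fun p hp => by
    rw [encodeFrom_of_lt m tail hp, extendFin_of_lt _ _ hp]
    simp [ModelInput.record]

lemma polyNum_point : PolyNum M (IsIndex m) (indexContext m tail)
    fun p => extendFin (m p.1).x 0 p.2 :=
  ((polyList_encodeFrom m tail).mono fun _ h => le_of_lt h).tail.head.congr fun p hp => by
    rw [encodeFrom_of_lt m tail hp, extendFin_of_lt _ _ hp]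
    simp [ModelInput.record]

lemma polyList_code : PolyList M (IsIndex m) (indexContext m tail)
    fun p => extendFin (fun i => F.code ((m p.1).f.feature i)) [] p.2 := by
  have h : PolyList M (IsIndex m) (indexContext m tail) (encodeFrom m tail) :=
    (polyList_encodeFrom m tail).mono fun _ h => le_of_lt h
  refine (PolyList.take h.tail.tail.tail (N := fun p => extendFin (fun i =>
      (F.code ((m p.1).f.feature i)).length) 0 p.2)
    (h.tail.tail.head.congr fun p hp => ?_) fun p hp => ?_).congr fun p hp => ?_
  all_goals
    rw [encodeFrom_of_lt m tail hp, extendFin_of_lt _ _ hp]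
    simp [ModelInput.record, extendFin_of_lt _ _ (show p.2 < _ from hp)]

lemma polyList_tail : PolyList M (fun _ => True) [encodeWith m tail] tail :=
  ((polyList_encodeFrom m tail).at id (fun a => (m a).f.n) (fun _ _ => le_rfl)
    (fun _ hx => PolyList.var hx) (polyNum_n m tail)).congr fun a _ => by
      rw [encodeFrom, List.drop_of_length_le (by simp)]
      rfl

lemma polyNum_contribution (hF : F.Tractable M) : PolyNum M (IsIndex m) (indexContext m tail)
    fun p => extendFin (fun i => (m p.1).f.weight i *
      F.component ((m p.1).f.feature i) ((m p.1).x i)) 0 p.2 := by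
  have h : PolyNum M (IsIndex m) (indexContext m tail)
      fun p => extendFin (fun i => F.component ((m p.1).f.feature i) ((m p.1).x i)) 0 p.2 := by
    refine PolyList.comp (xs := [fun p => extendFin (fun i => F.code ((m p.1).f.feature i)) [] p.2,
      fun p => [extendFin (m p.1).x 0 p.2]]) (hF.component.transfer fun p hp =>
        ⟨((m p.1).f.feature ⟨p.2, hp⟩, (m p.1).x ⟨p.2, hp⟩), (m p.1).x_mem _, ?_, ?_⟩) ?_
    · simp [valuesAt, extendFin_of_lt _ _ (show p.2 < _ from hp)]
    · simp [extendFin_of_lt _ _ (show p.2 < _ from hp)]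
    · simp only [List.forall_mem_cons]
      exact ⟨polyList_code m tail, polyNum_point m tail, by simp⟩
  exact (PolyNum.mul (polyNum_weight m tail) h).congr fun p hp => by
    simp [extendFin_of_lt _ _ (show p.2 < _ from hp)]

lemma polyNum_score (hF : F.Tractable M) : PolyNum M (fun _ => True) [encodeWith m tail]
    fun a => (m a).f.score (m a).x := by
  refine (PolyNum.add (polyList_encodeWith m tail).tail.head (PolyNum.sum (polyNum_n m tail)
    (polyBounded_n m tail) ((polyNum_contribution m tail hF).mono fun p hp => hp.2))).congr
      fun a _ => ?_
  dsimp only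
  rw [sum_range_extendFin]
  rfl

lemma polyNum_flipSign (hF : F.Tractable M) : PolyNum M (fun _ => True) [encodeWith m tail]
    fun a => (m a).f.flipSign (m a).x :=
  PolyNum.ite (PolyPred.le .zero (polyNum_score m tail hF)) PolyNum.one.neg .one

lemma polyPair_flipBase (hF : F.Tractable M) : PolyPair M (fun _ => True) [encodeWith m tail]
    fun a => (m a).f.flipBase (m a).x :=
  PolyPair.mk ((polyNum_flipSign m tail hF).mul (polyNum_score m tail hF))
    (PolyNum.ite (PolyPred.le .zero (polyNum_score m tail hF)) PolyNum.one.neg .zero)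

lemma polyPair_flipGain (hF : F.Tractable M) {q : F.Desc → K → K ×ₗ K} (hq : PolyPair M
    (fun p : F.Desc × K => (F.dom p.1).Nonempty) [fun p => F.code p.1, fun p => [p.2]]
      fun p => q p.1 p.2) : PolyPair M (IsIndex m) (indexContext m tail)
    fun p => extendFin ((m p.1).f.flipGain q (m p.1).x) 0 p.2 := by
  have hσ : PolyNum M (IsIndex m) (indexContext m tail) fun p => (m p.1).f.flipSign (m p.1).x :=
    (polyNum_flipSign m tail hF).lift (fun _ _ => trivial) (by simp)
  set b : I × ℕ → K := fun p => (m p.1).f.flipSign (m p.1).x * extendFin (m p.1).f.weight 0 p.2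
  have hb : PolyNum M (IsIndex m) (indexContext m tail) b := hσ.mul (polyNum_weight m tail)
  have key : ∀ π : K ×ₗ K → K, PolyNum M (fun p : F.Desc × K => (F.dom p.1).Nonempty)
      [fun p => F.code p.1, fun p => [p.2]] (fun p => π (q p.1 p.2)) →
      PolyNum M (IsIndex m) (indexContext m tail)
        fun p => π (extendFin (fun i => q ((m p.1).f.feature i) (b p)) 0 p.2) := by
    intro π hπ
    refine PolyList.comp (xs := [fun p => extendFin (fun i => F.code ((m p.1).f.feature i)) [] p.2,
      fun p => [b p]]) (hπ.transfer fun p hp =>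
        ⟨((m p.1).f.feature ⟨p.2, hp⟩, b p), ⟨_, (m p.1).x_mem ⟨p.2, hp⟩⟩, ?_, ?_⟩) ?_
    · simp [valuesAt, extendFin_of_lt _ _ (show p.2 < _ from hp)]
    · simp [extendFin_of_lt _ _ (show p.2 < _ from hp)]
    · simp only [List.forall_mem_cons]
      exact ⟨polyList_code m tail, hb, by simp⟩
  refine (PolyPair.sub ⟨key (fun q => (ofLex q).1) hq.1, key (fun q => (ofLex q).2) hq.2⟩
    (PolyPair.mk (hσ.mul (polyNum_contribution m tail hF)) .zero)).congr fun p hp => ?_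
  simp [extendFin_of_lt _ _ (show p.2 < _ from hp), GAM.flipGain, b, mul_assoc]

/-- The number of features that come before a feature in the order of decreasing gains. -/
lemma polyNum_rankOf {g : ∀ a : I, Fin (m a).f.n → K ×ₗ K} (hg : PolyPair M (IsIndex m)
    (indexContext m tail) fun p => extendFin (g p.1) 0 p.2) :
    PolyNum M (IsIndex m) (indexContext m tail)
      fun p => ((extendFin (rankOf (g p.1)) 0 p.2 : ℕ) : K) := by
  classical
  set N : I × ℕ → ℕ := fun p => (m p.1).f.n
  have hN : PolyNum M (IsIndex m) (indexContext m tail) fun p => (N p : K) :=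
    (polyNum_n m tail (D := fun _ => True)).lift (fun _ _ => trivial) (by simp)
  have hNb : PolyBounded M (IsIndex m) (indexContext m tail) N :=
    ((polyList_encodeWith m tail (D := fun _ => True)).lift (fun _ _ => trivial)
      (by simp)).bounded_length fun p _ => n_le_length_encodeWith m tail p.1
  set E : (I × ℕ) × ℕ → Prop := fun p => IsIndex m p.1 ∧ p.2 < N p.1
  set ctx := liftFst (indexContext m tail) ++ [loopIndex K (I × ℕ)] with hctx
  have hi : PolyNum M E ctx fun p => (p.1.2 : K) :=
    (PolyNum.counter (E := IsIndex m) (zs := indexContext m tail) (by simp)).lift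
      (fun _ h => h.1) (by simp [hctx])
  have hj : PolyNum M E ctx fun p => (p.2 : K) := PolyNum.counter (by simp [hctx])
  have hgi : PolyPair M E ctx fun p => extendFin (g p.1.1) 0 p.1.2 :=
    hg.lift (fun _ h => h.1) (by simp [hctx])
  have hx : ∀ x ∈ [encodeWith m tail], PolyList M E ctx fun p => x p.1.1 := by
    simp only [List.forall_mem_cons]
    exact ⟨((polyList_encodeWith m tail (D := fun _ => True)).lift (E := IsIndex m)
      (zs := indexContext m tail) (fun _ _ => trivial) (by simp)).lift (fun _ h => h.1)
        (by simp [hctx]), by simp⟩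
  have hgj : PolyPair M E ctx fun p => extendFin (g p.1.1) 0 p.2 :=
    PolyPair.at (f := fun p => extendFin (g p.1) 0 p.2) hg (fun p : (I × ℕ) × ℕ => p.1.1)
      (fun p => p.2) (fun p hp => hp.2) hx hj
  have hpre := (PolyPred.lexLt hgi hgj).or (((PolyPred.lexLe hgi hgj).and
    (PolyPred.lexLe hgj hgi)).and (PolyPred.lt hj hi))
  refine (PolyNum.sum hN hNb hpre).congr fun p hp => ?_
  have hp : p.2 < (m p.1).f.n := hp
  rw [extendFin_of_lt _ _ hp, rankOf, Finset.card_filter, Finset.sum_range]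
  push_cast
  refine Finset.sum_congr rfl fun j _ => ?_
  have h : Precedes (g p.1) j ⟨p.2, hp⟩ ↔ extendFin (g p.1) 0 p.2 < extendFin (g p.1) 0 j ∨
      (extendFin (g p.1) 0 p.2 ≤ extendFin (g p.1) 0 j ∧
        extendFin (g p.1) 0 j ≤ extendFin (g p.1) 0 p.2) ∧ ((j : ℕ) : K) < (p.2 : K) := by
    rw [extendFin_of_lt _ _ hp, extendFin_of_lt _ _ j.2, Precedes, le_antisymm_iff]
    simp [Fin.lt_def]
  by_cases h' : Precedes (g p.1) j ⟨p.2, hp⟩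
  · rw [if_pos h', if_pos (h.1 h')]
  · rw [if_neg h', if_neg fun h'' => h' (h.2 h'')]

lemma PolyPred.mem_compl {S : ∀ a : I, Finset (Fin (m a).f.n)}
    (hS : PolyPred M (IsIndex m) (indexContext m tail)
      fun p => extendFin (fun i => i ∈ S p.1) False p.2) :
    PolyPred M (IsIndex m) (indexContext m tail)
      fun p => extendFin (fun i => i ∈ (S p.1)ᶜ) False p.2 := by
  have h := hS.not
  refine PolyPred.congr h fun p hp => ?_
  rw [extendFin_of_lt _ _ hp, extendFin_of_lt _ _ hp, Finset.mem_compl]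

/-- Whether a given set of features can change the prediction is decidable in polynomial time, if
membership in this set is. -/
lemma polyPred_flips (hF : F.Tractable M) {q : F.Desc → K → K ×ₗ K} (hq : PolyPair M
    (fun p : F.Desc × K => (F.dom p.1).Nonempty) [fun p => F.code p.1, fun p => [p.2]]
      fun p => q p.1 p.2) {S : ∀ a : I, Finset (Fin (m a).f.n)}
    (hS : PolyPred M (IsIndex m) (indexContext m tail)
      fun p => extendFin (fun i => i ∈ S p.1) False p.2) :
    PolyPred M (fun _ => True) [encodeWith m tail] fun a =>
      0 ≤ (m a).f.flipBase (m a).x + ∑ i ∈ S a, (m a).f.flipGain q (m a).x i := by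
  classical
  refine PolyPred.lexLe (PolyPair.mk .zero .zero) ((polyPair_flipBase m tail hF).add
    ((PolyPair.sum (polyNum_n m tail) (polyBounded_n m tail) ((PolyPair.ite hS
      ((polyPair_flipGain m tail hF hq).mono fun p hp => hp.1) (PolyPair.mk .zero .zero)).mono
        fun p hp => hp.2)).congr fun a _ => ?_))
  rw [Finset.sum_range, ← Finset.univ_inter (S a), ← Finset.sum_ite_mem]
  refine Finset.sum_congr rfl fun i _ => ?_
  dsimp only
  rw [extendFin_of_lt _ _ i.2, extendFin_of_lt _ _ i.2]
  by_cases h : i ∈ S a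
  · rw [if_pos h, if_pos h]
  · rw [if_neg h, if_neg h]
    rfl

end Queries

section Queries

variable {K : Type} [Field K] [LinearOrder K] [IsStrictOrderedRing K] {M : Machine K}
  [FeasibleMachine M] {F : FeatureFamily K}

theorem FeatureFamily.Tractable.solvable_CSR (hF : F.Tractable M) :
    SolvableInPolyTime M SubsetInstance.encode (CSR (F := F)) := by
  obtain ⟨q, hq, hqp⟩ := hF.sup
  set m : SubsetInstance F → ModelInput F := fun a => a.toModelInput
  set tail : SubsetInstance F → List K := fun a => List.ofFn fun i : Fin a.f.n =>
    if i ∈ a.S then (1 : K) else 0 with htail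
  have hS : PolyPred M (IsIndex m) (indexContext m tail)
      fun p => extendFin (fun i => i ∈ p.1.Sᶜ) False p.2 := by
    have htl : PolyList M (IsIndex m) (indexContext m tail) fun p => tail p.1 :=
      (polyList_tail m tail).lift (fun _ _ => trivial) (by simp)
    have hmem : PolyNum M (IsIndex m) (indexContext m tail) fun p => (tail p.1).getD p.2 0 :=
      PolyNum.getD htl (PolyNum.counter (by simp)) fun p hp => by
        rw [htail, List.length_ofFn]
        exact le_of_lt hp
    refine (PolyPred.lt hmem .one).congr fun p hp => ?_
    have hp : p.2 < p.1.f.n := hp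
    rw [extendFin_of_lt _ _ hp, List.getD_eq_getElem _ _ (by simpa [htail] using hp)]
    by_cases h : (⟨p.2, hp⟩ : Fin p.1.f.n) ∈ p.1.S <;> simp [htail, h]
  have h := polyPred_flips m tail hF hqp (S := fun a => a.Sᶜ) hS
  refine SolvableInPolyTime.of_polyPred (h.not.congr fun a _ => ?_)
  rw [CSR, GAM.isSufficientReason_iff_not, GAM.isContrastiveReason_iff hq a.x_mem]

lemma polyPred_topIndices (hF : F.Tractable M) {q : F.Desc → K → K ×ₗ K} (hq : PolyPair M
    (fun p : F.Desc × K => (F.dom p.1).Nonempty) [fun p => F.code p.1, fun p => [p.2]]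
      fun p => q p.1 p.2) :
    PolyPred M (IsIndex fun a : BoundInstance F => a.toModelInput)
      (indexContext (fun a : BoundInstance F => a.toModelInput) fun a => [(a.d : K)])
      fun p => extendFin (fun i => i ∈ topIndices (p.1.f.flipGain q p.1.x) p.1.d) False p.2 := by
  have hd : PolyNum M (fun _ => True) [encodeWith (fun a : BoundInstance F => a.toModelInput)
    fun a => [(a.d : K)]] fun a => (a.d : K) := (polyList_tail _ _).head
  refine (PolyPred.lt (polyNum_rankOf (fun a : BoundInstance F => a.toModelInput)
    (fun a => [(a.d : K)]) (g := fun a => a.f.flipGain q a.x) (polyPair_flipGain _ _ hF hq))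
    (hd.lift (fun _ _ => trivial) (by simp))).congr fun p hp => ?_
  have hp : p.2 < p.1.f.n := hp
  rw [extendFin_of_lt _ _ hp, extendFin_of_lt _ _ hp]
  simp [topIndices]

theorem FeatureFamily.Tractable.solvable_MCR (hF : F.Tractable M) :
    SolvableInPolyTime M BoundInstance.encode (MCR (F := F)) := by
  obtain ⟨q, hq, hqp⟩ := hF.sup
  have h := polyPred_flips (fun a : BoundInstance F => a.toModelInput)
    (fun a => [(a.d : K)]) hF hqp (S := fun a => topIndices (a.f.flipGain q a.x) a.d)
    (polyPred_topIndices hF hqp)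
  refine SolvableInPolyTime.of_polyPred (h.congr fun a _ => ?_)
  rw [MCR, GAM.exists_isContrastiveReason_iff hq a.x_mem]

theorem FeatureFamily.Tractable.solvable_MSR (hF : F.Tractable M) :
    SolvableInPolyTime M BoundInstance.encode (MSR (F := F)) := by
  obtain ⟨q, hq, hqp⟩ := hF.sup
  have hS := PolyPred.mem_compl (fun a : BoundInstance F => a.toModelInput)
    (fun a => [(a.d : K)]) (S := fun a => topIndices (a.f.flipGain q a.x) a.d)
    (polyPred_topIndices hF hqp)
  have h := polyPred_flips (fun a : BoundInstance F => a.toModelInput)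
    (fun a => [(a.d : K)]) hF hqp (S := fun a => (topIndices (a.f.flipGain q a.x) a.d)ᶜ) hS
  refine SolvableInPolyTime.of_polyPred (h.not.congr fun a _ => ?_)
  rw [MSR, GAM.exists_isSufficientReason_iff hq a.x_mem]

end Queries

/-! ### Maxima over loops -/

section MaxUpTo

set_option linter.unusedSectionVars false

variable {K Γ : Type} [Field K] [LinearOrder K] [IsStrictOrderedRing K] {M : Machine K}
  [FeasibleMachine M] {D : Γ → Prop} {xs : List (Γ → List K)}

/-- The maximum of `q 0, …, q (n - 1)`, and `q 0` for `n = 0`. -/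
def maxUpTo (q : ℕ → K ×ₗ K) : ℕ → K ×ₗ K
  | 0 => q 0
  | n + 1 => max (maxUpTo q n) (q n)

lemma exists_maxUpTo_eq (q : ℕ → K ×ₗ K) {n k : ℕ} (hn : 0 < n) (hk : k ≤ n) :
    ∃ i < n, maxUpTo q k = q i := by
  induction k with
  | zero => exact ⟨0, hn, rfl⟩
  | succ k ih =>
    obtain ⟨i, hi, h⟩ := ih (by omega)
    rcases max_choice (maxUpTo q k) (q k) with h' | h'
    · exact ⟨i, hi, h'.trans h⟩
    · exact ⟨k, by omega, h'⟩

lemma IsLexSup.maxUpTo {V : ℕ → Set K} {q : ℕ → K ×ₗ K} {n : ℕ} (hn : 0 < n)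
    (h : ∀ i < n, IsLexSup (V i) (q i)) : IsLexSup {v | ∃ i < n, v ∈ V i} (maxUpTo q n) := by
  induction n, hn using Nat.le_induction with
  | base =>
    have e : {v | ∃ i < 1, v ∈ V i} = V 0 := by ext; simp
    have e' : _root_.maxUpTo q 1 = q 0 := max_self _
    exact e' ▸ e ▸ h 0 one_pos
  | succ n hn ih =>
    have e : {v | ∃ i < n + 1, v ∈ V i} = {v | ∃ i < n, v ∈ V i} ∪ V n := by
      ext v
      simp only [Nat.lt_succ_iff_lt_or_eq, Set.mem_ofPred_eq, Set.mem_union]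
      constructor
      · rintro ⟨i, hi | rfl, hv⟩
        · exact .inl ⟨i, hi, hv⟩
        · exact .inr hv
      · rintro (⟨i, hi, hv⟩ | hv)
        · exact ⟨i, .inl hi, hv⟩
        · exact ⟨n, .inr rfl, hv⟩
    rw [e]
    exact (ih fun i hi => h i (by omega)).max_union (h n (by omega))

lemma PolyPair.maxUpTo {N : Γ → ℕ} {q : Γ × ℕ → K ×ₗ K}
    (hNc : PolyNum M D xs fun γ => (N γ : K)) (hN : PolyBounded M D xs N)
    (hpos : ∀ γ, D γ → 0 < N γ) (hq : PolyPair M (fun p => D p.1 ∧ p.2 < N p.1)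
      (liftFst xs ++ [loopIndex K Γ]) q) :
    PolyPair M D xs fun γ => maxUpTo (fun i => q (γ, i)) (N γ) := by
  obtain ⟨B₁, hB₁, h₁⟩ := PolyList.bounded_loop hN hq.1
  obtain ⟨B₂, hB₂, h₂⟩ := PolyList.bounded_loop hN hq.2
  set y : Γ × ℕ → List K := fun p => [(ofLex (_root_.maxUpTo (fun i => q (p.1, i)) p.2)).1,
    (ofLex (_root_.maxUpTo (fun i => q (p.1, i)) p.2)).2] with hy
  have hq₀ : PolyPair M D xs fun γ => q (γ, 0) :=
    PolyPair.at (f := q) hq id (fun _ => 0) (fun γ hγ => ⟨hγ, hpos γ hγ⟩)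
      (fun _ hx => PolyList.var hx) (PolyNum.natCast 0)
  have key : PolyList M D xs fun γ => y (γ, N γ) := by
    refine PolyList.iterate_single hNc hN (hB₁.add hB₂) ?_ ?_ ?_
    · intro γ hγ i hi
      obtain ⟨j, hj, e⟩ := exists_maxUpTo_eq (fun i => q (γ, i)) (hpos γ hγ) hi
      have h₁ := h₁ γ hγ j hj
      have h₂ := h₂ γ hγ j hj
      simp only [hy, e]
      simp only [inputSize, List.map_cons, List.map_nil, List.sum_cons, List.sum_nil,
        add_zero] at h₁ h₂ ⊢
      omega
    · exact PolyList.cons hq₀.1 hq₀.2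
    · have hcur : PolyList M (fun p => D p.1 ∧ p.2 < N p.1) (liftFst xs ++ [loopIndex K Γ, y]) y :=
        PolyList.var (by simp)
      have hq' : PolyPair M (fun p => D p.1 ∧ p.2 < N p.1) (liftFst xs ++ [loopIndex K Γ, y]) q :=
        have hsub : ∀ x ∈ liftFst xs ++ [loopIndex K Γ],
            PolyList M (fun p => D p.1 ∧ p.2 < N p.1) (liftFst xs ++ [loopIndex K Γ, y]) x :=
          fun x hx => PolyList.var (by
            simp only [List.mem_append, List.mem_cons, List.not_mem_nil, or_false] at hx ⊢; tauto)
        ⟨PolyList.comp hq.1 hsub, PolyList.comp hq.2 hsub⟩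
      have hm := PolyPair.max (q := fun p => _root_.maxUpTo (fun i => q (p.1, i)) p.2)
        ⟨hcur.head, hcur.tail.head⟩ hq'
      exact PolyList.cons hm.1 hm.2
  exact ⟨key.head, key.tail.head⟩

end MaxUpTo

/-! ### Calling a program as a subroutine -/

section Subroutine

set_option linter.unusedSectionVars false

variable {K : Type} [Field K] [LinearOrder K] {M : Machine K}

/-- A strict upper bound for the numbers of the registers and stacks of a test. -/
def Test.bound : Test → ℕ
  | .less a b => max (a + 1) (b + 1)
  | .isEmpty s => s + 1

/-- A strict upper bound for the numbers of the registers and stacks of a program. -/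
def Prog.bound : Prog → ℕ
  | .skip => 0
  | .const r _ => r + 1
  | .arith _ r a b => max (r + 1) (max (a + 1) (b + 1))
  | .unary r a => max (r + 1) (a + 1)
  | .push s r => max (s + 1) (r + 1)
  | .pop r s => max (r + 1) (s + 1)
  | .seq P Q => max P.bound Q.bound
  | .cond c P Q => max c.bound (max P.bound Q.bound)
  | .loop c P => max c.bound P.bound

lemma Test.holds_congr {c : Test} {n : ℕ} (hc : c.bound ≤ n) {σ σ' : State K}
    (hs : σ'.stack = σ.stack) (hr : ∀ r < n, σ'.reg r = σ.reg r) :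
    (c.Holds σ' ↔ c.Holds σ) ∧ c.cost M σ' = c.cost M σ := by
  cases c with
  | less a b =>
    simp only [Test.bound, max_le_iff] at hc
    simp [Test.Holds, Test.cost, hr a (by omega), hr b (by omega)]
  | isEmpty s => simp [Test.Holds, Test.cost, hs]

/-- A run depends only on the registers that occur in the program. -/
lemma Run.congr_reg {P : Prog} {σ τ : State K} {t n : ℕ} (h : Run M P σ τ t) :
    P.bound ≤ n → ∀ ρ : ℕ → K, (∀ r < n, ρ r = σ.reg r) →
      ∃ ρ' : ℕ → K, Run M P ⟨ρ, σ.stack⟩ ⟨ρ', τ.stack⟩ t ∧ ∀ r < n, ρ' r = τ.reg r := by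
  have upd : ∀ (f g : ℕ → K) (r : ℕ) (a : K), (∀ r < n, f r = g r) →
      ∀ s < n, Function.update f r a s = Function.update g r a s := by
    intro f g r a h s hs
    by_cases e : s = r
    · subst e; simp
    · simp [e, h s hs]
  induction h with
  | skip σ => exact fun _ ρ hρ => ⟨ρ, Run.skip _, hρ⟩
  | const σ r q => exact fun _ ρ hρ => ⟨_, Run.const ⟨ρ, σ.stack⟩ r q, upd _ _ _ _ hρ⟩
  | arith σ o r a b =>
    intro hn ρ hρ
    simp only [Prog.bound, max_le_iff] at hn
    have := Run.arith (M := M) ⟨ρ, σ.stack⟩ o r a b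
    simp only [hρ a (by omega), hρ b (by omega)] at this
    exact ⟨_, this, upd _ _ _ _ hρ⟩
  | unary σ r a =>
    intro hn ρ hρ
    simp only [Prog.bound, max_le_iff] at hn
    have := Run.unary (M := M) ⟨ρ, σ.stack⟩ r a
    simp only [hρ a (by omega)] at this
    exact ⟨_, this, upd _ _ _ _ hρ⟩
  | push σ s r =>
    intro hn ρ hρ
    simp only [Prog.bound, max_le_iff] at hn
    have := Run.push (M := M) ⟨ρ, σ.stack⟩ s r
    simp only [hρ r (by omega)] at this
    exact ⟨_, this, hρ⟩
  | pop σ r s => exact fun _ ρ hρ => ⟨_, Run.pop ⟨ρ, σ.stack⟩ r s, upd _ _ _ _ hρ⟩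
  | seq _ _ ih₁ ih₂ =>
    intro hn ρ hρ
    simp only [Prog.bound, max_le_iff] at hn
    obtain ⟨ρ₁, h₁, hρ₁⟩ := ih₁ hn.1 ρ hρ
    obtain ⟨ρ₂, h₂, hρ₂⟩ := ih₂ hn.2 ρ₁ hρ₁
    exact ⟨ρ₂, Run.seq h₁ h₂, hρ₂⟩
  | @condTrue σ τ c P Q t hc _ ih =>
    intro hn ρ hρ
    simp only [Prog.bound, max_le_iff] at hn
    obtain ⟨ρ₁, h₁, hρ₁⟩ := ih hn.2.1 ρ hρ
    have hc' := Test.holds_congr (M := M) hn.1 (σ := σ) (σ' := ⟨ρ, σ.stack⟩) rfl hρ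
    exact ⟨ρ₁, hc'.2 ▸ Run.condTrue (hc'.1.2 hc) h₁, hρ₁⟩
  | @condFalse σ τ c P Q t hc _ ih =>
    intro hn ρ hρ
    simp only [Prog.bound, max_le_iff] at hn
    obtain ⟨ρ₁, h₁, hρ₁⟩ := ih hn.2.2 ρ hρ
    have hc' := Test.holds_congr (M := M) hn.1 (σ := σ) (σ' := ⟨ρ, σ.stack⟩) rfl hρ
    exact ⟨ρ₁, hc'.2 ▸ Run.condFalse (fun h => hc (hc'.1.1 h)) h₁, hρ₁⟩
  | @loopStop σ c P hc =>
    intro hn ρ hρ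
    simp only [Prog.bound, max_le_iff] at hn
    have hc' := Test.holds_congr (M := M) hn.1 (σ := σ) (σ' := ⟨ρ, σ.stack⟩) rfl hρ
    exact ⟨ρ, hc'.2 ▸ Run.loopStop (fun h => hc (hc'.1.1 h)), hρ⟩
  | @loopStep σ τ υ c P t u hc _ _ ih₁ ih₂ =>
    intro hn ρ hρ
    obtain ⟨ρ₁, h₁, hρ₁⟩ := ih₁ (by simp only [Prog.bound, max_le_iff] at hn; exact hn.2) ρ hρ
    obtain ⟨ρ₂, h₂, hρ₂⟩ := ih₂ hn ρ₁ hρ₁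
    simp only [Prog.bound, max_le_iff] at hn
    have hc' := Test.holds_congr (M := M) hn.1 (σ := σ) (σ' := ⟨ρ, σ.stack⟩) rfl hρ
    exact ⟨ρ₂, hc'.2 ▸ Run.loopStep (hc'.1.2 hc) h₁ h₂, hρ₂⟩

lemma Run.stack_eq_of_bound_le {P : Prog} {σ τ : State K} {t s : ℕ} (h : Run M P σ τ t) :
    P.bound ≤ s → τ.stack s = σ.stack s := by
  induction h with
  | skip | const | arith | unary | loopStop => exact fun _ => rfl
  | push σ a r | pop σ r a =>
    intro hs
    simp only [Prog.bound, max_le_iff] at hs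
    exact Function.update_of_ne (by omega) _ _
  | seq _ _ ih₁ ih₂ =>
    intro hs
    simp only [Prog.bound, max_le_iff] at hs
    exact (ih₂ hs.2).trans (ih₁ hs.1)
  | condTrue _ _ ih =>
    intro hs
    simp only [Prog.bound, max_le_iff] at hs
    exact ih hs.2.1
  | condFalse _ _ ih =>
    intro hs
    simp only [Prog.bound, max_le_iff] at hs
    exact ih hs.2.2
  | loopStep _ _ _ ih₁ ih₂ =>
    intro hs
    refine (ih₂ hs).trans (ih₁ ?_)
    simp only [Prog.bound, max_le_iff] at hs
    exact hs.2

/-- Every number in a register at the end was there at the start or has been paid for. -/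
lemma Run.size_reg_le {P : Prog} {σ τ : State K} {t : ℕ} (h : Run M P σ τ t) (s : ℕ) :
    M.size (τ.reg s) ≤ M.size (σ.reg s) + t := by
  induction h with
  | skip | push | loopStop => exact Nat.le_add_right _ _
  | const σ r | arith σ o r | unary σ r | pop σ r =>
    simp only [State.setReg, State.setStack]
    by_cases e : s = r
    · subst e
      rw [Function.update_self]
      omega
    · rw [Function.update_of_ne e]
      omega
  | seq _ _ ih₁ ih₂ => omega
  | condTrue _ _ ih => omega
  | condFalse _ _ ih => omega
  | loopStep _ _ _ ih₁ ih₂ => omega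

/-- Set the registers below `n` to zero. -/
def Prog.clearRegs : ℕ → Prog
  | 0 => .skip
  | n + 1 => .seq (.const n 0) (.clearRegs n)

lemma run_clearRegs (n : ℕ) (ρ : ℕ → K) (S : ℕ → List K) :
    ∃ (ρ' : ℕ → K) (t : ℕ), Run M (.clearRegs n) ⟨ρ, S⟩ ⟨ρ', S⟩ t ∧ (∀ r < n, ρ' r = 0) ∧
      (∀ r, n ≤ r → ρ' r = ρ r) ∧ t ≤ n * (1 + M.size 0) + 1 := by
  induction n generalizing ρ with
  | zero => exact ⟨ρ, 1, Run.skip _, by simp, by simp, by simp⟩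
  | succ n ih =>
    obtain ⟨ρ', t, h, h₁, h₂, ht⟩ := ih (Function.update ρ n 0)
    have h₀ := Run.const (M := M) ⟨ρ, S⟩ n 0
    simp only [State.setReg, Rat.cast_zero] at h₀
    refine ⟨ρ', _, Run.seq h₀ h, fun r hr => ?_, fun r hr => ?_, by rw [add_mul]; omega⟩
    · rcases Nat.lt_succ_iff_lt_or_eq.1 hr with hr | rfl
      · exact h₁ r hr
      · simp [h₂ r le_rfl]
    · rw [h₂ r (by omega), Function.update_of_ne (by omega)]

lemma stacksOf_ofFn {S : ℕ → List K} {n : ℕ} (hS : ∀ s, n ≤ s → S s = []) :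
    stacksOf (List.ofFn fun i : Fin n => S i) = S := by
  funext s
  rcases lt_or_ge s n with h | h
  · simp [stacksOf, h]
  · rw [hS s h, stacksOf_of_le (by simpa using h)]

variable [IsStrictOrderedRing K] [FeasibleMachine M]

/-- The result of a program that runs in polynomial time, on an input list that has been computed,
can be computed in polynomial time. -/
lemma PolyNum.of_run {Γ : Type} {D : Γ → Prop} {xs : List (Γ → List K)} {f : Γ → List K}
    {g : Γ → K} (hf : PolyList M D xs f) {P : Prog} {p : Polynomial ℕ}
    (h : ∀ γ, D γ → ∃ (τ : State K) (t : ℕ), Run M P (State.start (f γ)) τ t ∧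
      t ≤ p.eval (inputSize M (f γ)) ∧ τ.reg 0 = g γ) : PolyNum M D xs g := by
  set n := max P.bound 1 with hn
  set T : Γ → ℕ := fun γ => p.eval (inputSize M (f γ)) with hT
  set Z : Γ → ℕ := fun γ => inputSize M (f γ) + T γ + n + (M.size 0 + T γ + 1) with hZ
  have hin : PolyBounded M D [f] fun γ => inputSize M (f γ) :=
    (PolyList.var (by simp)).bounded
  have hTb : PolyBounded M D [f] T := hin.eval p
  have hZb : PolyBounded M D [f] Z :=
    ((hin.add hTb).add (.const n)).add (((PolyBounded.const _).add hTb).add (.const 1))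
  refine PolyList.of_stackRun (ys := [f]) (by simpa using hf) (P := .seq (.clearRegs n)
    (.seq P (.seq (.push n 0) (.dropBlock 0 n 1))))
    (((PolyBounded.const (n * (1 + M.size 0) + 1)).add hTb).add
      (((PolyBounded.const (1 + M.size 0)).add hTb).add (((PolyBounded.const n).mul
        ((((PolyBounded.const (drainCost M 0)).mul hZb).add
          ((PolyBounded.const (2 * drainCost M 1)).mul hZb)).add (.const 1))).add (.const 1))))
    fun γ hγ r => ?_
  obtain ⟨τ, t, hrun, ht, hg⟩ := h γ hγ
  have hstart : (State.start (f γ)).stack = stacksOf [f γ] := by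
    funext s
    rcases s with - | s
    · rfl
    · simp [State.start, stacksOf]
  obtain ⟨ρ, t₀, h₀, hρ, -, ht₀⟩ := run_clearRegs (M := M) n r (stacksOf [f γ])
  obtain ⟨ρ', h₁, hρ'⟩ := hrun.congr_reg (n := n) (le_max_left _ _) ρ hρ
  have hempty : ∀ s, n ≤ s → τ.stack s = [] := by
    intro s hs
    rw [hrun.stack_eq_of_bound_le (by omega), hstart, stacksOf_of_le (by simp; omega)]
  set L := List.ofFn fun i : Fin n => τ.stack i with hL
  have hLlen : L.length = n := by simp [hL]
  have hLτ : stacksOf L = τ.stack := stacksOf_ofFn hempty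
  have hρ0 : ρ' 0 = g γ := (hρ' 0 (by omega)).trans hg
  have h₂ := run_push_length (M := M) L 0 ρ'
  have hsize : M.size (g γ) ≤ M.size 0 + T γ := by
    have := hrun.size_reg_le 0
    rw [hg] at this
    exact this.trans (by simp [State.start]; omega)
  have h₃ := stackRun_dropBlock (M := M) [] L [[g γ]]
  have hLZ : stacksSize M (L ++ [[g γ]]) ≤ Z γ := by
    have e := hrun.sum_inputSize_le n
    rw [hstart, ← hLτ] at e
    have e₁ := sum_inputSize_stacksOf M L n hLlen.le
    have e₂ := sum_inputSize_stacksOf M [f γ] n (by simp; omega)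
    have e₃ : stacksSize M [f γ] = inputSize M (f γ) + 1 := by simp [stacksSize]
    have e₄ : stacksSize M [[g γ]] = M.size (g γ) + 1 := by simp [stacksSize, inputSize]
    have ht' : t ≤ T γ := ht
    have hZγ : Z γ = inputSize M (f γ) + T γ + n + (M.size 0 + T γ + 1) := rfl
    simp only [List.length_singleton] at e₂
    rw [stacksSize_append, e₄]
    omega
  rw [hstart] at h₁
  rw [hρ0, hLτ, hLlen] at h₂
  rw [List.nil_append, hLlen] at h₃
  obtain ⟨r', t₃, ht₃, h₃⟩ := h₃ ρ'
  refine ⟨r', _, ?_, Run.seq h₀ (Run.seq h₁ (Run.seq h₂ h₃))⟩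
  have hmono : n * (drainCost M 0 * stacksSize M (L ++ [[g γ]]) +
      2 * drainCost M 1 * stacksSize M (L ++ [[g γ]]) + 1) + 1 ≤
      n * (drainCost M 0 * Z γ + 2 * drainCost M 1 * Z γ + 1) + 1 := by gcongr
  have ht' : t ≤ T γ := ht
  omega

end Subroutine

/-! ### Arbitrary components on enumerated domains -/

section Enumerated

variable {C : ComponentClass}

lemma ComponentClass.HasPolyTimeInference.polyNum_eval (hC : C.HasPolyTimeInference) {Γ : Type}
    {D : Γ → Prop} {xs : List (Γ → List ℚ)} {c : Γ → List ℚ} {v : Γ → ℚ}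
    (hc : PolyList bitMachine D xs c) (hv : PolyNum bitMachine D xs v)
    (h : ∀ γ, D γ → v γ ∈ C.domain (c γ)) :
    PolyNum bitMachine D xs fun γ => C.eval (c γ) (v γ) := by
  obtain ⟨P, p, hP⟩ := hC
  exact PolyNum.of_run (PolyList.cons hv hc) fun γ hγ => hP (c γ) (v γ) (h γ hγ)

lemma enumeratedFeatures_tractable (hC : C.HasPolyTimeInference) :
    (enumeratedFeatures C).Tractable bitMachine := by
  have hcode : ∀ {D : EnumeratedFeature C × ℚ → Prop}, PolyList bitMachine D
      [fun p => (enumeratedFeatures C).code p.1, fun p => [p.2]]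
      fun p => (enumeratedFeatures C).code p.1 := PolyList.var (by simp)
  have hpt : ∀ {D : EnumeratedFeature C × ℚ → Prop}, PolyNum bitMachine D
      [fun p => (enumeratedFeatures C).code p.1, fun p => [p.2]] fun p => p.2 :=
    PolyList.var (by simp)
  have hlen : ∀ {D : EnumeratedFeature C × ℚ → Prop}, PolyNum bitMachine D
      [fun p => (enumeratedFeatures C).code p.1, fun p => [p.2]]
      fun p => ((p.1.values.length : ℕ) : ℚ) := hcode.head
  have hlenb : ∀ {D : EnumeratedFeature C × ℚ → Prop}, PolyBounded bitMachine D
      [fun p => (enumeratedFeatures C).code p.1, fun p => [p.2]] fun p => p.1.values.length :=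
    hcode.bounded_length fun p _ => by simp [enumeratedFeatures]; omega
  have hmodel : ∀ {D : EnumeratedFeature C × ℚ → Prop}, PolyList bitMachine D
      [fun p => (enumeratedFeatures C).code p.1, fun p => [p.2]] fun p => p.1.model :=
    (hcode.tail.drop hlen fun p _ => by simp [enumeratedFeatures]).congr fun p _ => by
      simp [enumeratedFeatures]
  refine ⟨hC.polyNum_eval hmodel hpt fun p hp => p.1.values_mem _ hp, ?_⟩
  -- the supremum is the maximum over the list of values
  refine ⟨fun e b => maxUpTo (fun i => toLex (b * C.eval e.model (e.values.getD i 0), 0))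
    e.values.length, ?_, ?_⟩
  · intro e b he
    obtain ⟨v, hv⟩ := he
    have hpos : 0 < e.values.length := List.length_pos_of_mem hv
    have key := IsLexSup.maxUpTo (V := fun i => {b * C.eval e.model (e.values.getD i 0)})
      (q := fun i => toLex (b * C.eval e.model (e.values.getD i 0), 0)) hpos
      fun i _ => isGreatest_singleton.isLexSup
    convert key using 1
    ext w
    simp only [Set.mem_image, Set.mem_ofPred_eq, Set.mem_singleton_iff]
    constructor
    · rintro ⟨z, hz, rfl⟩
      obtain ⟨i, hi, rfl⟩ := List.getElem_of_mem (show z ∈ e.values from hz)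
      exact ⟨i, hi, by rw [List.getD_eq_getElem _ _ hi]; rfl⟩
    · rintro ⟨i, hi, rfl⟩
      exact ⟨e.values[i], List.getElem_mem hi, by rw [List.getD_eq_getElem _ _ hi]; rfl⟩
  · set D : EnumeratedFeature C × ℚ → Prop :=
      fun p => ((enumeratedFeatures C).dom p.1).Nonempty with hD
    have hlift : ∀ {y : EnumeratedFeature C × ℚ → ℚ}, PolyNum bitMachine D
        [fun p => (enumeratedFeatures C).code p.1, fun p => [p.2]] y →
        PolyNum bitMachine (fun p : (EnumeratedFeature C × ℚ) × ℕ =>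
          D p.1 ∧ p.2 < p.1.1.values.length)
        (liftFst [fun p => (enumeratedFeatures C).code p.1, fun p => [p.2]] ++
          [loopIndex ℚ (EnumeratedFeature C × ℚ)]) fun p => y p.1 :=
      fun h => h.lift (fun p hp => hp.1) (by simp)
    have hliftL : ∀ {y : EnumeratedFeature C × ℚ → List ℚ}, PolyList bitMachine D
        [fun p => (enumeratedFeatures C).code p.1, fun p => [p.2]] y →
        PolyList bitMachine (fun p : (EnumeratedFeature C × ℚ) × ℕ =>
          D p.1 ∧ p.2 < p.1.1.values.length)
        (liftFst [fun p => (enumeratedFeatures C).code p.1, fun p => [p.2]] ++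
          [loopIndex ℚ (EnumeratedFeature C × ℚ)]) fun p => y p.1 :=
      fun h => h.lift (fun p hp => hp.1) (by simp)
    have hval : PolyNum bitMachine (fun p : (EnumeratedFeature C × ℚ) × ℕ =>
          D p.1 ∧ p.2 < p.1.1.values.length)
        (liftFst [fun p => (enumeratedFeatures C).code p.1, fun p => [p.2]] ++
          [loopIndex ℚ (EnumeratedFeature C × ℚ)]) fun p => p.1.1.values.getD p.2 0 := by
      refine (PolyNum.getD (hliftL hcode.tail) (PolyNum.counter (by simp)) fun p hp => ?_).congr
        fun p hp => ?_
      · have := hp.2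
        simp [enumeratedFeatures]
        omega
      · simp [enumeratedFeatures, List.getElem?_append_left hp.2]
    have hq : PolyPair bitMachine (fun p : (EnumeratedFeature C × ℚ) × ℕ =>
          D p.1 ∧ p.2 < p.1.1.values.length)
        (liftFst [fun p => (enumeratedFeatures C).code p.1, fun p => [p.2]] ++
          [loopIndex ℚ (EnumeratedFeature C × ℚ)])
        fun p => toLex (p.1.2 * C.eval p.1.1.model (p.1.1.values.getD p.2 0), 0) :=
      PolyPair.mk (PolyNum.mul (hlift hpt) (hC.polyNum_eval (hliftL hmodel) hval fun p hp =>
        p.1.1.values_mem _ (by rw [List.getD_eq_getElem _ _ hp.2]; exact List.getElem_mem _)))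
        .zero
    exact PolyPair.maxUpTo (N := fun p : EnumeratedFeature C × ℚ => p.1.values.length) (D := D)
      hlen hlenb (fun p ⟨v, hv⟩ => List.length_pos_of_mem hv) hq

end Enumerated

/-! ### Evaluating cubic splines -/

section Cubic

variable {K : Type} [Field K]

/-- The cubic polynomial with coefficients `c 0, …, c 3`. -/
def cubic (c : ℕ → K) (w : K) : K := c 0 + c 1 * w + c 2 * w ^ 2 + c 3 * w ^ 3

lemma cubic_mul (b : K) (c : ℕ → K) (w : K) : cubic (fun k => b * c k) w = b * cubic c w := by
  simp only [cubic]; ring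

end Cubic

section Splines

set_option linter.unusedSectionVars false

variable {K : Type} [Field K] [LinearOrder K] (s : CubicSpline K)

/-- The `j`-th knot, read off the code. -/
def CubicSpline.knotAt (j : ℕ) : K := s.code.getD (j + 1) 0

/-- The `k`-th coefficient of piece `j`, read off the code. -/
def CubicSpline.coeffAt (j k : ℕ) : K := s.code.getD (s.pieces + 2 + (4 * j + k)) 0

/-- `v` lies in the `j`-th interval. -/
def CubicSpline.OnPiece (j : ℕ) (v : K) : Prop :=
  s.knotAt j ≤ v ∧ (v < s.knotAt (j + 1) ∨ j + 1 = s.pieces ∧ v ≤ s.knotAt (j + 1))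

lemma CubicSpline.code_eq : s.code = (s.pieces : K) ::
    (List.ofFn s.knot ++ List.ofFn fun i : Fin (s.pieces * 4) =>
      s.coeff ⟨i / 4, Nat.div_lt_of_lt_mul (by omega)⟩ ⟨i % 4, Nat.mod_lt _ (by norm_num)⟩) := by
  rw [CubicSpline.code, List.ofFn_mul]
  congr 3
  refine congrArg List.ofFn (funext fun j => congrArg List.ofFn (funext fun k => ?_))
  congr 1
  all_goals ext; simp only; omega

lemma CubicSpline.length_code : s.code.length = s.pieces + 2 + 4 * s.pieces := by
  rw [s.code_eq]
  simp
  omega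

lemma CubicSpline.knotAt_of_lt {j : ℕ} (h : j < s.pieces + 1) : s.knotAt j = s.knot ⟨j, h⟩ := by
  rw [CubicSpline.knotAt, s.code_eq, List.getD_cons_succ,
    List.getD_append _ _ _ _ (by simpa using h),
    List.getD_eq_getElem _ _ (by simpa using h), List.getElem_ofFn]

lemma CubicSpline.coeffAt_of_lt {j k : ℕ} (hj : j < s.pieces) (hk : k < 4) :
    s.coeffAt j k = s.coeff ⟨j, hj⟩ ⟨k, hk⟩ := by
  rw [CubicSpline.coeffAt, s.code_eq,
    show s.pieces + 2 + (4 * j + k) = s.pieces + 1 + (4 * j + k) + 1 by omega,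
    List.getD_cons_succ, List.getD_append_right _ _ _ _ (by simp),
    List.getD_eq_getElem _ _ (by simp; omega), List.getElem_ofFn]
  congr 1
  · ext; simp only [List.length_ofFn]; omega
  · rw [Fin.mk.injEq]; simp only [List.length_ofFn]; omega

lemma CubicSpline.knotAt_lt {i j : ℕ} (hij : i < j) (hj : j ≤ s.pieces) :
    s.knotAt i < s.knotAt j := by
  rw [s.knotAt_of_lt (by omega : i < s.pieces + 1), s.knotAt_of_lt (by omega : j < s.pieces + 1)]
  exact s.knot_strictMono hij

lemma CubicSpline.knotAt_le {i j : ℕ} (hij : i ≤ j) (hj : j ≤ s.pieces) :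
    s.knotAt i ≤ s.knotAt j := by
  rcases hij.lt_or_eq with h | rfl
  · exact (s.knotAt_lt h hj).le
  · exact le_rfl

lemma CubicSpline.mem_interval (j : Fin s.pieces) (v : K) : v ∈ s.interval j ↔ s.OnPiece j v := by
  have h₁ : s.knotAt j = s.knot j.castSucc := s.knotAt_of_lt (by omega)
  have h₂ : s.knotAt (j + 1) = s.knot j.succ := s.knotAt_of_lt (by omega)
  rw [CubicSpline.OnPiece, CubicSpline.interval, h₁, h₂]
  split_ifs with h
  · simp only [Set.mem_Icc, h, true_and]
    exact and_congr_right fun _ => ⟨.inr, fun h => h.elim le_of_lt id⟩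
  · simp only [Set.mem_Ico, h, false_and, or_false]

open Classical in
lemma CubicSpline.eval_eq_sum_range (v : K) : s.eval v =
    ∑ j ∈ Finset.range s.pieces, if s.OnPiece j v then cubic (s.coeffAt j) v else 0 := by
  rw [CubicSpline.eval, Finset.sum_range]
  refine Finset.sum_congr rfl fun j _ => ?_
  rw [Set.indicator_apply]
  refine if_congr (s.mem_interval j v) ?_ rfl
  rw [Fin.sum_univ_four, cubic, s.coeffAt_of_lt j.2 (by norm_num),
    s.coeffAt_of_lt j.2 (by norm_num),
    s.coeffAt_of_lt j.2 (by norm_num), s.coeffAt_of_lt j.2 (by norm_num)]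
  simp

lemma CubicSpline.OnPiece.le_of {s : CubicSpline K} {i j : ℕ} {v : K} (hj : j < s.pieces)
    (h₁ : s.OnPiece i v) (h₂ : s.OnPiece j v) : j ≤ i := by
  by_contra hij
  rcases h₁.2 with h | h
  · exact (h.trans_le (s.knotAt_le (by omega) hj.le)).not_ge h₂.1
  · omega

lemma CubicSpline.eval_of_onPiece {s : CubicSpline K} {j : ℕ} {v : K} (hj : j < s.pieces)
    (h : s.OnPiece j v) : s.eval v = cubic (s.coeffAt j) v := by
  classical
  rw [s.eval_eq_sum_range, Finset.sum_eq_single_of_mem j (Finset.mem_range.2 hj), if_pos h]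
  intro i hi hij
  rw [if_neg]
  intro h'
  exact hij (le_antisymm (h.le_of (Finset.mem_range.1 hi) h') (h'.le_of hj h))

lemma CubicSpline.exists_onPiece {v : K} (h₁ : s.knotAt 0 ≤ v) (h₂ : v ≤ s.knotAt s.pieces) :
    ∃ j < s.pieces, s.OnPiece j v := by
  have key : ∀ n, n + 1 ≤ s.pieces → v ≤ s.knotAt (n + 1) →
      (n + 1 = s.pieces ∨ v < s.knotAt (n + 1)) →
      ∃ j < s.pieces, s.OnPiece j v := by
    intro n
    induction n with
    | zero => exact fun hn hv h => ⟨0, by omega, h₁, h.elim (fun h => .inr ⟨h, hv⟩) .inl⟩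
    | succ n ih =>
      intro hn hv h
      rcases lt_or_ge v (s.knotAt (n + 1)) with h' | h'
      · exact ih (by omega) h'.le (.inr h')
      · exact ⟨n + 1, by omega, h', h.elim (fun h => .inr ⟨h, hv⟩) .inl⟩
  obtain ⟨n, hn⟩ := Nat.exists_eq_succ_of_ne_zero s.pieces_pos.ne'
  exact key n hn.ge (by rwa [hn] at h₂) (.inl hn.symm)

lemma CubicSpline.OnPiece.bounds {s : CubicSpline K} {j : ℕ} {v : K} (hj : j < s.pieces)
    (h : s.OnPiece j v) : s.knotAt 0 ≤ v ∧ v ≤ s.knotAt s.pieces :=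
  ⟨(s.knotAt_le (Nat.zero_le _) hj.le).trans h.1,
    (h.2.elim le_of_lt And.right).trans (s.knotAt_le hj le_rfl)⟩

/-- The values of a multiple of a spline, piece by piece. -/
lemma CubicSpline.image_eval_eq {X : Set K}
    (hX : ∀ v ∈ X, s.knotAt 0 ≤ v ∧ v ≤ s.knotAt s.pieces) (b : K) :
    (fun v => b * s.eval v) '' X = {w | ∃ j < s.pieces,
      w ∈ cubic (fun k => b * s.coeffAt j k) '' {v | v ∈ X ∧ s.OnPiece j v}} := by
  ext w
  constructor
  · rintro ⟨v, hv, rfl⟩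
    obtain ⟨j, hj, h⟩ := s.exists_onPiece (hX v hv).1 (hX v hv).2
    exact ⟨j, hj, v, ⟨hv, h⟩, by simp only [cubic_mul, CubicSpline.eval_of_onPiece hj h]⟩
  · rintro ⟨j, hj, v, ⟨hv, h⟩, rfl⟩
    exact ⟨v, hv, by simp only [cubic_mul, CubicSpline.eval_of_onPiece hj h]⟩

variable {Γ : Type} [IsStrictOrderedRing K] {M : Machine K} [FeasibleMachine M] {D : Γ → Prop}
  {xs : List (Γ → List K)}

lemma PolyNum.cubic {c : Γ → ℕ → K} {w : Γ → K} (hc : ∀ k < 4, PolyNum M D xs fun γ => c γ k)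
    (hw : PolyNum M D xs w) : PolyNum M D xs fun γ => cubic (c γ) (w γ) :=
  ((((hc 0 (by norm_num)).add ((hc 1 (by norm_num)).mul hw)).add
    ((hc 2 (by norm_num)).mul (hw.mul hw))).add
      ((hc 3 (by norm_num)).mul ((hw.mul hw).mul hw))).congr fun γ _ => by
        simp only [_root_.cubic]; ring

variable {t : Γ → CubicSpline K} {j : Γ → ℕ}

lemma PolyList.pieces (ht : PolyList M D xs fun γ => (t γ).code) :
    PolyNum M D xs fun γ => ((t γ).pieces : K) := ht.head

lemma PolyList.bounded_pieces (ht : PolyList M D xs fun γ => (t γ).code) :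
    PolyBounded M D xs fun γ => (t γ).pieces :=
  ht.bounded_length fun γ _ => by rw [(t γ).length_code]; omega

lemma PolyList.knotAt (ht : PolyList M D xs fun γ => (t γ).code)
    (hj : PolyNum M D xs fun γ => (j γ : K)) (hlt : ∀ γ, D γ → j γ ≤ (t γ).pieces) :
    PolyNum M D xs fun γ => (t γ).knotAt (j γ) :=
  PolyNum.getD (N := fun γ => j γ + 1) ht ((hj.add .one).congr fun γ _ => by push_cast; rfl)
    fun γ hγ => by have := hlt γ hγ; rw [(t γ).length_code]; omega

lemma PolyList.coeffAt (ht : PolyList M D xs fun γ => (t γ).code)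
    (hj : PolyNum M D xs fun γ => (j γ : K)) (hlt : ∀ γ, D γ → j γ < (t γ).pieces) {k : ℕ}
    (hk : k < 4) : PolyNum M D xs fun γ => (t γ).coeffAt (j γ) k :=
  PolyNum.getD (N := fun γ => (t γ).pieces + 2 + (4 * j γ + k)) ht
    (((ht.pieces.add (.natCast 2)).add (((PolyNum.natCast 4).mul hj).add (.natCast k))).congr
      fun γ _ => by push_cast; rfl)
    fun γ hγ => by have := hlt γ hγ; rw [(t γ).length_code]; omega

lemma PolyList.onPiece (ht : PolyList M D xs fun γ => (t γ).code)
    (hj : PolyNum M D xs fun γ => (j γ : K)) (hlt : ∀ γ, D γ → j γ < (t γ).pieces) {v : Γ → K}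
    (hv : PolyNum M D xs v) : PolyPred M D xs fun γ => (t γ).OnPiece (j γ) (v γ) := by
  have hj' : PolyNum M D xs fun γ => ((j γ + 1 : ℕ) : K) :=
    (hj.add .one).congr fun γ _ => by push_cast; rfl
  have h₁ := ht.knotAt hj fun γ hγ => (hlt γ hγ).le
  have h₂ := ht.knotAt hj' hlt
  exact ((PolyPred.le h₁ hv).and ((PolyPred.lt hv h₂).or ((PolyPred.eq hj' ht.pieces).and
    (PolyPred.le hv h₂)))).congr fun γ _ => by
      rw [CubicSpline.OnPiece, Nat.cast_inj]

lemma PolyList.splineEval (ht : PolyList M D xs fun γ => (t γ).code) {v : Γ → K}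
    (hv : PolyNum M D xs v) : PolyNum M D xs fun γ => (t γ).eval (v γ) := by
  classical
  have ht' : PolyList M (fun p : Γ × ℕ => D p.1 ∧ p.2 < (t p.1).pieces)
      (liftFst xs ++ [loopIndex K Γ]) fun p => (t p.1).code := ht.lift (fun p hp => hp.1) (by simp)
  have hv' : PolyNum M (fun p : Γ × ℕ => D p.1 ∧ p.2 < (t p.1).pieces)
      (liftFst xs ++ [loopIndex K Γ]) fun p => v p.1 := hv.lift (fun p hp => hp.1) (by simp)
  have hi : PolyNum M (fun p : Γ × ℕ => D p.1 ∧ p.2 < (t p.1).pieces)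
      (liftFst xs ++ [loopIndex K Γ]) fun p => (p.2 : K) := PolyNum.counter (by simp)
  have hp := ht'.onPiece hi (fun p hp => hp.2) hv'
  have hc := PolyNum.cubic (c := fun p : Γ × ℕ => (t p.1).coeffAt p.2)
    (fun k hk => ht'.coeffAt hi (fun p hp => hp.2) hk) hv'
  exact (PolyNum.sum ht.pieces ht.bounded_pieces (PolyNum.ite hp (hc.mono fun _ h => h.1)
    .zero)).congr fun γ _ => (t γ).eval_eq_sum_range (v γ)

end Splines

/-! ### Suprema of cubic splines on an interval -/

section Continuous

/-- Real numbers among which all zeros of the derivative of `cubic c` are, unless this polynomial is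
constant: the solutions of the quadratic equation with coefficients `3 * c 3`, `2 * c 2`, `c 1`, and
of the linear equation with coefficients `2 * c 2`, `c 1`. Where these equations have no solution,
the entries are arbitrary numbers, which do no harm as mere candidates for a maximum. -/
noncomputable def criticalPoint (c : ℕ → ℝ) : Fin 3 → ℝ :=
  ![(-(2 * c 2) + √(2 * c 2 * (2 * c 2) - 4 * (3 * c 3) * c 1)) / (2 * (3 * c 3)),
    (-(2 * c 2) - √(2 * c 2 * (2 * c 2) - 4 * (3 * c 3) * c 1)) / (2 * (3 * c 3)),
    -c 1 / (2 * c 2)]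

lemma hasDerivAt_cubic (c : ℕ → ℝ) (w : ℝ) :
    HasDerivAt (cubic c) (c 1 + 2 * c 2 * w + 3 * c 3 * w ^ 2) w := by
  have h := (((hasDerivAt_const w (c 0)).add ((hasDerivAt_id w).const_mul (c 1))).add
    (((hasDerivAt_id w).pow 2).const_mul (c 2))).add (((hasDerivAt_id w).pow 3).const_mul (c 3))
  refine (h.congr_deriv ?_)
  simp
  ring

lemma continuous_cubic (c : ℕ → ℝ) : Continuous (cubic c) := by
  unfold cubic; fun_prop

lemma exists_criticalPoint_eq {c : ℕ → ℝ} {w : ℝ} (h : c 1 + 2 * c 2 * w + 3 * c 3 * w ^ 2 = 0) :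
    (∃ i, w = criticalPoint c i) ∨ ∀ v v', cubic c v = cubic c v' := by
  by_cases hA : 3 * c 3 = 0
  · have h3 : c 3 = 0 := by simpa using hA
    by_cases hB : 2 * c 2 = 0
    · have h2 : c 2 = 0 := by simpa using hB
      have h1 : c 1 = 0 := by simpa [h2, h3] using h
      exact .inr fun v v' => by simp [cubic, h1, h2, h3]
    · refine .inl ⟨2, ?_⟩
      simp only [criticalPoint, Matrix.cons_val]
      rw [eq_div_iff hB]
      rw [hA] at h
      linarith
  · have hd : 2 * c 2 * (2 * c 2) - 4 * (3 * c 3) * c 1 =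
        (2 * (3 * c 3) * w + 2 * c 2) * (2 * (3 * c 3) * w + 2 * c 2) := by
      linear_combination (-4 * (3 * c 3)) * h
    have hA' : 2 * (3 * c 3) ≠ 0 := by simpa using hA
    have hs := Real.sqrt_mul_self_eq_abs (2 * (3 * c 3) * w + 2 * c 2)
    rw [← hd] at hs
    left
    rcases abs_choice (2 * (3 * c 3) * w + 2 * c 2) with h' | h' <;> rw [h'] at hs
    · refine ⟨0, ?_⟩
      simp only [criticalPoint, Matrix.cons_val]
      rw [hs, eq_div_iff hA']
      ring
    · refine ⟨1, ?_⟩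
      simp only [criticalPoint, Matrix.cons_val]
      rw [hs, eq_div_iff hA']
      ring

open Classical in
/-- The value of `cubic c` at `r` if `r` lies between `a` and `b`, and its value at `a` if not. -/
noncomputable def valueWithin (c : ℕ → ℝ) (a b r : ℝ) : ℝ :=
  if a < r ∧ r < b then cubic c r else cubic c a

open Classical in
/-- The supremum of `cubic c` between `a` and `b`, where `b` is included if `closed` holds: the
largest of the values at the two ends and at the critical points. -/
noncomputable def supCubic (c : ℕ → ℝ) (a b : ℝ) (closed : Prop) : ℝ ×ₗ ℝ :=
  max (max (toLex (cubic c a, 0)) (toLex (cubic c b, if closed then 0 else -1)))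
    (max (max (toLex (valueWithin c a b (criticalPoint c 0), 0))
      (toLex (valueWithin c a b (criticalPoint c 1), 0)))
      (toLex (valueWithin c a b (criticalPoint c 2), 0)))

lemma valueWithin_eq (c : ℕ → ℝ) {a b : ℝ} (hab : a < b) (r : ℝ) :
    ∃ v, a ≤ v ∧ v < b ∧ valueWithin c a b r = cubic c v := by
  unfold valueWithin
  split_ifs with h
  · exact ⟨r, h.1.le, h.2, rfl⟩
  · exact ⟨a, le_rfl, hab, rfl⟩

lemma toLex_valueWithin_le_supCubic (c : ℕ → ℝ) (a b : ℝ) (closed : Prop) (i : Fin 3) :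
    toLex (valueWithin c a b (criticalPoint c i), 0) ≤ supCubic c a b closed := by
  fin_cases i <;> simp [supCubic]

lemma toLex_le_toLex_of_lt {x y k l : ℝ} (h : x < y) : toLex (x, k) ≤ toLex (y, l) :=
  Prod.Lex.toLex_le_toLex.2 (.inl h)

lemma toLex_le_toLex_of_le {x y : ℝ} (h : x ≤ y) : toLex (x, (0 : ℝ)) ≤ toLex (y, 0) := by
  rcases h.lt_or_eq with h | rfl
  · exact toLex_le_toLex_of_lt h
  · exact le_rfl

lemma supCubic_le {c : ℕ → ℝ} {a b : ℝ} {closed : Prop} (hab : a < b) {q : ℝ ×ₗ ℝ}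
    (h : ∀ v, a ≤ v → v < b → toLex (cubic c v, 0) ≤ q)
    (hb : toLex (cubic c b, open Classical in if closed then 0 else -1) ≤ q) :
    supCubic c a b closed ≤ q := by
  have hr : ∀ r, toLex (valueWithin c a b r, 0) ≤ q := by
    intro r
    obtain ⟨v, h₁, h₂, e⟩ := valueWithin_eq c hab r
    exact e ▸ h v h₁ h₂
  exact max_le (max_le (h a le_rfl hab) hb) (max_le (max_le (hr _) (hr _)) (hr _))

/-- The maximum over the closed interval exists and is taken at an end or at a critical point. If
`b` is excluded and the maximum is attained at `b` only, it is a supremum that is not attained. -/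
lemma isLexSup_supCubic (c : ℕ → ℝ) {a b : ℝ} (hab : a < b) (closed : Prop) :
    IsLexSup (cubic c '' {v | a ≤ v ∧ (v < b ∨ closed ∧ v ≤ b)}) (supCubic c a b closed) := by
  classical
  have ha : toLex (cubic c a, 0) ≤ supCubic c a b closed :=
    (le_max_left _ _).trans (le_max_left _ _)
  have hb : toLex (cubic c b, if closed then 0 else -1) ≤ supCubic c a b closed :=
    (le_max_right _ _).trans (le_max_left _ _)
  obtain ⟨m, hm, hmax⟩ := isCompact_Icc.exists_isMaxOn (Set.nonempty_Icc.2 hab.le)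
    (continuous_cubic c).continuousOn
  by_cases hex : ∃ w, (a ≤ w ∧ (w < b ∨ closed ∧ w ≤ b)) ∧ ∀ v ∈ Set.Icc a b, cubic c v ≤ cubic c w
  · obtain ⟨w, hw, hwmax⟩ := hex
    have hle : toLex (cubic c w, 0) ≤ supCubic c a b closed := by
      rcases hw.1.eq_or_lt with rfl | haw
      · exact ha
      · by_cases hwb : w < b
        · have hloc : IsLocalMax (cubic c) w := by
            filter_upwards [Icc_mem_nhds haw hwb] with v hv using hwmax v hv
          rcases exists_criticalPoint_eq (hloc.hasDerivAt_eq_zero (hasDerivAt_cubic c w)) with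
            ⟨i, hi⟩ | hconst
          · have := toLex_valueWithin_le_supCubic c a b closed i
            rwa [valueWithin, if_pos (by rw [← hi]; exact ⟨haw, hwb⟩), ← hi] at this
          · rwa [hconst w a]
        · have hc : closed ∧ w ≤ b := hw.2.resolve_left hwb
          obtain rfl : w = b := le_antisymm hc.2 (not_lt.1 hwb)
          rwa [if_pos hc.1] at hb
    have heq : supCubic c a b closed = toLex (cubic c w, 0) := by
      refine le_antisymm (supCubic_le hab (fun v h₁ h₂ => toLex_le_toLex_of_le
        (hwmax v ⟨h₁, h₂.le⟩)) ?_) hle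
      refine Prod.Lex.toLex_le_toLex.2 ?_
      rcases (hwmax b ⟨hab.le, le_rfl⟩).lt_or_eq with h | h
      · exact .inl h
      · exact .inr ⟨h, by dsimp only; split_ifs <;> norm_num⟩
    rw [heq]
    refine IsGreatest.isLexSup ⟨⟨w, hw, rfl⟩, ?_⟩
    rintro _ ⟨v, hv, rfl⟩
    exact hwmax v ⟨hv.1, hv.2.elim le_of_lt And.right⟩
  · -- the maximum over the closed interval is attained at `b` only, and `b` is excluded
    push Not at hex
    have hmb : m = b := by
      by_contra hne
      obtain ⟨v, hv, hlt⟩ := hex m ⟨hm.1, .inl (lt_of_le_of_ne hm.2 hne)⟩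
      exact hlt.not_ge (hmax hv)
    subst hmb
    have hnc : ¬ closed := fun hc => by
      obtain ⟨v, hv, hlt⟩ := hex m ⟨hm.1, .inr ⟨hc, le_rfl⟩⟩
      exact hlt.not_ge (hmax hv)
    have hlt : ∀ v, a ≤ v → v < m → cubic c v < cubic c m := by
      intro v h₁ h₂
      obtain ⟨w, hw, hlt⟩ := hex v ⟨h₁, .inl h₂⟩
      exact hlt.trans_le (hmax hw)
    have heq : supCubic c a m closed = toLex (cubic c m, -1) := by
      rw [if_neg hnc] at hb
      refine le_antisymm (supCubic_le hab (fun v h₁ h₂ => toLex_le_toLex_of_lt (hlt v h₁ h₂)) ?_) hb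
      rw [if_neg hnc]
    rw [heq]
    refine ⟨?_, by simp, by simp, ?_⟩
    · rintro _ ⟨v, hv, rfl⟩
      exact toLex_le_toLex_of_lt (hlt v hv.1 (hv.2.resolve_right fun h => hnc h.1))
    · intro ε hε
      have h₁ : ∀ᶠ v in nhdsWithin m (Set.Iio m), cubic c m - ε < cubic c v :=
        ((continuous_cubic c).tendsto m).mono_left nhdsWithin_le_nhds |>.eventually_const_lt
          (sub_lt_self _ hε)
      obtain ⟨v, h₂, h₃⟩ := (h₁.and (Ico_mem_nhdsLT hab)).exists
      exact ⟨_, ⟨v, ⟨h₃.1, .inl h₃.2⟩, rfl⟩, h₂⟩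

variable {Γ : Type} {D : Γ → Prop} {xs : List (Γ → List ℝ)}

lemma PolyNum.sqrt {a : Γ → ℝ} (ha : PolyNum realMachine D xs a) :
    PolyNum realMachine D xs fun γ => √(a γ) := ha.prim

lemma polyNum_criticalPoint {c : Γ → ℕ → ℝ}
    (hc : ∀ k < 4, PolyNum realMachine D xs fun γ => c γ k) (i : Fin 3) :
    PolyNum realMachine D xs fun γ => criticalPoint (c γ) i := by
  have h₁ := hc 1 (by norm_num)
  have h₂ := (PolyNum.natCast 2).mul (hc 2 (by norm_num))
  have h₃ := (PolyNum.natCast 3).mul (hc 3 (by norm_num))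
  have hs := ((h₂.mul h₂).sub (((PolyNum.natCast 4).mul h₃).mul h₁)).sqrt
  fin_cases i
  · exact (h₂.neg.add hs).div ((PolyNum.natCast 2).mul h₃)
  · exact (h₂.neg.sub hs).div ((PolyNum.natCast 2).mul h₃)
  · exact h₁.neg.div h₂

lemma polyNum_valueWithin {c : Γ → ℕ → ℝ} {a b r : Γ → ℝ}
    (hc : ∀ k < 4, PolyNum realMachine D xs fun γ => c γ k) (ha : PolyNum realMachine D xs a)
    (hb : PolyNum realMachine D xs b) (hr : PolyNum realMachine D xs r) :
    PolyNum realMachine D xs fun γ => valueWithin (c γ) (a γ) (b γ) (r γ) := by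
  classical
  exact (PolyNum.ite ((PolyPred.lt ha hr).and (PolyPred.lt hr hb))
    ((PolyNum.cubic hc hr).mono fun _ h => h.1) ((PolyNum.cubic hc ha).mono fun _ h => h.1)).congr
      fun γ _ => by simp only [valueWithin]

lemma polyPair_supCubic {c : Γ → ℕ → ℝ} {a b : Γ → ℝ} {closed : Γ → Prop}
    (hc : ∀ k < 4, PolyNum realMachine D xs fun γ => c γ k) (ha : PolyNum realMachine D xs a)
    (hb : PolyNum realMachine D xs b) (hclosed : PolyPred realMachine D xs closed) :
    PolyPair realMachine D xs fun γ => supCubic (c γ) (a γ) (b γ) (closed γ) := by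
  classical
  have hr := fun i => PolyPair.mk
    (polyNum_valueWithin hc ha hb (polyNum_criticalPoint hc i)) PolyNum.zero
  exact ((PolyPair.mk (PolyNum.cubic hc ha) .zero).max (PolyPair.mk (PolyNum.cubic hc hb)
    ((PolyNum.ite hclosed .zero PolyNum.one.neg).congr fun γ _ => by congr))).max
      (((hr 0).max (hr 1)).max (hr 2))

lemma continuousSplines_tractable : continuousSplines.Tractable realMachine := by
  have hcode : ∀ {D : CubicSpline ℝ × ℝ → Prop}, PolyList realMachine D
      [fun p => p.1.code, fun p => [p.2]] fun p => p.1.code := PolyList.var (by simp)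
  have hpt : ∀ {D : CubicSpline ℝ × ℝ → Prop}, PolyNum realMachine D
      [fun p => p.1.code, fun p => [p.2]] fun p => p.2 := PolyList.var (by simp)
  refine ⟨PolyList.splineEval (t := fun p : CubicSpline ℝ × ℝ => p.1) hcode hpt,
    fun s b => maxUpTo (fun j => supCubic (fun k => b * s.coeffAt j k) (s.knotAt j)
      (s.knotAt (j + 1)) (j + 1 = s.pieces)) s.pieces, ?_, ?_⟩
  · intro s b _
    have hdom : ∀ v, v ∈ continuousSplines.dom s ↔ s.knotAt 0 ≤ v ∧ v ≤ s.knotAt s.pieces := by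
      intro v
      rw [s.knotAt_of_lt (Nat.succ_pos _), s.knotAt_of_lt (Nat.lt_succ_self _)]
      rfl
    have key := IsLexSup.maxUpTo (n := s.pieces)
      (V := fun j => cubic (fun k => b * s.coeffAt j k) '' {v | s.OnPiece j v})
      (q := fun j => supCubic (fun k => b * s.coeffAt j k) (s.knotAt j)
        (s.knotAt (j + 1)) (j + 1 = s.pieces)) s.pieces_pos fun j hj =>
          isLexSup_supCubic _ (s.knotAt_lt (Nat.lt_succ_self j) hj) _
    convert key using 1
    refine (s.image_eval_eq (fun v hv => (hdom v).1 hv) b).trans ?_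
    ext w
    refine exists_congr fun j => and_congr_right fun hj => ?_
    have : {v | v ∈ continuousSplines.dom s ∧ s.OnPiece j v} = {v | s.OnPiece j v} := by
      ext v
      exact and_iff_right_of_imp fun h => (hdom v).2 (h.bounds hj)
    rw [this]
  · set xs : List (CubicSpline ℝ × ℝ → List ℝ) := [fun p => p.1.code, fun p => [p.2]] with hxs
    set D : CubicSpline ℝ × ℝ → Prop := fun p => (continuousSplines.dom p.1).Nonempty with hD
    set E : (CubicSpline ℝ × ℝ) × ℕ → Prop := fun p => D p.1 ∧ p.2 < p.1.1.pieces with hE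
    have ht : PolyList realMachine E (liftFst xs ++ [loopIndex ℝ (CubicSpline ℝ × ℝ)])
        fun p => p.1.1.code := PolyList.lift (hcode (D := D)) (fun p hp => hp.1) (by simp)
    have hb : PolyNum realMachine E (liftFst xs ++ [loopIndex ℝ (CubicSpline ℝ × ℝ)])
        fun p => p.1.2 := PolyNum.lift (hpt (D := D)) (fun p hp => hp.1) (by simp)
    have hj : PolyNum realMachine E (liftFst xs ++ [loopIndex ℝ (CubicSpline ℝ × ℝ)])
        fun p => (p.2 : ℝ) := PolyNum.counter (by simp)
    have hj' : PolyNum realMachine E (liftFst xs ++ [loopIndex ℝ (CubicSpline ℝ × ℝ)])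
        fun p => ((p.2 + 1 : ℕ) : ℝ) := (hj.add .one).congr fun p _ => by push_cast; rfl
    have hclosed : PolyPred realMachine E (liftFst xs ++ [loopIndex ℝ (CubicSpline ℝ × ℝ)])
        fun p => p.2 + 1 = p.1.1.pieces :=
      (PolyPred.eq hj' ht.pieces).congr fun p _ => by rw [Nat.cast_inj]
    have hq : PolyPair realMachine E (liftFst xs ++ [loopIndex ℝ (CubicSpline ℝ × ℝ)])
        fun p => supCubic (fun k => p.1.2 * p.1.1.coeffAt p.2 k) (p.1.1.knotAt p.2)
          (p.1.1.knotAt (p.2 + 1)) (p.2 + 1 = p.1.1.pieces) :=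
      polyPair_supCubic (fun k hk => hb.mul (ht.coeffAt hj (fun p hp => hp.2) hk))
        (ht.knotAt hj fun p hp => hp.2.le) (ht.knotAt hj' fun p hp => hp.2) hclosed
    exact PolyPair.maxUpTo (N := fun p : CubicSpline ℝ × ℝ => p.1.pieces) (D := D) (xs := xs)
      (q := fun p : (CubicSpline ℝ × ℝ) × ℕ => supCubic (fun k => p.1.2 * p.1.1.coeffAt p.2 k)
        (p.1.1.knotAt p.2) (p.1.1.knotAt (p.2 + 1)) (p.2 + 1 = p.1.1.pieces))
      (PolyList.pieces (t := fun p : CubicSpline ℝ × ℝ => p.1) hcode)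
      (PolyList.bounded_pieces (t := fun p : CubicSpline ℝ × ℝ => p.1) hcode)
      (fun p _ => p.1.pieces_pos) hq

end Continuous

/-! ### Maximizing a cubic polynomial over an integer interval -/

section Bisection

variable {p : ℤ → Prop} [DecidablePred p]

/-- Replace one end of the interval by its midpoint, so that `p` holds at the left end and fails at
the right end if it did before. -/
def bisectStep (p : ℤ → Prop) [DecidablePred p] (x : ℤ × ℤ) : ℤ × ℤ :=
  if p ((x.1 + x.2) / 2) then ((x.1 + x.2) / 2, x.2) else (x.1, (x.1 + x.2) / 2)

lemma bisectStep_iterate_mem {a b : ℤ} (hab : a ≤ b) (i : ℕ) :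
    a ≤ ((bisectStep p)^[i] (a, b)).1 ∧
      ((bisectStep p)^[i] (a, b)).1 ≤ ((bisectStep p)^[i] (a, b)).2 ∧
      ((bisectStep p)^[i] (a, b)).2 ≤ b := by
  induction i with
  | zero => exact ⟨le_rfl, hab, le_rfl⟩
  | succ i ih =>
    rw [Function.iterate_succ_apply']
    generalize (bisectStep p)^[i] (a, b) = x at ih
    unfold bisectStep
    split_ifs <;> dsimp only <;> omega

lemma bisectStep_iterate_sign {a b : ℤ} (ha : p a) (hb : ¬ p b) (i : ℕ) :
    p ((bisectStep p)^[i] (a, b)).1 ∧ ¬ p ((bisectStep p)^[i] (a, b)).2 := by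
  induction i with
  | zero => exact ⟨ha, hb⟩
  | succ i ih =>
    rw [Function.iterate_succ_apply']
    generalize (bisectStep p)^[i] (a, b) = x at ih
    unfold bisectStep
    split_ifs with h
    · exact ⟨h, ih.2⟩
    · exact ⟨ih.1, h⟩

lemma bisectStep_iterate_gap {a b : ℤ} (hab : a ≤ b) (i : ℕ) :
    (((bisectStep p)^[i] (a, b)).2 - ((bisectStep p)^[i] (a, b)).1 - 1).toNat ≤
      (b - a - 1).toNat / 2 ^ i := by
  induction i with
  | zero => simp
  | succ i ih =>
    have hx := (bisectStep_iterate_mem (p := p) hab i).2.1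
    rw [Function.iterate_succ_apply', pow_succ, ← Nat.div_div_eq_div_mul]
    refine le_trans ?_ (Nat.div_le_div_right ih)
    generalize (bisectStep p)^[i] (a, b) = x at hx
    unfold bisectStep
    split_ifs <;> dsimp only <;> omega

lemma exists_bisectStep_iterate_gap_le (p : ℤ → Prop) [DecidablePred p] {a b : ℤ} (hab : a ≤ b) :
    ∃ i ≤ Nat.size (b - a).toNat,
      ((bisectStep p)^[i] (a, b)).2 - ((bisectStep p)^[i] (a, b)).1 ≤ 1 := by
  refine ⟨_, le_rfl, ?_⟩
  have h₁ := bisectStep_iterate_gap (p := p) hab (Nat.size (b - a).toNat)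
  have h₂ : (b - a - 1).toNat / 2 ^ Nat.size (b - a).toNat = 0 :=
    Nat.div_eq_of_lt (lt_of_le_of_lt (by omega) (Nat.lt_size_self _))
  omega

lemma ratBits_intCast (k : ℤ) : ratBits k = 2 + Nat.size k.natAbs := by
  simp [ratBits]
  omega

lemma ratBits_intCast_le {a b k : ℤ} (h₁ : a ≤ k) (h₂ : k ≤ b) :
    ratBits k ≤ ratBits a + ratBits b := by
  rw [ratBits_intCast, ratBits_intCast, ratBits_intCast]
  rcases le_or_gt k.natAbs a.natAbs with h | h
  · have := Nat.size_le_size h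
    omega
  · have := Nat.size_le_size (show k.natAbs ≤ b.natAbs by omega)
    omega

variable {Γ : Type} {D : Γ → Prop} {xs : List (Γ → List ℚ)}

lemma PolyNum.floor {a : Γ → ℚ} (ha : PolyNum bitMachine D xs a) :
    PolyNum bitMachine D xs fun γ => ((⌊a γ⌋ : ℤ) : ℚ) := ha.prim

lemma PolyNum.ceil {a : Γ → ℚ} (ha : PolyNum bitMachine D xs a) :
    PolyNum bitMachine D xs fun γ => ((⌈a γ⌉ : ℤ) : ℚ) :=
  ha.neg.floor.neg.congr fun γ _ => by rw [Int.floor_neg]; push_cast; ring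

lemma PolyNum.intMax {a b : Γ → ℤ} (ha : PolyNum bitMachine D xs fun γ => (a γ : ℚ))
    (hb : PolyNum bitMachine D xs fun γ => (b γ : ℚ)) :
    PolyNum bitMachine D xs fun γ => ((max (a γ) (b γ) : ℤ) : ℚ) :=
  (PolyNum.ite (PolyPred.le ha hb) (hb.mono fun _ h => h.1) (ha.mono fun _ h => h.1)).congr
    fun γ _ => by rw [Int.cast_max, max_def]

lemma PolyNum.intMin {a b : Γ → ℤ} (ha : PolyNum bitMachine D xs fun γ => (a γ : ℚ))
    (hb : PolyNum bitMachine D xs fun γ => (b γ : ℚ)) :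
    PolyNum bitMachine D xs fun γ => ((min (a γ) (b γ) : ℤ) : ℚ) :=
  (PolyNum.ite (PolyPred.le ha hb) (ha.mono fun _ h => h.1) (hb.mono fun _ h => h.1)).congr
    fun γ _ => by rw [Int.cast_min, min_def]

/-- Binary search: a place where a cubic polynomial becomes negative can be found in polynomial
time, for integers in binary notation. The number of rounds is at most the number of bits of the
length of the interval. -/
lemma exists_polyNum_signChange {c : Γ → ℕ → ℚ} {a b : Γ → ℤ}
    (hc : ∀ k < 4, PolyNum bitMachine D xs fun γ => c γ k)
    (ha : PolyNum bitMachine D xs fun γ => (a γ : ℚ))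
    (hb : PolyNum bitMachine D xs fun γ => (b γ : ℚ)) (hab : ∀ γ, D γ → a γ ≤ b γ) :
    ∃ m : Γ → ℤ, PolyNum bitMachine D xs (fun γ => (m γ : ℚ)) ∧ ∀ γ, D γ →
      0 ≤ cubic (c γ) (a γ) → cubic (c γ) (b γ) < 0 →
        a γ ≤ m γ ∧ m γ < b γ ∧ 0 ≤ cubic (c γ) (m γ) ∧ cubic (c γ) ((m γ + 1 : ℤ) : ℚ) < 0 := by
  classical
  set X : Γ → ℕ → ℤ × ℤ := fun γ i =>
    (bisectStep fun k : ℤ => 0 ≤ cubic (c γ) k)^[i] (a γ, b γ) with hX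
  have hex : ∀ γ, D γ → ∃ i, (X γ i).2 - (X γ i).1 ≤ 1 := fun γ hγ =>
    let ⟨i, _, hi⟩ := exists_bisectStep_iterate_gap_le (fun k : ℤ => 0 ≤ cubic (c γ) k) (hab γ hγ)
    ⟨i, hi⟩
  -- the number of rounds until the interval has length at most one
  set N : Γ → ℕ := fun γ => if h : D γ then Nat.find (hex γ h) else 0 with hN
  have hNspec : ∀ γ, D γ → (X γ (N γ)).2 - (X γ (N γ)).1 ≤ 1 := by
    intro γ hγ
    simp only [hN, dif_pos hγ]
    exact Nat.find_spec (hex γ hγ)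
  have hNmin : ∀ γ, D γ → ∀ i < N γ, 1 < (X γ i).2 - (X γ i).1 := by
    intro γ hγ i hi
    simp only [hN, dif_pos hγ] at hi
    exact not_le.1 (Nat.find_min (hex γ hγ) hi)
  have hgap : PolyBounded bitMachine D xs N := by
    refine (hb.sub ha).bounded.mono fun γ hγ => ?_
    obtain ⟨i, hi, h⟩ :=
      exists_bisectStep_iterate_gap_le (fun k : ℤ => 0 ≤ cubic (c γ) k) (hab γ hγ)
    have h₁ : N γ ≤ i := by
      by_contra hlt
      exact (hNmin γ hγ i (not_le.1 hlt)).not_ge h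
    have h₂ : inputSize bitMachine [(b γ : ℚ) - a γ] = ratBits ((b γ - a γ : ℤ) : ℚ) := by
      simp [inputSize, bitMachine]
    have h₃ : (b γ - a γ).toNat = (b γ - a γ).natAbs := by have := hab γ hγ; omega
    rw [h₂, ratBits_intCast, ← h₃]
    omega
  set y₀ : Γ × ℕ → List ℚ := fun q => if (X q.1 q.2).2 - (X q.1 q.2).1 ≤ 1 then [] else [1] with hy₀
  set lo : Γ × ℕ → List ℚ := fun q => [((X q.1 q.2).1 : ℚ)] with hlo
  set hi : Γ × ℕ → List ℚ := fun q => [((X q.1 q.2).2 : ℚ)] with hhi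
  -- the end of the loop can be recognized from the two ends of the interval
  have hctrl : ∀ {Δ : Type} {E : Δ → Prop} {zs : List (Δ → List ℚ)} {u v : Δ → ℤ},
      PolyNum bitMachine E zs (fun δ => (u δ : ℚ)) → PolyNum bitMachine E zs (fun δ => (v δ : ℚ)) →
      PolyList bitMachine E zs fun δ => if v δ - u δ ≤ 1 then [] else [1] := by
    intro Δ E zs u v hu hv
    refine PolyList.ite ((PolyPred.le (hv.sub hu) .one).congr fun δ _ => ?_) .nil PolyNum.one
    exact_mod_cast Iff.rfl
  have hsize : PolyBounded bitMachine D xs fun γ =>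
      inputSize bitMachine [(a γ : ℚ)] + inputSize bitMachine [(b γ : ℚ)] :=
    ha.bounded.add hb.bounded
  have key := PolyList.loop (y₀ := y₀) (ys := [lo, hi]) hgap hsize ?_ ?_ ?_ ?_ lo (by simp)
  · refine ⟨fun γ => (X γ (N γ)).1, key, fun γ hγ h₁ h₂ => ?_⟩
    have hm := bisectStep_iterate_mem (p := fun k : ℤ => 0 ≤ cubic (c γ) k) (hab γ hγ) (N γ)
    have hs := bisectStep_iterate_sign (p := fun k : ℤ => 0 ≤ cubic (c γ) k) h₁ (not_le.2 h₂) (N γ)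
    have hg := hNspec γ hγ
    change a γ ≤ (X γ (N γ)).1 ∧ (X γ (N γ)).1 ≤ (X γ (N γ)).2 ∧ (X γ (N γ)).2 ≤ b γ at hm
    change 0 ≤ cubic (c γ) (X γ (N γ)).1 ∧ ¬ 0 ≤ cubic (c γ) (X γ (N γ)).2 at hs
    have hne : (X γ (N γ)).1 ≠ (X γ (N γ)).2 := fun h => hs.2 (h ▸ hs.1)
    have he : (X γ (N γ)).2 = (X γ (N γ)).1 + 1 := by omega
    exact ⟨hm.1, by dsimp only; omega, hs.1, he ▸ not_le.1 hs.2⟩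
  · intro γ hγ i _ y hy
    obtain ⟨h₁, h₂, h₃⟩ :=
      bisectStep_iterate_mem (p := fun k : ℤ => 0 ≤ cubic (c γ) k) (hab γ hγ) i
    change a γ ≤ (X γ i).1 at h₁
    change (X γ i).1 ≤ (X γ i).2 at h₂
    change (X γ i).2 ≤ b γ at h₃
    have e : ∀ k : ℤ, inputSize bitMachine [(k : ℚ)] = ratBits k := fun k => by
      simp [inputSize, bitMachine]
    have h₄ : inputSize bitMachine [(1 : ℚ)] ≤ inputSize bitMachine [(a γ : ℚ)] +
        inputSize bitMachine [(b γ : ℚ)] := by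
      have e₁ := e 1
      rw [Int.cast_one, ← Int.cast_one, ratBits_intCast] at e₁
      rw [e, e, ratBits_intCast, ratBits_intCast]
      simp at e₁
      omega
    simp only [List.mem_cons, List.not_mem_nil, or_false] at hy
    rcases hy with rfl | rfl | rfl
    · simp only [hy₀]
      split_ifs
      · exact Nat.zero_le _
      · exact h₄
    · simp only [hlo, e]
      exact ratBits_intCast_le h₁ (h₂.trans h₃)
    · simp only [hhi, e]
      exact ratBits_intCast_le (h₁.trans h₂) h₃
  · intro y hy
    simp only [List.mem_cons, List.not_mem_nil, or_false] at hy
    rcases hy with rfl | rfl | rfl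
    · exact hctrl ha hb
    · exact ha
    · exact hb
  · set E : Γ × ℕ → Prop := fun q => D q.1 ∧ q.2 < N q.1 with hE
    set zs : List (Γ × ℕ → List ℚ) := liftFst xs ++ y₀ :: [lo, hi] with hzs
    have hlo' : PolyNum bitMachine E zs fun q => ((X q.1 q.2).1 : ℚ) :=
      PolyList.var (by simp [hzs, hlo])
    have hhi' : PolyNum bitMachine E zs fun q => ((X q.1 q.2).2 : ℚ) :=
      PolyList.var (by simp [hzs, hhi])
    have hmid : PolyNum bitMachine E zs fun q => ((((X q.1 q.2).1 + (X q.1 q.2).2) / 2 : ℤ) : ℚ) :=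
      ((hlo'.add hhi').div (.natCast 2)).floor.congr fun q _ => by
        rw [← Int.cast_add, Rat.floor_intCast_div_natCast]
        rfl
    have hc' : ∀ k < 4, PolyNum bitMachine E zs fun q => c q.1 k := fun k hk =>
      (hc k hk).lift (fun q hq => hq.1) (by simp [hzs])
    have hp : PolyPred bitMachine E zs fun q =>
        0 ≤ cubic (c q.1) ((((X q.1 q.2).1 + (X q.1 q.2).2) / 2 : ℤ) : ℚ) :=
      PolyPred.le .zero (PolyNum.cubic hc' hmid)
    have hstep : ∀ q : Γ × ℕ, X q.1 (q.2 + 1) =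
        bisectStep (fun k : ℤ => 0 ≤ cubic (c q.1) k) (X q.1 q.2) :=
      fun q => Function.iterate_succ_apply' _ _ _
    have hlo₁ : PolyNum bitMachine E zs fun q => ((X q.1 (q.2 + 1)).1 : ℚ) :=
      (PolyNum.ite hp (hmid.mono fun _ h => h.1) (hlo'.mono fun _ h => h.1)).congr fun q _ => by
        rw [hstep, bisectStep]
        split_ifs <;> rfl
    have hhi₁ : PolyNum bitMachine E zs fun q => ((X q.1 (q.2 + 1)).2 : ℚ) :=
      (PolyNum.ite hp (hhi'.mono fun _ h => h.1) (hmid.mono fun _ h => h.1)).congr fun q _ => by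
        rw [hstep, bisectStep]
        split_ifs <;> rfl
    intro y hy
    simp only [List.mem_cons, List.not_mem_nil, or_false] at hy
    rcases hy with rfl | rfl | rfl
    · exact hctrl hlo₁ hhi₁
    · exact hlo₁
    · exact hhi₁
  · intro γ hγ i hi
    have h₁ := hNspec γ hγ
    have h₂ := hNmin γ hγ i
    simp only [hy₀]
    split_ifs with h
    · simp only [true_iff]
      by_contra hne
      have := h₂ (by omega)
      omega
    · simp only [false_iff]
      rintro rfl
      exact h h₁

end Bisection

section IntegerMax

lemma le_of_forall_le_succ {P : ℤ → ℚ} {a b : ℤ} (hab : a ≤ b)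
    (h : ∀ k, a ≤ k → k < b → P k ≤ P (k + 1)) : P a ≤ P b := by
  induction b, hab using Int.leInduction with
  | base => exact le_rfl
  | succ b hb ih => exact (ih fun k h₁ h₂ => h k h₁ (by omega)).trans (h b hb (by omega))

lemma le_of_forall_succ_le {P : ℤ → ℚ} {a b : ℤ} (hab : a ≤ b)
    (h : ∀ k, a ≤ k → k < b → P (k + 1) ≤ P k) : P b ≤ P a := by
  have := le_of_forall_le_succ (P := fun k => -P k) hab fun k h₁ h₂ => neg_le_neg (h k h₁ h₂)
  simpa using this

/-- The difference polynomial: `cubic (diffCoeff c) k = cubic c (k + 1) - cubic c k`. -/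
def diffCoeff (c : ℕ → ℚ) : ℕ → ℚ
  | 0 => c 1 + c 2 + c 3
  | 1 => 2 * c 2 + 3 * c 3
  | 2 => 3 * c 3
  | _ => 0

lemma cubic_diffCoeff (c : ℕ → ℚ) (w : ℚ) :
    cubic (diffCoeff c) w = cubic c (w + 1) - cubic c w := by
  simp only [cubic, diffCoeff]; ring

/-- The vertex of the parabola `cubic (diffCoeff c)`, or `0` if this is not a parabola. -/
def diffVertex (c : ℕ → ℚ) : ℚ := -(2 * c 2 + 3 * c 3) / (2 * (3 * c 3))

lemma diffCoeff_sub (c : ℕ → ℚ) (v w : ℚ) : cubic (diffCoeff c) w - cubic (diffCoeff c) v =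
    (w - v) * (2 * c 2 + 3 * c 3 + 3 * c 3 * (v + w)) := by
  simp only [cubic, diffCoeff]; ring

/-- A parabola, or a line, is monotone or antitone on either side of its vertex. For a line the
vertex is an arbitrary number. -/
lemma diffCoeff_monotoneOn_or_antitoneOn (c : ℕ → ℚ) {s : Set ℚ}
    (hs : (∀ w ∈ s, w ≤ diffVertex c) ∨ ∀ w ∈ s, diffVertex c ≤ w) :
    MonotoneOn (cubic (diffCoeff c)) s ∨ AntitoneOn (cubic (diffCoeff c)) s := by
  have hm : (∀ v ∈ s, ∀ w ∈ s, 0 ≤ 2 * c 2 + 3 * c 3 + 3 * c 3 * (v + w)) →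
      MonotoneOn (cubic (diffCoeff c)) s := fun h v hv w hw hvw => by
    have := mul_nonneg (sub_nonneg.2 hvw) (h v hv w hw)
    rw [← diffCoeff_sub] at this
    exact sub_nonneg.1 this
  have ha : (∀ v ∈ s, ∀ w ∈ s, 2 * c 2 + 3 * c 3 + 3 * c 3 * (v + w) ≤ 0) →
      AntitoneOn (cubic (diffCoeff c)) s := fun h v hv w hw hvw => by
    have := mul_nonpos_of_nonneg_of_nonpos (sub_nonneg.2 hvw) (h v hv w hw)
    rw [← diffCoeff_sub] at this
    exact sub_nonpos.1 this
  have e : c 3 ≠ 0 → ∀ v w, 2 * c 2 + 3 * c 3 + 3 * c 3 * (v + w) =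
      3 * c 3 * (v - diffVertex c + (w - diffVertex c)) := fun h v w => by
    rw [diffVertex]; field_simp; ring
  rcases lt_trichotomy (c 3) 0 with h3 | h3 | h3
  · simp only [e h3.ne] at hm ha
    rcases hs with hs | hs
    · exact .inl (hm fun v hv w hw => by nlinarith [hs v hv, hs w hw])
    · exact .inr (ha fun v hv w hw => by nlinarith [hs v hv, hs w hw])
  · simp only [h3, mul_zero, zero_mul, add_zero] at hm ha
    rcases le_total 0 (2 * c 2) with h | h
    · exact .inl (hm fun _ _ _ _ => h)
    · exact .inr (ha fun _ _ _ _ => h)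
  · simp only [e h3.ne'] at hm ha
    rcases hs with hs | hs
    · exact .inr (ha fun v hv w hw => by nlinarith [hs v hv, hs w hw])
    · exact .inl (hm fun v hv w hw => by nlinarith [hs v hv, hs w hw])

/-- A sequence whose differences are monotone or antitone has its maximum at an end of the interval,
or where the differences turn negative. -/
lemma isGreatest_of_monotoneOn_or_antitoneOn {c : ℕ → ℚ} {a b m : ℤ} (hab : a ≤ b)
    (h : MonotoneOn (cubic (diffCoeff c)) (Set.Icc a b) ∨
      AntitoneOn (cubic (diffCoeff c)) (Set.Icc a b))
    (hm : 0 ≤ cubic (diffCoeff c) a → cubic (diffCoeff c) b < 0 → a ≤ m ∧ m < b ∧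
      0 ≤ cubic (diffCoeff c) m ∧ cubic (diffCoeff c) ((m + 1 : ℤ) : ℚ) < 0) :
    IsGreatest ((fun k : ℤ => cubic c k) '' Set.Icc a b) (max (max (cubic c a) (cubic c b))
      (if 0 ≤ cubic (diffCoeff c) a ∧ cubic (diffCoeff c) b < 0 then cubic c ((m + 1 : ℤ) : ℚ)
        else cubic c a)) := by
  have hd : ∀ k : ℤ, cubic (diffCoeff c) k = cubic c ((k + 1 : ℤ) : ℚ) - cubic c k := fun k => by
    rw [cubic_diffCoeff]; push_cast; rfl
  have hmem : ∀ {k : ℤ}, a ≤ k → k ≤ b → (k : ℚ) ∈ Set.Icc (a : ℚ) b := fun h₁ h₂ =>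
    ⟨Int.cast_le.2 h₁, Int.cast_le.2 h₂⟩
  have hup : ∀ {k l : ℤ}, k ≤ l → (∀ i, k ≤ i → i < l → 0 ≤ cubic (diffCoeff c) i) →
      cubic c k ≤ cubic c l := fun {k l} hkl hi =>
    le_of_forall_le_succ (P := fun k : ℤ => cubic c k) hkl fun i h₁ h₂ => by
      have := hi i h₁ h₂
      rw [hd] at this
      exact sub_nonneg.1 this
  have hdown : ∀ {k l : ℤ}, k ≤ l → (∀ i, k ≤ i → i < l → cubic (diffCoeff c) i ≤ 0) →
      cubic c l ≤ cubic c k := fun {k l} hkl hi =>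
    le_of_forall_succ_le (P := fun k : ℤ => cubic c k) hkl fun i h₁ h₂ => by
      have := hi i h₁ h₂
      rw [hd] at this
      exact sub_nonpos.1 this
  constructor
  · have h₁ : cubic c a ∈ (fun k : ℤ => cubic c k) '' Set.Icc a b := ⟨a, ⟨le_rfl, hab⟩, rfl⟩
    have h₂ : cubic c b ∈ (fun k : ℤ => cubic c k) '' Set.Icc a b := ⟨b, ⟨hab, le_rfl⟩, rfl⟩
    refine max_rec' _ (max_rec' _ h₁ h₂) ?_
    split_ifs with hs
    · obtain ⟨h₃, h₄, -⟩ := hm hs.1 hs.2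
      exact ⟨m + 1, ⟨by omega, by omega⟩, rfl⟩
    · exact h₁
  · rintro _ ⟨k, ⟨h₁, h₂⟩, rfl⟩
    dsimp only
    rcases h with h | h
    · rw [le_max_iff, le_max_iff]
      left
      rcases le_total 0 (cubic (diffCoeff c) k) with hk | hk
      · exact .inr (hup h₂ fun i h₃ h₄ => hk.trans (h (hmem h₁ h₂) (hmem (by omega) (by omega))
          (Int.cast_le.2 h₃)))
      · exact .inl (hdown h₁ fun i h₃ h₄ => (h (hmem (by omega) (by omega)) (hmem h₁ h₂)
          (Int.cast_le.2 h₄.le)).trans hk)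
    · rw [le_max_iff, le_max_iff]
      rcases lt_or_ge (cubic (diffCoeff c) a) 0 with h0 | h0
      · exact .inl (.inl (hdown h₁ fun i h₃ h₄ => (h (hmem le_rfl hab) (hmem h₃ (by omega))
          (Int.cast_le.2 h₃)).trans h0.le))
      · rcases lt_or_ge (cubic (diffCoeff c) b) 0 with hb | hb
        · right
          rw [if_pos ⟨h0, hb⟩]
          obtain ⟨h₃, h₄, h₅, h₆⟩ := hm h0 hb
          rcases le_or_gt k (m + 1) with h₇ | h₇
          · exact hup h₇ fun i h₈ h₉ => h₅.trans (h (hmem (by omega) (by omega))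
              (hmem (by omega) (by omega)) (Int.cast_le.2 (by omega)))
          · exact hdown h₇.le fun i h₈ h₉ => (h (hmem (by omega) (by omega))
              (hmem (by omega) (by omega)) (Int.cast_le.2 h₈)).trans h₆.le
        · exact .inl (.inr (hup h₂ fun i h₃ h₄ => hb.trans (h (hmem (by omega) (by omega))
            (hmem (by omega) (by omega)) (Int.cast_le.2 h₄.le))))

variable {Γ : Type} {D : Γ → Prop} {xs : List (Γ → List ℚ)}

lemma PolyNum.max {a b : Γ → ℚ} (ha : PolyNum bitMachine D xs a) (hb : PolyNum bitMachine D xs b) :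
    PolyNum bitMachine D xs fun γ => max (a γ) (b γ) :=
  (PolyNum.ite (PolyPred.le ha hb) (hb.mono fun _ h => h.1) (ha.mono fun _ h => h.1)).congr
    fun _ _ => max_def _ _

lemma polyNum_diffCoeff {c : Γ → ℕ → ℚ}
    (hc : ∀ k < 4, PolyNum bitMachine D xs fun γ => c γ k) (k : ℕ) :
    PolyNum bitMachine D xs fun γ => diffCoeff (c γ) k := by
  have h₁ := hc 1 (by norm_num)
  have h₂ := hc 2 (by norm_num)
  have h₃ := hc 3 (by norm_num)
  match k with
  | 0 => exact (h₁.add h₂).add h₃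
  | 1 => exact ((PolyNum.natCast 2).mul h₂).add ((PolyNum.natCast 3).mul h₃)
  | 2 => exact (PolyNum.natCast 3).mul h₃
  | _ + 3 => exact .zero

lemma exists_polyNum_isGreatest_of_monotoneOn_or_antitoneOn {c : Γ → ℕ → ℚ} {a b : Γ → ℤ}
    (hc : ∀ k < 4, PolyNum bitMachine D xs fun γ => c γ k)
    (ha : PolyNum bitMachine D xs fun γ => (a γ : ℚ))
    (hb : PolyNum bitMachine D xs fun γ => (b γ : ℚ)) (hab : ∀ γ, D γ → a γ ≤ b γ)
    (h : ∀ γ, D γ → MonotoneOn (cubic (diffCoeff (c γ))) (Set.Icc (a γ) (b γ)) ∨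
      AntitoneOn (cubic (diffCoeff (c γ))) (Set.Icc (a γ) (b γ))) :
    ∃ g : Γ → ℚ, PolyNum bitMachine D xs g ∧ ∀ γ, D γ →
      IsGreatest ((fun k : ℤ => cubic (c γ) k) '' Set.Icc (a γ) (b γ)) (g γ) := by
  have hd := polyNum_diffCoeff hc
  obtain ⟨m, hm, hspec⟩ := exists_polyNum_signChange (c := fun γ => diffCoeff (c γ))
    (fun k _ => hd k) ha hb hab
  have hp := (PolyPred.le .zero (PolyNum.cubic (c := fun γ => diffCoeff (c γ))
    (fun k _ => hd k) ha)).and (PolyPred.lt (PolyNum.cubic (c := fun γ => diffCoeff (c γ))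
      (fun k _ => hd k) hb) .zero)
  have hm' : PolyNum bitMachine D xs fun γ => ((m γ + 1 : ℤ) : ℚ) :=
    (hm.add .one).congr fun γ _ => by push_cast; rfl
  exact ⟨_, ((PolyNum.cubic hc ha).max (PolyNum.cubic hc hb)).max (PolyNum.ite hp
    ((PolyNum.cubic hc hm').mono fun _ h => h.1) ((PolyNum.cubic hc ha).mono fun _ h => h.1)),
    fun γ hγ => isGreatest_of_monotoneOn_or_antitoneOn (hab γ hγ) (h γ hγ) (hspec γ hγ)⟩

/-- The maximum of a cubic polynomial over the integers of an interval can be computed in polynomial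
time, for integers in binary notation. -/
lemma exists_polyNum_isGreatest_cubic {c : Γ → ℕ → ℚ} {a b : Γ → ℤ}
    (hc : ∀ k < 4, PolyNum bitMachine D xs fun γ => c γ k)
    (ha : PolyNum bitMachine D xs fun γ => (a γ : ℚ))
    (hb : PolyNum bitMachine D xs fun γ => (b γ : ℚ)) (hab : ∀ γ, D γ → a γ ≤ b γ) :
    ∃ g : Γ → ℚ, PolyNum bitMachine D xs g ∧ ∀ γ, D γ →
      IsGreatest ((fun k : ℤ => cubic (c γ) k) '' Set.Icc (a γ) (b γ)) (g γ) := by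
  have h₂ := hc 2 (by norm_num)
  have h₃ := (PolyNum.natCast 3).mul (hc 3 (by norm_num))
  -- the differences are monotone or antitone to the left and to the right of their vertex
  set u : Γ → ℤ := fun γ => max (a γ) (min (b γ) ⌊diffVertex (c γ)⌋) with hu
  set v : Γ → ℤ := fun γ => min (u γ + 1) (b γ) with hv
  have huN : PolyNum bitMachine D xs fun γ => (u γ : ℚ) := PolyNum.intMax ha (PolyNum.intMin hb
    (PolyNum.floor ((((PolyNum.natCast 2).mul h₂).add h₃).neg.div ((PolyNum.natCast 2).mul h₃))))
  have hvN : PolyNum bitMachine D xs fun γ => (v γ : ℚ) :=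
    PolyNum.intMin ((huN.add .one).congr fun γ _ => by push_cast; rfl) hb
  obtain ⟨g, hg, hgs⟩ := exists_polyNum_isGreatest_of_monotoneOn_or_antitoneOn hc ha huN
    (fun γ hγ => le_max_left _ _) fun γ hγ => by
      rcases le_or_gt (u γ) (a γ) with h | h
      · left
        intro x hx y hy _
        have : x = y := by
          have hle : (u γ : ℚ) ≤ a γ := Int.cast_le.2 h
          linarith [hx.1, hx.2, hy.1, hy.2]
        rw [this]
      · refine diffCoeff_monotoneOn_or_antitoneOn _ (.inl fun w hw => hw.2.trans ?_)
        have hγu : u γ = max (a γ) (min (b γ) ⌊diffVertex (c γ)⌋) := rfl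
        exact Int.le_floor.1 (by omega)
  obtain ⟨g', hg', hgs'⟩ := exists_polyNum_isGreatest_of_monotoneOn_or_antitoneOn hc hvN hb
    (fun γ hγ => min_le_right _ _) fun γ hγ => by
      rcases le_or_gt (b γ) (v γ) with h | h
      · left
        intro x hx y hy _
        have : x = y := by
          have hle : (b γ : ℚ) ≤ v γ := Int.cast_le.2 h
          linarith [hx.1, hx.2, hy.1, hy.2]
        rw [this]
      · refine diffCoeff_monotoneOn_or_antitoneOn _ (.inr fun w hw => le_trans ?_ hw.1)
        have hγu : u γ = max (a γ) (min (b γ) ⌊diffVertex (c γ)⌋) := rfl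
        have hγv : v γ = min (u γ + 1) (b γ) := rfl
        have hle : ⌊diffVertex (c γ)⌋ + 1 ≤ v γ := by omega
        exact (Int.lt_floor_add_one _).le.trans (by exact_mod_cast hle)
  refine ⟨_, hg.max hg', fun γ hγ => ?_⟩
  have hset : Set.Icc (a γ) (b γ) = Set.Icc (a γ) (u γ) ∪ Set.Icc (v γ) (b γ) := by
    have hγu : u γ = max (a γ) (min (b γ) ⌊diffVertex (c γ)⌋) := rfl
    have hγv : v γ = min (u γ + 1) (b γ) := rfl
    have := hab γ hγ
    ext k
    simp only [Set.mem_Icc, Set.mem_union]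
    omega
  rw [hset, Set.image_union]
  exact (hgs γ hγ).union (hgs' γ hγ)

end IntegerMax

/-! ### Suprema of cubic splines on a grid -/

section Grid

/-- The coefficients of `k ↦ cubic c (l + k * h)`. -/
def shiftCoeff (c : ℕ → ℚ) (l h : ℚ) : ℕ → ℚ
  | 0 => cubic c l
  | 1 => h * (c 1 + 2 * c 2 * l + 3 * c 3 * (l * l))
  | 2 => h * h * (c 2 + 3 * c 3 * l)
  | _ => h * h * h * c 3

lemma cubic_shiftCoeff (c : ℕ → ℚ) (l h k : ℚ) :
    cubic (shiftCoeff c l h) k = cubic c (l + k * h) := by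
  simp only [cubic, shiftCoeff]; ring

lemma polyNum_shiftCoeff {Γ : Type} {D : Γ → Prop} {xs : List (Γ → List ℚ)} {c : Γ → ℕ → ℚ}
    {l h : Γ → ℚ} (hc : ∀ k < 4, PolyNum bitMachine D xs fun γ => c γ k)
    (hl : PolyNum bitMachine D xs l) (hh : PolyNum bitMachine D xs h) (k : ℕ) :
    PolyNum bitMachine D xs fun γ => shiftCoeff (c γ) (l γ) (h γ) k := by
  have h₁ := hc 1 (by norm_num)
  have h₂ := hc 2 (by norm_num)
  have h₃ := hc 3 (by norm_num)
  match k with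
  | 0 => exact PolyNum.cubic hc hl
  | 1 => exact hh.mul ((h₁.add (((PolyNum.natCast 2).mul h₂).mul hl)).add
      (((PolyNum.natCast 3).mul h₃).mul (hl.mul hl)))
  | 2 => exact (hh.mul hh).mul (h₂.add (((PolyNum.natCast 3).mul h₃).mul hl))
  | _ + 3 => exact ((hh.mul hh).mul hh).mul h₃

/-- The index of the first grid point in piece `j`. -/
def GridSpline.firstIndex (g : GridSpline) (j : ℕ) : ℤ :=
  max 0 ⌈(g.spline.knotAt j - g.lo) / g.step⌉

/-- The index of the last grid point in piece `j`. Nothing but the end of the grid bounds it in the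
last piece. -/
def GridSpline.lastIndex (g : GridSpline) (j : ℕ) : ℤ :=
  if j + 1 = g.spline.pieces then ⌊(g.hi - g.lo) / g.step⌋
  else min ⌊(g.hi - g.lo) / g.step⌋ (⌈(g.spline.knotAt (j + 1) - g.lo) / g.step⌉ - 1)

lemma GridSpline.bounds_of_mem_dom {g : GridSpline} {v : ℚ} (hv : v ∈ discreteSplines.dom g) :
    g.spline.knotAt 0 ≤ v ∧ v ≤ g.spline.knotAt g.spline.pieces := by
  obtain ⟨k, rfl, hv⟩ := hv
  rw [g.spline.knotAt_of_lt (Nat.succ_pos _), g.spline.knotAt_of_lt (Nat.lt_succ_self _)]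
  have := g.step_pos
  exact ⟨g.first_le_lo.trans (le_add_of_nonneg_right (by positivity)), hv.trans g.hi_le_last⟩

lemma GridSpline.lo_mem_dom (g : GridSpline) : g.lo ∈ discreteSplines.dom g :=
  ⟨0, by simp, g.lo_le_hi⟩

lemma GridSpline.dom_inter_onPiece (g : GridSpline) (j : ℕ) :
    {v | v ∈ discreteSplines.dom g ∧ g.spline.OnPiece j v} =
      (fun k : ℤ => g.lo + k * g.step) '' Set.Icc (g.firstIndex j) (g.lastIndex j) := by
  have hs := g.step_pos
  have h₁ : ∀ k : ℤ, g.spline.knotAt j ≤ g.lo + k * g.step ↔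
      ⌈(g.spline.knotAt j - g.lo) / g.step⌉ ≤ k := fun k => by
    rw [Int.ceil_le, div_le_iff₀ hs, sub_le_iff_le_add']
  have h₂ : ∀ k : ℤ, g.lo + k * g.step ≤ g.hi ↔ k ≤ ⌊(g.hi - g.lo) / g.step⌋ := fun k => by
    rw [Int.le_floor, le_div_iff₀ hs, le_sub_iff_add_le']
  have h₃ : ∀ k : ℤ, g.lo + k * g.step < g.spline.knotAt (j + 1) ↔
      k ≤ ⌈(g.spline.knotAt (j + 1) - g.lo) / g.step⌉ - 1 := fun k => by
    rw [Int.le_sub_one_iff, Int.lt_ceil, lt_div_iff₀ hs, lt_sub_iff_add_lt']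
  have h₄ : ∀ k : ℤ, g.firstIndex j ≤ k ∧ k ≤ g.lastIndex j ↔
      0 ≤ k ∧ g.lo + k * g.step ≤ g.hi ∧ g.spline.OnPiece j (g.lo + k * g.step) := by
    intro k
    rw [CubicSpline.OnPiece, h₁, h₂, h₃, GridSpline.firstIndex, GridSpline.lastIndex, max_le_iff]
    split_ifs with hj
    · have h₅ : k ≤ ⌊(g.hi - g.lo) / g.step⌋ →
          g.lo + k * g.step ≤ g.spline.knotAt (j + 1) := fun h => by
        rw [hj, g.spline.knotAt_of_lt (Nat.lt_succ_self _)]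
        exact ((h₂ k).2 h).trans g.hi_le_last
      tauto
    · rw [le_min_iff]
      tauto
  ext v
  constructor
  · rintro ⟨⟨k, rfl, hk⟩, hv⟩
    exact ⟨k, (h₄ k).2 ⟨by positivity, by simpa using hk, by simpa using hv⟩, by simp⟩
  · rintro ⟨k, hk, rfl⟩
    obtain ⟨h₅, h₆, h₇⟩ := (h₄ k).1 hk
    lift k to ℕ using h₅
    exact ⟨⟨k, by simp, h₆⟩, h₇⟩

variable {Γ : Type} {D : Γ → Prop} {xs : List (Γ → List ℚ)} {g : Γ → GridSpline} {j : Γ → ℕ}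

/-- The code of a spline on a grid. -/
def GridSpline.code (g : GridSpline) : List ℚ := g.lo :: g.hi :: g.step :: g.spline.code

lemma polyNum_firstIndex (hg : PolyList bitMachine D xs fun γ => (g γ).code)
    (hj : PolyNum bitMachine D xs fun γ => (j γ : ℚ))
    (hlt : ∀ γ, D γ → j γ < (g γ).spline.pieces) :
    PolyNum bitMachine D xs fun γ => ((g γ).firstIndex (j γ) : ℚ) := by
  have ht : PolyList bitMachine D xs fun γ => (g γ).spline.code := hg.tail.tail.tail
  have hlo : PolyNum bitMachine D xs fun γ => (g γ).lo := hg.head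
  have hstep : PolyNum bitMachine D xs fun γ => (g γ).step := hg.tail.tail.head
  exact PolyNum.intMax (a := fun _ => 0) (by simpa using PolyNum.zero)
    (((ht.knotAt hj fun γ hγ => (hlt γ hγ).le).sub hlo).div hstep).ceil

lemma polyNum_lastIndex (hg : PolyList bitMachine D xs fun γ => (g γ).code)
    (hj : PolyNum bitMachine D xs fun γ => (j γ : ℚ))
    (hlt : ∀ γ, D γ → j γ < (g γ).spline.pieces) :
    PolyNum bitMachine D xs fun γ => ((g γ).lastIndex (j γ) : ℚ) := by
  have ht : PolyList bitMachine D xs fun γ => (g γ).spline.code := hg.tail.tail.tail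
  have hlo : PolyNum bitMachine D xs fun γ => (g γ).lo := hg.head
  have hhi : PolyNum bitMachine D xs fun γ => (g γ).hi := hg.tail.head
  have hstep : PolyNum bitMachine D xs fun γ => (g γ).step := hg.tail.tail.head
  have hj' : PolyNum bitMachine D xs fun γ => ((j γ + 1 : ℕ) : ℚ) :=
    (hj.add .one).congr fun γ _ => by push_cast; rfl
  have hend : PolyNum bitMachine D xs fun γ => ((⌊((g γ).hi - (g γ).lo) / (g γ).step⌋ : ℤ) : ℚ) :=
    ((hhi.sub hlo).div hstep).floor
  have hceil : PolyNum bitMachine D xs fun γ =>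
      ((⌈((g γ).spline.knotAt (j γ + 1) - (g γ).lo) / (g γ).step⌉ - 1 : ℤ) : ℚ) :=
    ((((ht.knotAt hj' hlt).sub hlo).div hstep).ceil.sub .one).congr fun γ _ => by
      push_cast; rfl
  have hp : PolyPred bitMachine D xs fun γ => j γ + 1 = (g γ).spline.pieces :=
    (PolyPred.eq hj' ht.pieces).congr fun γ _ => (Nat.cast_inj (R := ℚ)).symm
  exact (PolyNum.ite hp (hend.mono fun _ h => h.1)
    ((PolyNum.intMin hend hceil).mono fun _ h => h.1)).congr
      fun γ _ => by rw [GridSpline.lastIndex]; split_ifs <;> rfl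

/-- The maximum of a multiple of the spline over the grid points in a piece. As a piece may contain
no grid point, the value at the first point of the grid is always taken into account. -/
lemma exists_polyNum_isGreatest_onPiece {b : Γ → ℚ}
    (hg : PolyList bitMachine D xs fun γ => (g γ).code) (hb : PolyNum bitMachine D xs b)
    (hj : PolyNum bitMachine D xs fun γ => (j γ : ℚ))
    (hlt : ∀ γ, D γ → j γ < (g γ).spline.pieces) :
    ∃ Q : Γ → ℚ, PolyNum bitMachine D xs Q ∧ ∀ γ, D γ → IsGreatest
      ({b γ * (g γ).spline.eval (g γ).lo} ∪
        cubic (fun k => b γ * (g γ).spline.coeffAt (j γ) k) ''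
          {v | v ∈ discreteSplines.dom (g γ) ∧ (g γ).spline.OnPiece (j γ) v}) (Q γ) := by
  have ht : PolyList bitMachine D xs fun γ => (g γ).spline.code := hg.tail.tail.tail
  have hlo : PolyNum bitMachine D xs fun γ => (g γ).lo := hg.head
  have hstep : PolyNum bitMachine D xs fun γ => (g γ).step := hg.tail.tail.head
  have hfirst := polyNum_firstIndex hg hj hlt
  have hlast := polyNum_lastIndex hg hj hlt
  set c : Γ → ℕ → ℚ := fun γ =>
    shiftCoeff (fun k => b γ * (g γ).spline.coeffAt (j γ) k) (g γ).lo (g γ).step with hc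
  have hcN : ∀ k, PolyNum bitMachine D xs fun γ => c γ k :=
    polyNum_shiftCoeff (c := fun γ k => b γ * (g γ).spline.coeffAt (j γ) k)
      (fun k hk => hb.mul (ht.coeffAt hj hlt hk)) hlo hstep
  obtain ⟨G, hG, hGs⟩ := exists_polyNum_isGreatest_cubic
    (D := fun γ => D γ ∧ (g γ).firstIndex (j γ) ≤ (g γ).lastIndex (j γ)) (c := c)
    (a := fun γ => (g γ).firstIndex (j γ)) (b := fun γ => (g γ).lastIndex (j γ))
    (fun k _ => (hcN k).mono fun _ h => h.1) (hfirst.mono fun _ h => h.1)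
    (hlast.mono fun _ h => h.1) fun γ hγ => hγ.2
  have hd : PolyNum bitMachine D xs fun γ => b γ * (g γ).spline.eval (g γ).lo :=
    hb.mul (PolyList.splineEval ht hlo)
  have hp : PolyPred bitMachine D xs fun γ => (g γ).firstIndex (j γ) ≤ (g γ).lastIndex (j γ) :=
    (PolyPred.le hfirst hlast).congr fun γ _ => Int.cast_le.symm
  refine ⟨_, PolyNum.ite hp ((hd.mono fun _ h => h.1).max hG) (hd.mono fun _ h => h.1),
    fun γ hγ => ?_⟩
  rw [(g γ).dom_inter_onPiece, Set.image_image]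
  split_ifs with h
  · refine isGreatest_singleton.union ?_
    simpa only [hc, cubic_shiftCoeff] using hGs γ ⟨hγ, h⟩
  · rw [Set.Icc_eq_empty h, Set.image_empty, Set.union_empty]
    exact isGreatest_singleton

lemma GridSpline.image_eval_eq (g : GridSpline) (b : ℚ) :
    (fun v => b * g.spline.eval v) '' discreteSplines.dom g =
      {w | ∃ j < g.spline.pieces, w ∈ {b * g.spline.eval g.lo} ∪
        cubic (fun k => b * g.spline.coeffAt j k) ''
          {v | v ∈ discreteSplines.dom g ∧ g.spline.OnPiece j v}} := by
  have h := g.spline.image_eval_eq (fun v hv => GridSpline.bounds_of_mem_dom hv) b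
  ext w
  constructor
  · intro hw
    rw [h] at hw
    obtain ⟨j, hj, hw⟩ := hw
    exact ⟨j, hj, .inr hw⟩
  · rintro ⟨j, hj, hw | hw⟩
    · exact ⟨g.lo, g.lo_mem_dom, (Set.mem_singleton_iff.1 hw).symm⟩
    · rw [h]
      exact ⟨j, hj, hw⟩

lemma discreteSplines_tractable : discreteSplines.Tractable bitMachine := by
  set xs : List (GridSpline × ℚ → List ℚ) := [fun p => p.1.code, fun p => [p.2]] with hxs
  have hcode : ∀ {D : GridSpline × ℚ → Prop}, PolyList bitMachine D xs fun p => p.1.code :=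
    PolyList.var (by simp [hxs])
  have hpt : ∀ {D : GridSpline × ℚ → Prop}, PolyNum bitMachine D xs fun p => p.2 :=
    PolyList.var (by simp [hxs])
  have hspline : ∀ {D : GridSpline × ℚ → Prop}, PolyList bitMachine D xs
      fun p => p.1.spline.code := fun {D} => (hcode (D := D)).tail.tail.tail
  set D : GridSpline × ℚ → Prop := fun p => (discreteSplines.dom p.1).Nonempty with hD
  set E : (GridSpline × ℚ) × ℕ → Prop := fun p => D p.1 ∧ p.2 < p.1.1.spline.pieces with hE
  set zs : List ((GridSpline × ℚ) × ℕ → List ℚ) := liftFst xs ++ [loopIndex ℚ (GridSpline × ℚ)]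
    with hzs
  have hg : PolyList bitMachine E zs fun p => p.1.1.code :=
    PolyList.lift (f := fun p : GridSpline × ℚ => p.1.code) (hcode (D := D)) (fun p hp => hp.1)
      (by simp [hzs])
  have hb : PolyNum bitMachine E zs fun p => p.1.2 :=
    PolyNum.lift (f := fun p : GridSpline × ℚ => p.2) (hpt (D := D)) (fun p hp => hp.1)
      (by simp [hzs])
  have hj : PolyNum bitMachine E zs fun p => (p.2 : ℚ) := PolyNum.counter (by simp [hzs])
  obtain ⟨Q, hQ, hQs⟩ := exists_polyNum_isGreatest_onPiece
    (g := fun p : (GridSpline × ℚ) × ℕ => p.1.1) (b := fun p : (GridSpline × ℚ) × ℕ => p.1.2)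
    (j := fun p : (GridSpline × ℚ) × ℕ => p.2) hg hb hj fun p hp => hp.2
  have heval : PolyNum bitMachine (fun p : GridSpline × ℚ => p.2 ∈ discreteSplines.dom p.1) xs
      fun p => p.1.spline.eval p.2 :=
    PolyList.splineEval (t := fun p : GridSpline × ℚ => p.1.spline) hspline hpt
  have hsup : PolyPair bitMachine D xs fun p =>
      maxUpTo (fun i => toLex (Q (p, i), 0)) p.1.spline.pieces :=
    PolyPair.maxUpTo (N := fun p : GridSpline × ℚ => p.1.spline.pieces) (D := D) (xs := xs)
      (q := fun p : (GridSpline × ℚ) × ℕ => toLex (Q p, 0))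
      (PolyList.pieces (t := fun p : GridSpline × ℚ => p.1.spline) hspline)
      (PolyList.bounded_pieces (t := fun p : GridSpline × ℚ => p.1.spline) hspline)
      (fun p _ => p.1.spline.pieces_pos) (PolyPair.mk hQ .zero)
  refine ⟨heval, fun g b => maxUpTo (fun j => toLex (Q ((g, b), j), 0)) g.spline.pieces, ?_, hsup⟩
  intro g b hne
  have key := IsLexSup.maxUpTo (n := g.spline.pieces)
    (V := fun j => {b * g.spline.eval g.lo} ∪ cubic (fun k => b * g.spline.coeffAt j k) ''
      {v | v ∈ discreteSplines.dom g ∧ g.spline.OnPiece j v})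
    (q := fun j => toLex (Q ((g, b), j), 0)) g.spline.pieces_pos fun j hj =>
      (hQs ((g, b), j) ⟨hne, hj⟩).isLexSup
  rw [← g.image_eval_eq b] at key
  exact key

end Grid

theorem proposition1 :
    -- any GAM over an enumerable discrete domain
    (∀ C : ComponentClass, C.HasPolyTimeInference →
      SolvableInPolyTime bitMachine SubsetInstance.encode (CSR (F := enumeratedFeatures C)) ∧
      SolvableInPolyTime bitMachine BoundInstance.encode (MCR (F := enumeratedFeatures C)) ∧
      SolvableInPolyTime bitMachine BoundInstance.encode (MSR (F := enumeratedFeatures C))) ∧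
    -- Smooth GAMs over a general discrete domain
    (SolvableInPolyTime bitMachine SubsetInstance.encode (CSR (F := discreteSplines)) ∧
      SolvableInPolyTime bitMachine BoundInstance.encode (MCR (F := discreteSplines)) ∧
      SolvableInPolyTime bitMachine BoundInstance.encode (MSR (F := discreteSplines))) ∧
    -- Smooth GAMs over a continuous domain
    (SolvableInPolyTime realMachine SubsetInstance.encode (CSR (F := continuousSplines)) ∧
      SolvableInPolyTime realMachine BoundInstance.encode (MCR (F := continuousSplines)) ∧
      SolvableInPolyTime realMachine BoundInstance.encode (MSR (F := continuousSplines))) := by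
  exact ⟨fun _ hC => have h := enumeratedFeatures_tractable hC
      ⟨h.solvable_CSR, h.solvable_MCR, h.solvable_MSR⟩,
    have h := discreteSplines_tractable
    ⟨h.solvable_CSR, h.solvable_MCR, h.solvable_MSR⟩,
    have h := continuousSplines_tractable
    ⟨h.solvable_CSR, h.solvable_MCR, h.solvable_MSR⟩⟩
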